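/- For a lattice $\Lambda\subset\mathbb R^n$ of full rank let $V=\{x : |x|\le |x-y| \text{ for all } y\in\Lambda\}$ be its Voronoi cell around the origin, and let $\Lambda^*=\{x : x\cdot y\in\mathbb Z \text{ for all } y\in\Lambda\}$ be its dual. Call $\Lambda$ isodual if $\Lambda^*=c\,g(\Lambda)$ for some $c>0$ and some linear isometry $g$ of $\mathbb R^n$. When $V$ has volume 1, put $G(\Lambda)=\frac1n\int_V x\cdot x\,dx$. The mean-centered cuboidal lattice $M_3$ is the lattice in $\mathbb R^3$, determined up to isometry, that has a basis with Gram matrix $$\frac12\begin{pmatrix}1+\sqrt2&-1&-1\\-1&1+\sqrt2&1-\sqrt2\\-1&1-\sqrt2&1+\sqrt2\end{pmatrix}.$$ **Theorem.** The lattice $M_3$ exists, is isodual, and its Voronoi cell has volume 1. Among all isodual lattices in $\mathbb R^3$ whose Voronoi cell has volume 1, $M_3$ has the smallest normalized second moment $G$, and every lattice among them with the same value of $G$ is isometric to $M_3$. This smallest value is $$G(M_3)=\frac{17+4\sqrt2}{288}.$$ Moreover, up to isometry, $M_3$ is the only one of these lattices at which $G$ has a local minimum (that is, a local minimum of the restriction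 of $G$ to these lattices, where two lattices are close if they have bases that are close), and $G$ does have a local minimum there. -/

import Mathlib

open MeasureTheory Module

/-- The Voronoi cell around the origin of `L`: the points that are at least as close to the
origin as to any other point of `L`. -/
def voronoiCell {n : ℕ} (L : Submodule ℤ (EuclideanSpace ℝ (Fin n))) :
    Set (EuclideanSpace ℝ (Fin n)) :=
  {x | ∀ y ∈ L, ‖x‖ ≤ ‖x - y‖}

/-- The second moment `G = (1/n) ∫_V x · x dx` of the Voronoi cell `V` of `L`; it is the
normalized second moment when `V` has unit volume. -/
noncomputable def secondMoment {n : ℕ} (L : Submodule ℤ (EuclideanSpace ℝ (Fin n))) : ℝ :=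
  (1 / (n : ℝ)) * ∫ x in voronoiCell L, inner ℝ x x

/-- The dual of `L`: all vectors that have integral inner product with every vector of `L`. -/
noncomputable def dualLattice {n : ℕ} (L : Submodule ℤ (EuclideanSpace ℝ (Fin n))) :
    Submodule ℤ (EuclideanSpace ℝ (Fin n)) :=
  LinearMap.BilinForm.dualSubmodule (innerₗ (EuclideanSpace ℝ (Fin n))) L

/-- `L` is geometrically similar to its dual: a positive multiple of a linear isometry maps
`L` onto the dual of `L`. -/
def IsIsodual {n : ℕ} (L : Submodule ℤ (EuclideanSpace ℝ (Fin n))) : Prop :=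
  ∃ (c : ℝ) (g : EuclideanSpace ℝ (Fin n) ≃ₗᵢ[ℝ] EuclideanSpace ℝ (Fin n)), 0 < c ∧
    (fun x => c • g x) '' (L : Set (EuclideanSpace ℝ (Fin n))) =
      (dualLattice L : Set (EuclideanSpace ℝ (Fin n)))

/-- `L` is an `n`-dimensional isodual lattice, scaled so that its Voronoi cell has volume 1.
The first two fields say that `L` is a full lattice (`IsZLattice`). -/
structure IsUnitIsodualLattice {n : ℕ} (L : Submodule ℤ (EuclideanSpace ℝ (Fin n))) :
    Prop where
  discrete : DiscreteTopology L
  span_eq_top : Submodule.span ℝ (L : Set (EuclideanSpace ℝ (Fin n))) = ⊤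
  isodual : IsIsodual L
  volume_eq_one : volume (voronoiCell L) = 1

/-- `G` has a local minimum at `L` among the `n`-dimensional isodual lattices with Voronoi cell
of volume 1. The topology on lattices is the usual one, that of `GL n ℝ / GL n ℤ`: the
lattices close to `L` are those with a basis close to a given basis of `L`. (The `n`-tuples `v`
below are automatically linearly independent over `ℝ`, since they span.) -/
def IsLocalMinIsodual {n : ℕ} (L : Submodule ℤ (EuclideanSpace ℝ (Fin n))) : Prop :=
  ∀ b : Basis (Fin n) ℤ L,
    IsLocalMinOn
      (fun v : Fin n → EuclideanSpace ℝ (Fin n) =>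
        secondMoment (Submodule.span ℤ (Set.range v)))
      {v | IsUnitIsodualLattice (Submodule.span ℤ (Set.range v))}
      (fun i => (b i : EuclideanSpace ℝ (Fin n)))

/-- A Gram matrix of the mean-centered cuboidal lattice. -/
noncomputable def mccGram : Matrix (Fin 3) (Fin 3) ℝ :=
  (1 / 2 : ℝ) • !![1 + √2, -1, -1; -1, 1 + √2, 1 - √2; -1, 1 - √2, 1 + √2]

/-- `L` is (an isometric copy of) the mean-centered cuboidal lattice: it has a basis with Gram
matrix `mccGram`. -/
def IsMCC (L : Submodule ℤ (EuclideanSpace ℝ (Fin 3))) : Prop :=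
  ∃ b : Basis (Fin 3) ℤ L, ∀ i j,
    inner ℝ (b i : EuclideanSpace ℝ (Fin 3)) (b j : EuclideanSpace ℝ (Fin 3)) = mccGram i j

open Matrix Filter Topology

/-! Everything is expressed through Gram matrices. A lattice with Gram matrix `A` of determinant 1
is isodual exactly if `Bᵀ A⁻¹ B = A` for some integral unimodular `B`
(`isUnitIsodualLattice_of_gram`, `isIsodualGram_of_isUnitIsodualLattice`). Here `A⁻¹ B` is an
isometry of the form `A`, and `B` may be treated as a bilinear form, since it transforms like `A`
under changes of basis.

The classification is `IsoPair.isReducible`. If `B` is symmetric, a short vector of `A` shows that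
`B` takes a nontrivial value of absolute value at most 1, so up to sign `B` is equivalent to the
identity or to `D = diag(1, -1, -1)`. The identity forces `A = 1`. For `D` one gets `A = 2uuᵀ - D`
with `u` on the hyperboloid `u₁² - u₂² - u₃² = 1`, and the integral automorphs of `D` move `u` into
a triangle with coordinates `a, b, c ≥ 0`; its sides are decomposable lattices. If `B` is not
symmetric, the isometry is, up to sign, a rotation about a lattice vector. The orthogonal plane
lattice then has determinant 1, 2, 3 or 4, which yields respectively an orthogonal sum with `ℤ`, the
lattice `M₃`, the cubic lattice, and a contradiction.

All normal forms have an obtuse superbase, that is, nonnegative conorms `p`. Their Voronoi cells are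
zonotopes, tiled by the 16 parallelepipeds that belong to the spanning trees of the complete graph
on four vertices. Integration over the tiles makes the second moment an explicit polynomial in `p`
(`secondMoment_eq_of_gram`).

What remains is calculus. Inside the triangle the Lagrange equations have `M₃` as their only
solution (`eq_mcc_of_lagrange`). Decomposable lattices have larger moment, by Schur's inequality
(`mcc_lt_decomposable`). As the moment is coercive, its minimum on the closed triangle exists and is
attained at `M₃` only. A decomposable local minimum would have to be the sum of `ℤ` and a hexagonal
lattice, and that lattice can be improved by deforming it into the triangle
(`not_isLocalMinIsodual_decomposable`). -/

/-! ### The Voronoi cell as a fundamental domain -/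

theorem isClosed_voronoiCell {n : ℕ} (L : Submodule ℤ (EuclideanSpace ℝ (Fin n))) :
    IsClosed (voronoiCell L) := by
  have : voronoiCell L = ⋂ y ∈ L, {x | ‖x‖ ≤ ‖x - y‖} := by
    ext x; simp [voronoiCell]
  rw [this]
  refine isClosed_biInter fun y _ => isClosed_le (by fun_prop) (by fun_prop)

theorem exists_vadd_mem_voronoiCell {n : ℕ} (b : Basis (Fin n) ℝ (EuclideanSpace ℝ (Fin n)))
    (x : EuclideanSpace ℝ (Fin n)) :
    ∃ g : Submodule.span ℤ (Set.range b), g +ᵥ x ∈ voronoiCell (Submodule.span ℤ (Set.range b)) := by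
  set L := Submodule.span ℤ (Set.range b)
  -- The sought `-g` is a lattice point nearest to `x`. The choice `g = 0` gives norm `‖x‖`, so only
  -- `‖g‖ ≤ 2‖x‖` can compete, and this leaves finitely many candidates.
  have hfin : (Metric.closedBall (0 : EuclideanSpace ℝ (Fin n)) (2 * ‖x‖) ∩ (L : Set _)).Finite :=
    ZSpan.setFinite_inter b Metric.isBounded_closedBall
  obtain ⟨g, ⟨hgb, hgL⟩, hg⟩ := Set.exists_min_image _ (fun g => ‖g + x‖) hfin
    ⟨0, by simp, L.zero_mem⟩
  refine ⟨⟨g, hgL⟩, fun y hy => ?_⟩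
  change ‖g + x‖ ≤ ‖g + x - y‖
  by_cases h : ‖g - y‖ ≤ 2 * ‖x‖
  · have := hg (g - y) ⟨by simpa using h, L.sub_mem hgL hy⟩
    rwa [show g - y + x = g + x - y by abel] at this
  · have h0 := hg 0 ⟨by simp, L.zero_mem⟩
    have h1 : ‖g - y‖ ≤ ‖g + x - y‖ + ‖x‖ := by
      calc ‖g - y‖ = ‖(g + x - y) - x‖ := by congr 1; abel
        _ ≤ _ := norm_sub_le _ _
    simp only [zero_add] at h0
    linarith

-- The overlap of two translated cells lies in the perpendicular bisector of their centres, a null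
-- set.
open Pointwise in
theorem aedisjoint_vadd_voronoiCell {n : ℕ} {L : Submodule ℤ (EuclideanSpace ℝ (Fin n))}
    (g : L) (hg : g ≠ 0) : AEDisjoint volume (g +ᵥ voronoiCell L) (voronoiCell L) := by
  have hne : AffineSubspace.perpBisector (0 : EuclideanSpace ℝ (Fin n)) (g : EuclideanSpace ℝ (Fin n)) ≠ ⊤ := by
    rw [Ne, AffineSubspace.perpBisector_eq_top]
    exact fun h => hg (Subtype.ext h.symm)
  refine measure_mono_null ?_ (Measure.addHaar_affineSubspace volume _ hne)
  rintro x ⟨⟨y, hy, rfl⟩, hx⟩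
  change (g : EuclideanSpace ℝ (Fin n)) + y ∈ _
  rw [SetLike.mem_coe, AffineSubspace.mem_perpBisector_iff_dist_eq, dist_eq_norm, dist_eq_norm]
  have h1 : ‖(g : EuclideanSpace ℝ (Fin n)) + y‖ ≤ ‖(g : EuclideanSpace ℝ (Fin n)) + y - g‖ :=
    hx _ g.2
  have h2 := hy _ (L.neg_mem g.2)
  rw [show y - -(g : EuclideanSpace ℝ (Fin n)) = g + y by abel] at h2
  rw [add_sub_cancel_left, sub_zero] at *
  exact le_antisymm h1 h2

theorem isAddFundamentalDomain_voronoiCell {n : ℕ}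
    (b : Basis (Fin n) ℝ (EuclideanSpace ℝ (Fin n))) :
    IsAddFundamentalDomain (Submodule.span ℤ (Set.range b))
      (voronoiCell (Submodule.span ℤ (Set.range b))) volume := by
  refine IsAddFundamentalDomain.mk'' (isClosed_voronoiCell _).measurableSet.nullMeasurableSet
    (Filter.Eventually.of_forall (exists_vadd_mem_voronoiCell b)) aedisjoint_vadd_voronoiCell ?_
  intro g
  exact (measurePreserving_vadd (g : EuclideanSpace ℝ (Fin n)) volume).quasiMeasurePreserving

theorem volume_voronoiCell {n : ℕ} (b : Basis (Fin n) ℝ (EuclideanSpace ℝ (Fin n))) :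
    volume (voronoiCell (Submodule.span ℤ (Set.range b))) =
      ENNReal.ofReal |(EuclideanSpace.basisFun (Fin n) ℝ).toBasis.det b| := by
  have : VAddInvariantMeasure (Submodule.span ℤ (Set.range b)) (EuclideanSpace ℝ (Fin n)) volume :=
    inferInstanceAs <| VAddInvariantMeasure (Submodule.span ℤ (Set.range b)).toAddSubgroup _ volume
  have h1 := (isAddFundamentalDomain_voronoiCell b).measure_eq
    (ZSpan.isAddFundamentalDomain b volume)
  rw [h1, ZSpan.measure_fundamentalDomain b volume (EuclideanSpace.basisFun (Fin n) ℝ).toBasis,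
    measure_congr (ZSpan.fundamentalDomain_ae_parallelepiped _ volume)]
  have := (EuclideanSpace.basisFun (Fin n) ℝ).volume_parallelepiped
  simp only [OrthonormalBasis.coe_toBasis]
  rw [this, mul_one]

/-! ### Gram matrices, duals and isoduality -/

theorem det_gram_eq_sq {n : ℕ} (v : Fin n → EuclideanSpace ℝ (Fin n)) :
    (Matrix.gram ℝ v).det = ((EuclideanSpace.basisFun (Fin n) ℝ).toBasis.det v) ^ 2 := by
  rw [Matrix.gram_eq_conjTranspose_mul (EuclideanSpace.basisFun (Fin n) ℝ) v, Matrix.det_mul,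
    Matrix.conjTranspose_eq_transpose_of_trivial, Matrix.det_transpose, sq]
  rfl

theorem volume_voronoiCell_eq_one_iff {n : ℕ} (b : Basis (Fin n) ℝ (EuclideanSpace ℝ (Fin n))) :
    volume (voronoiCell (Submodule.span ℤ (Set.range b))) = 1 ↔ (Matrix.gram ℝ b).det = 1 := by
  rw [volume_voronoiCell, det_gram_eq_sq, ENNReal.ofReal_eq_one, ← sq_abs,
    pow_eq_one_iff_of_nonneg (abs_nonneg _) two_ne_zero]

theorem exists_isometry_of_gram_eq {n : ℕ} (b c : Basis (Fin n) ℝ (EuclideanSpace ℝ (Fin n)))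
    (h : gram ℝ b = gram ℝ c) :
    ∃ g : EuclideanSpace ℝ (Fin n) ≃ₗᵢ[ℝ] EuclideanSpace ℝ (Fin n), ∀ i, g (b i) = c i := by
  let e := b.equiv c (Equiv.refl _)
  have he : ∀ i, e (b i) = c i := fun i => by simp [e]
  have key : ∀ x y, inner ℝ (e x) (e y) = inner ℝ x y := by
    have : ((innerₗ (EuclideanSpace ℝ (Fin n))).compl₁₂ e.toLinearMap e.toLinearMap) =
        innerₗ (EuclideanSpace ℝ (Fin n)) := by
      refine LinearMap.BilinForm.ext_basis b fun i j => ?_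
      have := congrFun (congrFun h i) j
      simpa [he, gram_apply] using this.symm
    intro x y
    exact LinearMap.congr_fun (LinearMap.congr_fun this x) y
  exact ⟨e.isometryOfInner key, he⟩

theorem gram_basis_expand {n : ℕ} (b : Basis (Fin n) ℝ (EuclideanSpace ℝ (Fin n)))
    (N : Matrix (Fin n) (Fin n) ℝ) :
    gram ℝ (fun i => ∑ k, N k i • b k) = Nᵀ * gram ℝ b * N := by
  ext i j
  rw [gram_apply, sum_inner]
  simp_rw [inner_sum, inner_smul_left, inner_smul_right, Matrix.mul_apply, Finset.sum_mul,
    gram_apply, transpose_apply]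
  rw [Finset.sum_comm]
  refine Finset.sum_congr rfl fun k _ => Finset.sum_congr rfl fun l _ => ?_
  simp; ring

theorem mem_dualLattice_span {n : ℕ} (v : Fin n → EuclideanSpace ℝ (Fin n))
    (x : EuclideanSpace ℝ (Fin n)) :
    x ∈ dualLattice (Submodule.span ℤ (Set.range v)) ↔ ∀ i, ∃ m : ℤ, inner ℝ (v i) x = m := by
  constructor
  · intro h i
    obtain ⟨m, hm⟩ := Submodule.mem_one.1 (h (v i) (Submodule.subset_span ⟨i, rfl⟩))
    refine ⟨m, ?_⟩
    rw [real_inner_comm]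
    simpa using hm.symm
  · intro h
    change ∀ y ∈ _, _
    intro y hy
    induction hy using Submodule.span_induction with
    | mem y hy =>
      obtain ⟨i, rfl⟩ := hy
      obtain ⟨m, hm⟩ := h i
      refine Submodule.mem_one.2 ⟨m, ?_⟩
      rw [real_inner_comm] at hm
      simpa using hm.symm
    | zero => simp
    | add y z _ _ hy hz => rw [map_add]; exact add_mem hy hz
    | smul m y _ hy =>
      rw [map_zsmul]
      exact Submodule.smul_mem _ m hy

theorem mem_span_int_range {n : ℕ} {M : Type*} [AddCommGroup M] (v : Fin n → M) (x : M) :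
    x ∈ Submodule.span ℤ (Set.range v) ↔ ∃ m : Fin n → ℤ, ∑ i, m i • v i = x := by
  rw [Submodule.mem_span_range_iff_exists_fun]

/-- A Gram matrix of determinant 1 belongs to an isodual lattice if some unimodular integral matrix,
regarded as a bilinear form, is an isometry from the form to its inverse. -/
def IsIsodualGram {n : ℕ} (A : Matrix (Fin n) (Fin n) ℝ) : Prop :=
  A.det = 1 ∧ ∃ B : Matrix (Fin n) (Fin n) ℤ, IsUnit B.det ∧
    (B.map (Int.cast : ℤ → ℝ))ᵀ * A⁻¹ * B.map (Int.cast : ℤ → ℝ) = A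

/-- The columns of `A⁻¹ B` are coordinates of vectors `c j` with `⟨b i, c j⟩ = B i j`. Since `B` is
unimodular, they form a basis of the dual lattice, and their Gram matrix `Bᵀ A⁻¹ B = A` is that of
`b`. Hence `b ↦ c` extends to an isometry onto the dual. -/
theorem isUnitIsodualLattice_of_gram {n : ℕ} (b : Basis (Fin n) ℝ (EuclideanSpace ℝ (Fin n)))
    (h : IsIsodualGram (gram ℝ b)) :
    IsUnitIsodualLattice (Submodule.span ℤ (Set.range b)) := by
  obtain ⟨hdet, B, hB, hBA⟩ := h
  set A := gram ℝ b
  set B' := B.map (Int.cast : ℤ → ℝ)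
  have hAu : IsUnit A.det := by rw [hdet]; exact isUnit_one
  have hB' : IsUnit B'.det := by
    have : B'.det = (B.det : ℝ) := (Int.cast_det B).symm
    rw [this]; exact hB.map (Int.castRingHom ℝ)
  set N := A⁻¹ * B'
  have hN : IsUnit N.det := by
    rw [det_mul]; exact (isUnit_nonsing_inv_det _ hAu).mul hB'
  have hAsymm : Aᵀ = A := by
    have := (isHermitian_gram ℝ b); rwa [IsHermitian, conjTranspose_eq_transpose_of_trivial] at this
  have hgram : gram ℝ (fun i => ∑ k, N k i • b k) = A := by
    rw [gram_basis_expand]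
    simp only [N, transpose_mul, transpose_nonsing_inv]
    change B'ᵀ * (Aᵀ)⁻¹ * A * (A⁻¹ * B') = A
    rw [hAsymm, mul_assoc, mul_assoc, mul_nonsing_inv_cancel_left _ _ hAu, ← mul_assoc]
    exact hBA
  have hli : LinearIndependent ℝ (fun i => ∑ k, N k i • b k) :=
    linearIndependent_of_det_gram_ne_zero (by rw [hgram, hdet]; exact one_ne_zero)
  let c : Basis (Fin n) ℝ (EuclideanSpace ℝ (Fin n)) :=
    basisOfLinearIndependentOfCardEqFinrank' _ hli (by simp)
  have hc : ∀ i, c i = ∑ k, N k i • b k := fun i => by simp [c]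
  have hcf : (c : Fin n → _) = (fun i => ∑ k, N k i • b k) := funext hc
  obtain ⟨g, hg⟩ := exists_isometry_of_gram_eq b c (by rw [hcf, hgram])
  have hbc : ∀ i j, inner ℝ (b i) (c j) = B' i j := by
    intro i j
    rw [hc, inner_sum]
    simp_rw [inner_smul_right]
    have : (A * N) i j = B' i j := by rw [mul_nonsing_inv_cancel_left _ _ hAu]
    rw [← this, mul_apply]
    refine Finset.sum_congr rfl fun k _ => ?_
    rw [mul_comm]; rfl
  refine ⟨inferInstance, by simp, ⟨1, g, one_pos, ?_⟩,
    (volume_voronoiCell_eq_one_iff b).2 hdet⟩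
  ext x
  simp only [one_smul, Set.mem_image, SetLike.mem_coe]
  rw [mem_dualLattice_span]
  constructor
  · rintro ⟨y, hy, rfl⟩ i
    obtain ⟨m, rfl⟩ := (mem_span_int_range _ _).1 hy
    refine ⟨∑ j, m j * B i j, ?_⟩
    rw [map_sum, inner_sum]
    push_cast
    refine Finset.sum_congr rfl fun j _ => ?_
    rw [map_zsmul, hg, ← Int.cast_smul_eq_zsmul ℝ, inner_smul_right, hbc]; rfl
  · intro h
    choose m hm using h
    refine ⟨∑ i, (B⁻¹ *ᵥ m) i • b i, (mem_span_int_range _ _).2 ⟨_, rfl⟩, ?_⟩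
    refine InnerProductSpace.ext_inner_left_basis b fun i => ?_
    rw [hm, map_sum, inner_sum]
    have : ∀ j, inner ℝ (b i) (g ((B⁻¹ *ᵥ m) j • b j)) = ((B i j * (B⁻¹ *ᵥ m) j : ℤ) : ℝ) := by
      intro j
      rw [map_zsmul, hg, ← Int.cast_smul_eq_zsmul ℝ, inner_smul_right, hbc]
      push_cast; rw [mul_comm]; rfl
    simp_rw [this]
    rw [← Int.cast_sum]
    congr 1
    have h2 : (B *ᵥ (B⁻¹ *ᵥ m)) i = m i := by
      rw [mulVec_mulVec, mul_nonsing_inv _ hB, one_mulVec]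
    exact h2

theorem exists_basis_span_eq {n : ℕ} {L : Submodule ℤ (EuclideanSpace ℝ (Fin n))}
    (h : IsUnitIsodualLattice L) :
    ∃ b : Basis (Fin n) ℝ (EuclideanSpace ℝ (Fin n)), Submodule.span ℤ (Set.range b) = L := by
  have := h.discrete
  have hz : IsZLattice ℝ L := ⟨h.span_eq_top⟩
  have := ZLattice.module_free ℝ L
  have := ZLattice.module_finite ℝ L
  let b := Module.finBasis ℤ L
  have hr : finrank ℤ L = n := by rw [ZLattice.rank ℝ L]; simp
  let b' := (b.ofZLatticeBasis ℝ L).reindex (finCongr hr)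
  refine ⟨b', ?_⟩
  rw [Basis.range_reindex]
  exact b.ofZLatticeBasis_span ℝ L

/-- `B` consists of the inner products of `b` with the image of `b` under the similarity. They are
integers because this image lies in the dual, and `B` is invertible over `ℤ` because the dual basis
lies in the image of the lattice. -/
theorem isIsodualGram_of_isUnitIsodualLattice {n : ℕ} (hn : n ≠ 0)
    (b : Basis (Fin n) ℝ (EuclideanSpace ℝ (Fin n)))
    (h : IsUnitIsodualLattice (Submodule.span ℤ (Set.range b))) : IsIsodualGram (gram ℝ b) := by
  have hdet := (volume_voronoiCell_eq_one_iff b).1 h.volume_eq_one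
  refine ⟨hdet, ?_⟩
  obtain ⟨c, g, hc, hg⟩ := h.isodual
  set A := gram ℝ b
  have hAu : IsUnit A.det := by rw [hdet]; exact isUnit_one
  have hAsymm : Aᵀ = A := by
    have := (isHermitian_gram ℝ b); rwa [IsHermitian, conjTranspose_eq_transpose_of_trivial] at this
  have h1 : ∀ j i, ∃ m : ℤ, inner ℝ (b i) (c • g (b j)) = m := by
    intro j
    refine (mem_dualLattice_span _ _).1 ?_
    have : c • g (b j) ∈ (fun x => c • g x) '' (Submodule.span ℤ (Set.range b) : Set _) :=
      ⟨b j, Submodule.subset_span ⟨j, rfl⟩, rfl⟩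
    rw [hg] at this
    exact this
  choose B hB using h1
  let B0 : Matrix (Fin n) (Fin n) ℤ := of fun i j => B j i
  let N : Matrix (Fin n) (Fin n) ℝ := of fun k j => b.repr (c • g (b j)) k
  have hN : ∀ j, ∑ k, N k j • b k = c • g (b j) := fun j => b.sum_repr _
  have hAN : A * N = B0.map (Int.cast : ℤ → ℝ) := by
    ext i j
    have : (B0.map (Int.cast : ℤ → ℝ)) i j = inner ℝ (b i) (c • g (b j)) := (hB j i).symm
    rw [this, ← hN, inner_sum, mul_apply]
    refine Finset.sum_congr rfl fun k _ => ?_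
    rw [inner_smul_right, mul_comm]; rfl
  have hNA : N = A⁻¹ * B0.map (Int.cast : ℤ → ℝ) := by
    rw [← hAN, nonsing_inv_mul_cancel_left _ _ hAu]
  have hgr : Nᵀ * A * N = c ^ 2 • A := by
    rw [← gram_basis_expand]
    ext i j
    rw [gram_apply, hN, hN, inner_smul_left, inner_smul_right, g.inner_map_map]
    simp [A, gram_apply, sq, mul_assoc]
  have hB2 : (B0.map (Int.cast : ℤ → ℝ))ᵀ * A⁻¹ * B0.map (Int.cast : ℤ → ℝ) = c ^ 2 • A := by
    rw [← hgr, mul_assoc _ A⁻¹, ← hNA, ← hAN, transpose_mul, hAsymm]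
  have hunit : IsUnit B0.det := by
    -- the dual basis is the image of integral combinations
    have hinv : ∀ i, ∃ m : Fin n → ℤ, ∀ j, ∑ k, B0 j k * m k = if j = i then 1 else 0 := by
      intro i
      have hx : ∃ x : EuclideanSpace ℝ (Fin n), ∀ j, inner ℝ (b j) x = if j = i then 1 else 0 := by
        refine ⟨∑ k, (A⁻¹) k i • b k, fun j => ?_⟩
        have : (A * A⁻¹) j i = if j = i then 1 else 0 := by
          rw [mul_nonsing_inv _ hAu, one_apply]
        rw [← this, inner_sum, mul_apply]
        refine Finset.sum_congr rfl fun k _ => ?_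
        rw [inner_smul_right, mul_comm]; rfl
      obtain ⟨x, hx⟩ := hx
      have hxd : x ∈ (dualLattice (Submodule.span ℤ (Set.range b)) : Set _) := by
        rw [SetLike.mem_coe, mem_dualLattice_span]
        intro j
        rw [hx]
        exact ⟨if j = i then 1 else 0, by push_cast; rfl⟩
      rw [← hg] at hxd
      obtain ⟨y, hy, rfl⟩ := hxd
      obtain ⟨m, rfl⟩ := (mem_span_int_range _ _).1 hy
      refine ⟨m, fun j => ?_⟩
      have := hx j
      simp only [map_sum, map_zsmul, Finset.smul_sum] at this
      rw [inner_sum] at this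
      have h3 : ∀ k, inner ℝ (b j) (c • m k • g (b k)) = ((B0 j k * m k : ℤ) : ℝ) := by
        intro k
        rw [smul_comm, ← Int.cast_smul_eq_zsmul ℝ, inner_smul_right, hB]
        push_cast; rw [mul_comm]; rfl
      simp_rw [h3] at this
      exact_mod_cast this
    choose m hm using hinv
    have : B0 * (of fun k i => m i k) = 1 := by
      ext j i
      rw [mul_apply, one_apply]
      exact hm i j
    exact isUnit_det_of_right_inverse this
  -- Comparing determinants gives `(c²)ⁿ = 1`, whence the condition `n ≠ 0`.
  have hc1 : c ^ 2 = 1 := by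
    have h4 := congrArg det hB2
    rw [det_mul, det_mul, det_transpose, det_smul, hdet, det_nonsing_inv, hdet] at h4
    have h5 : (B0.map (Int.cast : ℤ → ℝ)).det = (B0.det : ℝ) := (Int.cast_det B0).symm
    rw [h5] at h4
    have h6 : (B0.det : ℝ) * B0.det = 1 := by
      rcases Int.isUnit_iff.1 hunit with h | h <;> rw [h] <;> norm_num
    simp only [Ring.inverse_one, mul_one, h6, Fintype.card_fin] at h4
    exact (pow_eq_one_iff_of_nonneg (sq_nonneg c) hn).1 h4.symm
  rw [hc1, one_smul] at hB2
  exact ⟨B0, hunit, hB2⟩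

/-! ### Integration over boxes -/

/-- The open box centred at the origin with side lengths `r`. -/
def centeredBox {n : ℕ} (r : Fin n → ℝ) : Set (Fin n → ℝ) :=
  Set.univ.pi fun k => Set.Ioo (-(r k / 2)) (r k / 2)

theorem volume_centeredBox {n : ℕ} (r : Fin n → ℝ) :
    volume (centeredBox r) = ∏ k, ENNReal.ofReal (r k) := by
  rw [centeredBox, Real.volume_pi_Ioo]
  refine Finset.prod_congr rfl fun k _ => ?_
  congr 1; ring

theorem measurableSet_centeredBox {n : ℕ} (r : Fin n → ℝ) : MeasurableSet (centeredBox r) :=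
  MeasurableSet.univ_pi fun _ => measurableSet_Ioo

theorem integrableOn_centeredBox {n : ℕ} (r : Fin n → ℝ) {f : (Fin n → ℝ) → ℝ}
    (hf : Continuous f) : IntegrableOn f (centeredBox r) := by
  refine (hf.continuousOn.integrableOn_compact
    (isCompact_univ_pi fun k => isCompact_Icc (a := -(r k / 2)) (b := r k / 2))).mono_set ?_
  exact Set.pi_mono fun k _ => Set.Ioo_subset_Icc_self

theorem integral_centeredBox_monomial {n : ℕ} {r : Fin n → ℝ} (hr : ∀ k, 0 ≤ r k) (e : Fin n → ℕ) :
    ∫ z in centeredBox r, ∏ k, z k ^ e k =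
      ∏ k, (((r k / 2) ^ (e k + 1) - (-(r k / 2)) ^ (e k + 1)) / (e k + 1)) := by
  rw [centeredBox, volume_pi, Measure.restrict_pi_pi,
    integral_fintype_prod_eq_prod (fun k (x : ℝ) => x ^ e k)]
  refine Finset.prod_congr rfl fun k _ => ?_
  rw [← integral_Ioc_eq_integral_Ioo,
    ← intervalIntegral.integral_of_le (by linarith [hr k]), integral_pow]

/-- Linear terms and mixed products are odd in some coordinate and integrate to zero; the mean of `z
k ^ 2` is `r k ^ 2 / 12`. -/
theorem integral_centeredBox_quadratic {r : Fin 3 → ℝ} (hr : ∀ k, 0 ≤ r k) (α : ℝ)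
    (β : Fin 3 → ℝ) (γ : Fin 3 → Fin 3 → ℝ) :
    ∫ z in centeredBox r, (α + ∑ k, β k * z k + ∑ k, ∑ l, γ k l * (z k * z l)) =
      (∏ k, r k) * (α + ∑ k, γ k k * (r k ^ 2 / 12)) := by
  have h0 : ∫ z in centeredBox r, α = (∏ k, r k) * α := by
    have := integral_centeredBox_monomial hr (fun _ => 0)
    rw [setIntegral_const, smul_eq_mul]
    congr 1
    rw [measureReal_def, volume_centeredBox, ENNReal.toReal_prod]
    exact Finset.prod_congr rfl fun k _ => ENNReal.toReal_ofReal (hr k)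
  have hs : ∀ (k : Fin 3) (z : Fin 3 → ℝ), ∏ i, z i ^ (Pi.single k 1 : Fin 3 → ℕ) i = z k := by
    intro k z
    rw [Finset.prod_eq_single k] <;> simp +contextual
  have h1 : ∀ k, ∫ z in centeredBox r, β k * z k = 0 := by
    intro k
    rw [integral_const_mul]
    have := integral_centeredBox_monomial hr (Pi.single k 1)
    simp_rw [hs] at this
    rw [this, Finset.prod_eq_zero (Finset.mem_univ k), mul_zero]
    simp
  have h2 : ∀ k l, ∫ z in centeredBox r, γ k l * (z k * z l) =
      if k = l then (∏ k, r k) * (γ k k * (r k ^ 2 / 12)) else 0 := by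
    intro k l
    rw [integral_const_mul]
    have := integral_centeredBox_monomial hr (Pi.single k 1 + Pi.single l 1)
    have h2 : ∀ z : Fin 3 → ℝ, ∏ i, z i ^ (Pi.single k 1 + Pi.single l 1 : Fin 3 → ℕ) i =
        z k * z l := by
      intro z
      simp_rw [Pi.add_apply, pow_add]
      rw [Finset.prod_mul_distrib, hs, hs]
    simp_rw [h2] at this
    rw [this]
    split_ifs with h
    · subst h
      fin_cases k <;> simp [Fin.prod_univ_three] <;> ring
    · rw [Finset.prod_eq_zero (Finset.mem_univ k), mul_zero]
      simp [h]
  have hi1 : ∀ k, IntegrableOn (fun z : Fin 3 → ℝ => β k * z k) (centeredBox r) := fun k =>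
    integrableOn_centeredBox r (by fun_prop)
  have hi2 : ∀ k l, IntegrableOn (fun z : Fin 3 → ℝ => γ k l * (z k * z l)) (centeredBox r) :=
    fun k l => integrableOn_centeredBox r (by fun_prop)
  rw [integral_add (integrableOn_centeredBox r (by fun_prop))
      (integrableOn_centeredBox r (by fun_prop)),
    integral_add (integrableOn_centeredBox r (by fun_prop))
      (integrableOn_centeredBox r (by fun_prop)), h0,
    integral_finsetSum _ fun k _ => hi1 k,
    integral_finsetSum _ fun k _ => integrable_finsetSum _ fun l _ => hi2 k l]
  simp_rw [h1, integral_finsetSum _ fun l _ => hi2 _ l, h2]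
  simp [mul_add, Finset.mul_sum]

theorem measurePreserving_mulVec_add {n : ℕ} {M : Matrix (Fin n) (Fin n) ℝ} (hM : |M.det| = 1)
    (c : Fin n → ℝ) : MeasurePreserving (fun z => M *ᵥ z + c) volume volume := by
  have hM0 : M.det ≠ 0 := by
    intro h; rw [h] at hM; simp at hM
  have h1 : MeasurePreserving (toLin' M) volume volume := by
    refine ⟨(toLin' M).continuous_of_finiteDimensional.measurable, ?_⟩
    rw [Real.map_matrix_volume_pi_eq_smul_volume_pi hM0, abs_inv, hM]
    simp
  exact (measurePreserving_add_right volume c).comp h1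

theorem measurableEmbedding_mulVec_add {n : ℕ} {M : Matrix (Fin n) (Fin n) ℝ} (hM : |M.det| = 1)
    (c : Fin n → ℝ) : MeasurableEmbedding (fun z => M *ᵥ z + c) := by
  have hM0 : IsUnit M.det := by
    rw [isUnit_iff_ne_zero]; intro h; rw [h] at hM; simp at hM
  refine Continuous.measurableEmbedding (by fun_prop) fun x y h => ?_
  have h1 : M *ᵥ x = M *ᵥ y := add_right_cancel h
  have := congrArg (M⁻¹ *ᵥ ·) h1
  simpa [mulVec_mulVec, nonsing_inv_mul _ hM0] using this

/-! ### The complete graph on four vertices -/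

/-- Coordinates (those of the vertices 1, 2, 3) of the edges 01, 02, 03, 12, 13, 23 of the
complete graph on 0, 1, 2, 3. -/
def edgeVec : Fin 6 → Fin 3 → ℤ :=
  ![![-1, 0, 0], ![0, -1, 0], ![0, 0, -1], ![1, -1, 0], ![1, 0, -1], ![0, 1, -1]]

/-- The edges of the 16 spanning trees. -/
def treeEdge : Fin 16 → Fin 3 → Fin 6 :=
  ![![0, 1, 2], ![0, 1, 4], ![0, 1, 5], ![0, 2, 3], ![0, 2, 5], ![0, 3, 4], ![0, 3, 5], ![0, 4, 5],
    ![1, 2, 3], ![1, 2, 4], ![1, 3, 4], ![1, 3, 5], ![1, 4, 5], ![2, 3, 4], ![2, 3, 5], ![2, 4, 5]]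

/-- Signs of the edges outside each spanning tree, zero on the tree itself, that place the
parallelepipeds spanned by the trees so that they tile the graphical zonotope. -/
def treeSign : Fin 16 → Fin 6 → ℤ :=
  ![![0, 0, 0, 1, 1, 1], ![0, 0, -1, 1, 0, 1], ![0, 0, -1, 1, -1, 0], ![0, -1, 0, 0, 1, 1],
    ![0, 1, 0, 1, 1, 0], ![0, -1, -1, 0, 0, 1], ![0, -1, -1, 0, -1, 0], ![0, 1, -1, 1, 0, 0],
    ![1, 0, 0, 0, 1, 1], ![1, 0, 0, -1, 0, 1], ![1, 0, -1, 0, 0, 1], ![1, 0, -1, 0, -1, 0],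
    ![-1, 0, -1, 1, 0, 0], ![1, 1, 0, 0, 0, 1], ![1, 1, 0, 0, -1, 0], ![1, 1, 0, 1, 0, 0]]

/-- The cuts of the complete graph, with both orientations. -/
def graphCut : Fin 14 → Fin 3 → ℤ :=
  ![![1, 0, 0], ![0, 1, 0], ![0, 0, 1], ![1, 1, 0], ![1, 0, 1], ![0, 1, 1], ![1, 1, 1],
    ![-1, 0, 0], ![0, -1, 0], ![0, 0, -1], ![-1, -1, 0], ![-1, 0, -1], ![0, -1, -1], ![-1, -1, -1]]

/-- Two tiles lie on different sides of a plane normal to a cut. On a tile, the linear function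
given by a cut splits into contributions of the six edges: a tree edge contributes anything up to
its absolute value times half the conorm, any other edge exactly its sign. The comparison is made
edge by edge and thus holds for all nonnegative conorms at once. The last clause makes it strict,
because the tiles are open. -/
theorem exists_separating_cut : ∀ i j : Fin 16, i ≠ j → ∃ c : Fin 14,
    (∀ e : Fin 6,
      (if treeSign i e = 0 then |∑ k, graphCut c k * edgeVec e k|
        else treeSign i e * ∑ k, graphCut c k * edgeVec e k) ≤
      (if treeSign j e = 0 then -|∑ k, graphCut c k * edgeVec e k|
        else treeSign j e * ∑ k, graphCut c k * edgeVec e k)) ∧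
    ∃ l : Fin 3, ∑ k, graphCut c k * edgeVec (treeEdge i l) k ≠ 0 := by
  decide +kernel

theorem treeEdge_injective : ∀ i, Function.Injective (treeEdge i) := by
  unfold Function.Injective; decide +kernel

theorem image_treeEdge : ∀ i, Finset.univ.image (treeEdge i) =
    Finset.univ.filter fun e => treeSign i e = 0 := by decide +kernel

theorem treeSign_bound : ∀ i e, |treeSign i e| ≤ 1 := by decide +kernel

theorem sum_treeEdge (i : Fin 16) (f : Fin 6 → ℝ) :
    ∑ k, f (treeEdge i k) = ∑ e, if treeSign i e = 0 then f e else 0 := by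
  rw [← Finset.sum_filter, ← image_treeEdge, Finset.sum_image fun _ _ _ _ h => treeEdge_injective i h]

/-- The edges of a spanning tree, as the columns of a matrix. -/
def treeMatrix (i : Fin 16) : Matrix (Fin 3) (Fin 3) ℤ := of fun c k => edgeVec (treeEdge i k) c

theorem abs_det_treeMatrix (i : Fin 16) : |((treeMatrix i).map (Int.cast : ℤ → ℝ)).det| = 1 := by
  have h : ∀ i, |(treeMatrix i).det| = 1 := by
    simp_rw [det_fin_three]; decide +kernel
  have h2 : ((treeMatrix i).map (Int.cast : ℤ → ℝ)).det = ((treeMatrix i).det : ℝ) :=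
    (Int.cast_det _).symm
  rw [h2, ← Int.cast_abs, h, Int.cast_one]

/-! ### Tiling the Voronoi cell by the parallelepipeds of the spanning trees -/

/-- The Gram matrix of `v₁, v₂, v₃` for a superbase `v₀, v₁, v₂, v₃` with the given conorms
`p = -vᵢ ⬝ vⱼ`, indexed by the edges 01, 02, 03, 12, 13, 23. -/
def conormGram (p : Fin 6 → ℝ) : Matrix (Fin 3) (Fin 3) ℝ :=
  of fun a b => ∑ e, p e * edgeVec e a * edgeVec e b

/-- The centre of the parallelepiped of a spanning tree. -/
noncomputable def tileCenter (p : Fin 6 → ℝ) (i : Fin 16) : Fin 3 → ℝ :=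
  fun c => ∑ e, treeSign i e * (p e / 2) * edgeVec e c

/-- The open parallelepiped of a spanning tree. -/
def tile (p : Fin 6 → ℝ) (i : Fin 16) : Set (Fin 3 → ℝ) :=
  (fun z => (treeMatrix i).map (Int.cast : ℤ → ℝ) *ᵥ z + tileCenter p i) ''
    centeredBox fun k => p (treeEdge i k)

/-- The Voronoi cell of a lattice with Gram matrix `A`, in the coordinates given by the inner
products with the basis. -/
def coordVoronoi (A : Matrix (Fin 3) (Fin 3) ℝ) : Set (Fin 3 → ℝ) :=
  {y | ∀ k : Fin 3 → ℤ, ∑ a, k a * y a ≤ (1 / 2) * ∑ a, ∑ b, k a * A a b * k b}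

theorem sum_mul_tile_point (p : Fin 6 → ℝ) (i : Fin 16) (z : Fin 3 → ℝ) (k : Fin 3 → ℤ) :
    ∑ a, (k a : ℝ) * ((treeMatrix i).map (Int.cast : ℤ → ℝ) *ᵥ z + tileCenter p i) a =
      ∑ l, z l * ((∑ a, k a * edgeVec (treeEdge i l) a : ℤ) : ℝ) +
        ∑ e, p e / 2 * (treeSign i e * ∑ a, k a * edgeVec e a : ℤ) := by
  simp only [Pi.add_apply, mulVec, dotProduct, map_apply, treeMatrix, of_apply, tileCenter, mul_add,
    Finset.sum_add_distrib, Finset.mul_sum]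
  push_cast
  rw [Finset.sum_comm]
  simp only [Finset.mul_sum]
  congr 1
  · refine Finset.sum_congr rfl fun l _ => Finset.sum_congr rfl fun a _ => by ring
  · rw [Finset.sum_comm]
    refine Finset.sum_congr rfl fun l _ => Finset.sum_congr rfl fun a _ => by ring

/-- The signs vanish on the tree, so tree edges and remaining edges combine into a single sum over
all edges. This permits comparing tiles of different trees. -/
theorem sum_tree_add_sum_sign (p : Fin 6 → ℝ) (i : Fin 16) (f g : Fin 6 → ℤ) :
    ∑ l, p (treeEdge i l) / 2 * (f (treeEdge i l) : ℝ) +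
        ∑ e, p e / 2 * (treeSign i e * g e : ℤ) =
      ∑ e, p e / 2 * ((if treeSign i e = 0 then f e else treeSign i e * g e : ℤ) : ℝ) := by
  rw [sum_treeEdge i fun e => p e / 2 * (f e : ℝ), ← Finset.sum_add_distrib]
  refine Finset.sum_congr rfl fun e _ => ?_
  split_ifs with h
  · simp [h]
  · simp

theorem abs_mul_lt_of_mem_centeredBox {r : Fin 3 → ℝ} {z : Fin 3 → ℝ} (hz : z ∈ centeredBox r)
    (l : Fin 3) : |z l| < r l / 2 := by
  have := hz l (Set.mem_univ l)
  rw [abs_lt]; exact this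

theorem sum_mul_le_of_mem_tile {p : Fin 6 → ℝ} {i : Fin 16} {z : Fin 3 → ℝ}
    (hz : z ∈ centeredBox fun k => p (treeEdge i k)) (k : Fin 3 → ℤ) :
    ∑ a, (k a : ℝ) * ((treeMatrix i).map (Int.cast : ℤ → ℝ) *ᵥ z + tileCenter p i) a ≤
      ∑ e, p e / 2 * ((if treeSign i e = 0 then |∑ a, k a * edgeVec e a|
        else treeSign i e * ∑ a, k a * edgeVec e a : ℤ) : ℝ) := by
  rw [sum_mul_tile_point, ← sum_tree_add_sum_sign p i (fun e => |∑ a, k a * edgeVec e a|)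
    (fun e => ∑ a, k a * edgeVec e a)]
  refine add_le_add (Finset.sum_le_sum fun l _ => ?_) le_rfl
  rw [Int.cast_abs]
  refine (le_abs_self _).trans ?_
  rw [abs_mul]
  exact mul_le_mul_of_nonneg_right (abs_mul_lt_of_mem_centeredBox hz l).le (abs_nonneg _)

theorem lt_sum_mul_of_mem_tile {p : Fin 6 → ℝ} {i : Fin 16} {z : Fin 3 → ℝ}
    (hz : z ∈ centeredBox fun k => p (treeEdge i k)) (k : Fin 3 → ℤ)
    (hk : ∃ l, ∑ a, k a * edgeVec (treeEdge i l) a ≠ 0) :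
    ∑ a, (k a : ℝ) * ((treeMatrix i).map (Int.cast : ℤ → ℝ) *ᵥ z + tileCenter p i) a <
      ∑ e, p e / 2 * ((if treeSign i e = 0 then |∑ a, k a * edgeVec e a|
        else treeSign i e * ∑ a, k a * edgeVec e a : ℤ) : ℝ) := by
  rw [sum_mul_tile_point, ← sum_tree_add_sum_sign p i (fun e => |∑ a, k a * edgeVec e a|)
    (fun e => ∑ a, k a * edgeVec e a)]
  obtain ⟨l, hl⟩ := hk
  refine add_lt_add_of_lt_of_le (Finset.sum_lt_sum (fun l _ => ?_) ⟨l, Finset.mem_univ l, ?_⟩) le_rfl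
  · rw [Int.cast_abs]
    refine (le_abs_self _).trans ?_
    rw [abs_mul]
    exact mul_le_mul_of_nonneg_right (abs_mul_lt_of_mem_centeredBox hz l).le (abs_nonneg _)
  · rw [Int.cast_abs]
    refine (le_abs_self _).trans_lt ?_
    rw [abs_mul]
    exact mul_lt_mul_of_pos_right (abs_mul_lt_of_mem_centeredBox hz l)
      (abs_pos.2 (by exact_mod_cast hl))

theorem le_sum_mul_of_mem_tile {p : Fin 6 → ℝ} {i : Fin 16} {z : Fin 3 → ℝ}
    (hz : z ∈ centeredBox fun k => p (treeEdge i k)) (k : Fin 3 → ℤ) :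
    ∑ e, p e / 2 * ((if treeSign i e = 0 then -|∑ a, k a * edgeVec e a|
        else treeSign i e * ∑ a, k a * edgeVec e a : ℤ) : ℝ) ≤
    ∑ a, (k a : ℝ) * ((treeMatrix i).map (Int.cast : ℤ → ℝ) *ᵥ z + tileCenter p i) a := by
  have := sum_mul_le_of_mem_tile hz (-k)
  rw [← neg_le_neg_iff, ← Finset.sum_neg_distrib, ← Finset.sum_neg_distrib]
  refine le_of_eq_of_le (Finset.sum_congr rfl fun a _ => ?_)
    (this.trans_eq (Finset.sum_congr rfl fun e _ => ?_))
  · simp only [Pi.neg_apply, Int.cast_neg]; ring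
  · rw [← mul_neg, ← Int.cast_neg]
    congr 2
    simp only [Pi.neg_apply, neg_mul, Finset.sum_neg_distrib, abs_neg]
    split_ifs <;> ring

theorem pairwise_disjoint_tile {p : Fin 6 → ℝ} (hp : ∀ e, 0 ≤ p e) :
    Pairwise (Function.onFun Disjoint (tile p)) := by
  intro i j hij
  refine Set.disjoint_left.2 ?_
  rintro _ ⟨z, hz, rfl⟩ ⟨z', hz', h⟩
  obtain ⟨c, hc, hl⟩ := exists_separating_cut i j hij
  have h1 := lt_sum_mul_of_mem_tile hz (graphCut c) hl
  have h2 := le_sum_mul_of_mem_tile hz' (graphCut c)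
  simp only at h
  rw [h] at h2
  refine absurd (h1.trans_le ((Finset.sum_le_sum fun e _ => ?_).trans h2)) (lt_irrefl _)
  exact mul_le_mul_of_nonneg_left (by exact_mod_cast hc e) (by linarith [hp e])

/-- The form is the sum of `p e * n²` over the edges, with `n` the value of `k` on the edge. On a
tile each edge contributes at most `p e / 2 * |n|` to `k · y`, and `|n| ≤ n²` for integers. -/
theorem tile_subset_coordVoronoi {p : Fin 6 → ℝ} (hp : ∀ e, 0 ≤ p e) (i : Fin 16) :
    tile p i ⊆ coordVoronoi (conormGram p) := by
  rintro _ ⟨z, hz, rfl⟩ k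
  refine (sum_mul_le_of_mem_tile hz k).trans ?_
  have h1 : (1 / 2 : ℝ) * ∑ a, ∑ b, k a * conormGram p a b * k b =
      ∑ e, p e / 2 * (((∑ a, k a * edgeVec e a) ^ 2 : ℤ) : ℝ) := by
    have : ∀ e, (((∑ a, k a * edgeVec e a) ^ 2 : ℤ) : ℝ) =
        ∑ a, ∑ b, ((k a : ℝ) * edgeVec e a) * (k b * edgeVec e b) := by
      intro e; push_cast; rw [sq, Finset.sum_mul_sum]
    simp_rw [this, conormGram, of_apply, Finset.mul_sum, Finset.sum_mul, Finset.mul_sum]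
    rw [Finset.sum_comm' (t' := Finset.univ) (s' := fun _ => Finset.univ) (by simp)]
    simp_rw [Finset.sum_comm (s := (Finset.univ : Finset (Fin 3))) (t := (Finset.univ : Finset (Fin 6)))]
    refine Finset.sum_congr rfl fun e _ => ?_
    rw [Finset.sum_comm]
    exact Finset.sum_congr rfl fun a _ => Finset.sum_congr rfl fun b _ => by ring
  rw [h1]
  refine Finset.sum_le_sum fun e _ => mul_le_mul_of_nonneg_left ?_ (by linarith [hp e])
  have h2 : ∀ x : ℤ, |x| ≤ x ^ 2 := fun x => by
    rw [← sq_abs, sq]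
    rcases eq_or_ne x 0 with rfl | hx
    · simp
    · nlinarith [Int.one_le_abs hx]
  have h3 := treeSign_bound i e
  rw [Int.cast_le]
  refine le_trans ?_ (h2 _)
  split_ifs
  · exact le_rfl
  · refine (le_abs_self _).trans ?_
    rw [abs_mul]
    nlinarith [abs_nonneg (∑ a, k a * edgeVec e a)]

theorem measurableSet_tile (p : Fin 6 → ℝ) (i : Fin 16) : MeasurableSet (tile p i) :=
  (measurableEmbedding_mulVec_add (abs_det_treeMatrix i) _).measurableSet_image.2
    (measurableSet_centeredBox _)

theorem volume_tile (p : Fin 6 → ℝ) (i : Fin 16) :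
    volume (tile p i) = ∏ k, ENNReal.ofReal (p (treeEdge i k)) := by
  have he := measurableEmbedding_mulVec_add (abs_det_treeMatrix i) (tileCenter p i)
  have hm := measurePreserving_mulVec_add (abs_det_treeMatrix i) (tileCenter p i)
  rw [← hm.measure_preimage_emb he, tile, he.injective.preimage_image, volume_centeredBox]

/-- The matrix-tree theorem for the complete graph on four vertices. In the tiling it says that the
volumes of the tiles add up to the volume of the cell. -/
theorem det_conormGram (p : Fin 6 → ℝ) :
    (conormGram p).det = ∑ i, ∏ k, p (treeEdge i k) := by
  simp [det_fin_three, conormGram, Fin.sum_univ_succ, Fin.prod_univ_succ, edgeVec, treeEdge]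
  ring

/-- No covering argument is needed: the tiles are disjoint, lie in the cell and have the same total
volume. -/
theorem coordVoronoi_ae_eq_iUnion_tile {p : Fin 6 → ℝ} (hp : ∀ e, 0 ≤ p e)
    (hdet : (conormGram p).det = 1) (hV : volume (coordVoronoi (conormGram p)) = 1) :
    (⋃ i, tile p i) =ᵐ[volume] coordVoronoi (conormGram p) := by
  refine ae_eq_of_subset_of_measure_ge (Set.iUnion_subset fun i => tile_subset_coordVoronoi hp i)
    ?_ (MeasurableSet.iUnion fun i => measurableSet_tile p i).nullMeasurableSet
    (by rw [hV]; exact ENNReal.one_ne_top)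
  rw [hV, measure_iUnion (pairwise_disjoint_tile hp) (measurableSet_tile p), tsum_fintype]
  simp_rw [volume_tile, ← ENNReal.ofReal_prod_of_nonneg fun k _ => hp _]
  rw [← ENNReal.ofReal_sum_of_nonneg fun i _ => Finset.prod_nonneg fun k _ => hp _,
    ← det_conormGram, hdet, ENNReal.ofReal_one]

theorem integral_tile {p : Fin 6 → ℝ} (hp : ∀ e, 0 ≤ p e) (i : Fin 16)
    (Q : Matrix (Fin 3) (Fin 3) ℝ) :
    ∫ y in tile p i, ∑ a, ∑ b, Q a b * (y a * y b) =
      (∏ k, p (treeEdge i k)) * (∑ a, ∑ b, Q a b * (tileCenter p i a * tileCenter p i b) +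
        ∑ k, (∑ a, ∑ b, Q a b * (edgeVec (treeEdge i k) a * edgeVec (treeEdge i k) b)) *
          (p (treeEdge i k) ^ 2 / 12)) := by
  have he := measurableEmbedding_mulVec_add (abs_det_treeMatrix i) (tileCenter p i)
  have hm := measurePreserving_mulVec_add (abs_det_treeMatrix i) (tileCenter p i)
  rw [tile, hm.setIntegral_image_emb he]
  rw [← integral_centeredBox_quadratic (fun k => hp _)
    (∑ a, ∑ b, Q a b * (tileCenter p i a * tileCenter p i b))
    (fun k => ∑ a, ∑ b, Q a b * (tileCenter p i a * edgeVec (treeEdge i k) b +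
      edgeVec (treeEdge i k) a * tileCenter p i b))
    (fun k l => ∑ a, ∑ b, Q a b * (edgeVec (treeEdge i k) a * edgeVec (treeEdge i l) b))]
  congr 1
  ext z
  simp only [Pi.add_apply, mulVec, dotProduct, map_apply, treeMatrix, of_apply,
    Fin.sum_univ_three]
  ring

/-! ### The second moment as a polynomial in the conorms -/

/-- Thirty-six times the normalized second moment of a unit lattice in terms of its conorms. -/
def conormMoment (p : Fin 6 → ℝ) : ℝ :=
  p 0 + p 1 + p 2 + p 3 + p 4 + p 5 +
    2 * (p 0 * p 5 * p 1 * p 4 + p 0 * p 5 * p 2 * p 3 + p 1 * p 4 * p 2 * p 3) +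
    (p 0 * p 1 * p 2 * (p 3 + p 4 + p 5) + p 0 * p 3 * p 4 * (p 1 + p 2 + p 5) +
      p 1 * p 3 * p 5 * (p 0 + p 2 + p 4) + p 2 * p 4 * p 5 * (p 0 + p 1 + p 3))

theorem conormGram_eq (p : Fin 6 → ℝ) : conormGram p =
    !![p 0 + p 3 + p 4, -p 3, -p 4; -p 3, p 1 + p 3 + p 5, -p 5; -p 4, -p 5, p 2 + p 4 + p 5] := by
  ext a b
  fin_cases a <;> fin_cases b <;>
    simp [conormGram, Fin.sum_univ_succ, edgeVec] <;> ring

set_option maxRecDepth 4000 in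
theorem sum_tile_moments {p : Fin 6 → ℝ} (hdet : (conormGram p).det = 1)
    (Q : Matrix (Fin 3) (Fin 3) ℝ) (hQ : Q = (conormGram p).adjugate) :
    ∑ i, (∏ k, p (treeEdge i k)) * (∑ a, ∑ b, Q a b * (tileCenter p i a * tileCenter p i b) +
        ∑ k, (∑ a, ∑ b, Q a b * (edgeVec (treeEdge i k) a * edgeVec (treeEdge i k) b)) *
          (p (treeEdge i k) ^ 2 / 12)) = conormMoment p / 12 := by
  have hQ' := hQ
  rw [conormGram_eq, adjugate_fin_three_of] at hQ'
  have hd : ∑ i, ∏ k, p (treeEdge i k) = 1 := by rw [← det_conormGram, hdet]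
  generalize h0 : p 0 = x0 at *
  generalize h1 : p 1 = x1 at *
  generalize h2 : p 2 = x2 at *
  generalize h3 : p 3 = x3 at *
  generalize h4 : p 4 = x4 at *
  generalize h5 : p 5 = x5 at *
  have hp : p = ![x0, x1, x2, x3, x4, x5] := by
    ext e; fin_cases e <;> simp [*]
  clear hQ hdet
  subst hQ'
  subst hp
  clear h0 h1 h2 h3 h4 h5
  simp [Fin.sum_univ_succ, Fin.prod_univ_succ, edgeVec, treeEdge, tileCenter, treeSign,
    conormMoment] at hd ⊢
  have hd' : x0 * x1 * x2 + x0 * x1 * x4 + x0 * x1 * x5 + x0 * x2 * x3 + x0 * x2 * x5 + x0 * x3 * x4 + x0 * x3 * x5 +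
      x0 * x4 * x5 + x1 * x2 * x3 + x1 * x2 * x4 + x1 * x3 * x4 + x1 * x3 * x5 +
      x1 * x4 * x5 + x2 * x3 * x4 + x2 * x3 * x5 + x2 * x4 * x5 = 1 := by
    rw [← hd]; ring
  generalize hD : x0 * x1 * x2 + x0 * x1 * x4 + x0 * x1 * x5 + x0 * x2 * x3 + x0 * x2 * x5 + x0 * x3 * x4 + x0 * x3 * x5 +
      x0 * x4 * x5 + x1 * x2 * x3 + x1 * x2 * x4 + x1 * x3 * x4 + x1 * x3 * x5 +
      x1 * x4 * x5 + x2 * x3 * x4 + x2 * x3 * x5 + x2 * x4 * x5 = D at hd'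
  -- The integral is homogeneous of degree 7 in the conorms, whereas `conormMoment` has parts of
  -- degrees 1 and 4. Inserting powers of the cubic `D = 1` makes both sides homogeneous, and the
  -- claim becomes a polynomial identity.
  have hmul : D * (D * (x0 + x1 + x2 + x3 + x4 + x5) +
      (2 * (x0 * x5 * x1 * x4 + x0 * x5 * x2 * x3 + x1 * x4 * x2 * x3) +
        (x0 * x1 * x2 * (x3 + x4 + x5) + x0 * x3 * x4 * (x1 + x2 + x5) +
          x1 * x3 * x5 * (x0 + x2 + x4) + x2 * x4 * x5 * (x0 + x1 + x3)))) =
      x0 + x1 + x2 + x3 + x4 + x5 +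
        2 * (x0 * x5 * x1 * x4 + x0 * x5 * x2 * x3 + x1 * x4 * x2 * x3) +
        (x0 * x1 * x2 * (x3 + x4 + x5) + x0 * x3 * x4 * (x1 + x2 + x5) +
          x1 * x3 * x5 * (x0 + x2 + x4) + x2 * x4 * x5 * (x0 + x1 + x3)) := by
    rw [hd']; ring
  rw [← hmul, ← hD]
  ring

theorem measurePreserving_sum_smul {n : ℕ} {d : Fin n → EuclideanSpace ℝ (Fin n)}
    (hd : (gram ℝ d).det = 1) :
    MeasurePreserving (fun y : Fin n → ℝ => ∑ k, y k • d k) volume volume ∧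
      MeasurableEmbedding (fun y : Fin n → ℝ => ∑ k, y k • d k) := by
  let M : Matrix (Fin n) (Fin n) ℝ := of fun i k => d k i
  have hM : |M.det| = 1 := by
    have h1 : (gram ℝ d).det = M.det ^ 2 := by
      rw [det_gram_eq_sq]; rfl
    rw [h1, ← sq_abs, pow_eq_one_iff_of_nonneg (abs_nonneg _) two_ne_zero] at hd
    exact hd
  have heq : (fun y : Fin n → ℝ => ∑ k, y k • d k) =
      WithLp.toLp 2 ∘ fun y => M *ᵥ y + 0 := by
    funext y
    ext i
    simp [M, mulVec, dotProduct, mul_comm]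
  rw [heq]
  exact ⟨(PiLp.volume_preserving_toLp (Fin n)).comp (measurePreserving_mulVec_add hM 0),
    (MeasurableEquiv.toLp 2 (Fin n → ℝ)).measurableEmbedding.comp
      (measurableEmbedding_mulVec_add hM 0)⟩

theorem transpose_gram {n : ℕ} {E : Type*} [NormedAddCommGroup E] [InnerProductSpace ℝ E]
    (v : Fin n → E) : (gram ℝ v)ᵀ = gram ℝ v := by
  have := isHermitian_gram ℝ v
  rwa [IsHermitian, conjTranspose_eq_transpose_of_trivial] at this

theorem norm_le_norm_sub_iff {E : Type*} [NormedAddCommGroup E] [InnerProductSpace ℝ E] (x y : E) :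
    ‖x‖ ≤ ‖x - y‖ ↔ inner ℝ y x ≤ (1 / 2) * inner ℝ y y := by
  rw [← sq_le_sq₀ (norm_nonneg _) (norm_nonneg _), norm_sub_sq_real, real_inner_comm,
    ← real_inner_self_eq_norm_sq y]
  constructor <;> intro h <;> linarith

theorem secondMoment_eq_of_gram {p : Fin 6 → ℝ} (hp : ∀ e, 0 ≤ p e)
    (b : Basis (Fin 3) ℝ (EuclideanSpace ℝ (Fin 3))) (hb : gram ℝ b = conormGram p)
    (hdet : (conormGram p).det = 1) :
    secondMoment (Submodule.span ℤ (Set.range b)) = conormMoment p / 36 := by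
  set A := conormGram p with hA
  have hAu : IsUnit A.det := by rw [hdet]; exact isUnit_one
  have hinv : A⁻¹ = A.adjugate := by
    rw [inv_def, hdet]; simp
  have hAT : Aᵀ = A := by rw [← hb]; exact transpose_gram _
  -- The dual basis. In the coordinates `y a = ⟨b a, x⟩` one has `x = ∑ y k • d k`; this change of
  -- variables preserves volume and turns `x · x` into the form `A⁻¹`, which is the adjugate since
  -- `A.det = 1`.
  let d : Fin 3 → EuclideanSpace ℝ (Fin 3) := fun i => ∑ k, A⁻¹ k i • b k
  have hd : gram ℝ d = A⁻¹ := by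
    rw [gram_basis_expand, hb, transpose_nonsing_inv, hAT, nonsing_inv_mul _ hAu, one_mul]
  have hbd : ∀ i j, inner ℝ (b i) (d j) = if i = j then 1 else 0 := by
    intro i j
    rw [← one_apply, ← mul_nonsing_inv A hAu, mul_apply, inner_sum]
    refine Finset.sum_congr rfl fun k _ => ?_
    rw [inner_smul_right, mul_comm, ← hb]; rfl
  obtain ⟨hm, he⟩ := measurePreserving_sum_smul (d := d)
    (by rw [hd, det_nonsing_inv, hdet]; simp)
  have hbx : ∀ (y : Fin 3 → ℝ) i, inner ℝ (b i) (∑ k, y k • d k) = y i := by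
    intro y i
    rw [inner_sum]
    simp [inner_smul_right, hbd]
  have hV : (fun y : Fin 3 → ℝ => ∑ k, y k • d k) ⁻¹'
      voronoiCell (Submodule.span ℤ (Set.range b)) = coordVoronoi A := by
    ext y
    have h1 : ∀ k : Fin 3 → ℤ, ‖∑ k, y k • d k‖ ≤ ‖∑ k, y k • d k - ∑ i, k i • b i‖ ↔
        ∑ a, k a * y a ≤ (1 / 2) * ∑ a, ∑ c, k a * A a c * k c := by
      intro k
      rw [norm_le_norm_sub_iff, sum_inner, sum_inner]
      simp_rw [← Int.cast_smul_eq_zsmul ℝ, inner_smul_left, hbx, inner_sum, inner_smul_right,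
        Finset.mul_sum]
      have : ∀ i j, inner ℝ (b i) (b j) = A i j := fun i j => by rw [← hb]; rfl
      simp_rw [this]
      refine iff_of_eq (congrArg₂ _ rfl (congrArg₂ _ rfl ?_))
      funext a
      refine Finset.sum_congr rfl fun c _ => ?_
      simp; ring
    simp only [Set.mem_preimage, voronoiCell, coordVoronoi, Set.mem_ofPred_eq]
    constructor
    · intro h k
      exact (h1 k).1 (h _ ((mem_span_int_range _ _).2 ⟨k, rfl⟩))
    · intro h l hl
      obtain ⟨k, rfl⟩ := (mem_span_int_range _ _).1 hl
      exact (h1 k).2 (h k)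
  have hvol : volume (coordVoronoi A) = 1 := by
    rw [← hV, hm.measure_preimage_emb he]
    exact (volume_voronoiCell_eq_one_iff b).2 (by rw [hb, hdet])
  have hae := coordVoronoi_ae_eq_iUnion_tile hp hdet hvol
  have hin : ∀ y : Fin 3 → ℝ, inner ℝ (∑ k, y k • d k) (∑ k, y k • d k) =
      ∑ a, ∑ c, A.adjugate a c * (y a * y c) := by
    intro y
    rw [sum_inner]
    simp_rw [inner_sum, inner_smul_left, inner_smul_right]
    have : ∀ i j, inner ℝ (d i) (d j) = A.adjugate i j := fun i j => by rw [← hinv, ← hd]; rfl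
    simp_rw [this]
    refine Finset.sum_congr rfl fun a _ => Finset.sum_congr rfl fun c _ => ?_
    simp; ring
  have hint : ∀ i, IntegrableOn (fun y : Fin 3 → ℝ => ∑ a, ∑ c, A.adjugate a c * (y a * y c))
      (tile p i) := by
    intro i
    have he := measurableEmbedding_mulVec_add (abs_det_treeMatrix i) (tileCenter p i)
    have hm := measurePreserving_mulVec_add (abs_det_treeMatrix i) (tileCenter p i)
    rw [tile, hm.integrableOn_image he]
    exact integrableOn_centeredBox _ (by fun_prop)
  rw [secondMoment, ← hm.setIntegral_preimage_emb he, hV]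
  simp_rw [hin]
  rw [← setIntegral_congr_set hae, integral_iUnion_fintype (measurableSet_tile p)
    (pairwise_disjoint_tile hp) hint]
  simp_rw [integral_tile hp]
  rw [sum_tile_moments hdet _ rfl]
  norm_num
  ring

/-! ### Realizing nearby Gram matrices by nearby bases -/

/-- The columns of the Cholesky factor of a positive definite 3 by 3 matrix. -/
noncomputable def choleskyVec (A : Matrix (Fin 3) (Fin 3) ℝ) : Fin 3 → EuclideanSpace ℝ (Fin 3) :=
  ![!₂[√(A 0 0), 0, 0],
    !₂[A 0 1 / √(A 0 0), √((A 0 0 * A 1 1 - A 0 1 ^ 2) / A 0 0), 0],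
    !₂[A 0 2 / √(A 0 0), (A 0 0 * A 1 2 - A 0 1 * A 0 2) /
        (A 0 0 * √((A 0 0 * A 1 1 - A 0 1 ^ 2) / A 0 0)),
      √(A.det / (A 0 0 * A 1 1 - A 0 1 ^ 2))]]

theorem gram_choleskyVec {A : Matrix (Fin 3) (Fin 3) ℝ} (hs : Aᵀ = A) (h0 : 0 < A 0 0)
    (h1 : 0 < A 0 0 * A 1 1 - A 0 1 ^ 2) (h2 : 0 < A.det) : gram ℝ (choleskyVec A) = A := by
  have e10 : A 1 0 = A 0 1 := congrFun (congrFun hs 0) 1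
  have e20 : A 2 0 = A 0 2 := congrFun (congrFun hs 0) 2
  have e21 : A 2 1 = A 1 2 := congrFun (congrFun hs 1) 2
  have s0 : √(A 0 0) ^ 2 = A 0 0 := Real.sq_sqrt h0.le
  have s1 := Real.sq_sqrt (div_pos h1 h0).le
  have s2 := Real.sq_sqrt (div_pos h2 h1).le
  have p0 := Real.sqrt_pos.2 h0
  have p1 := Real.sqrt_pos.2 (div_pos h1 h0)
  have hdet : A.det = A 0 0 * A 1 1 * A 2 2 - A 0 0 * A 1 2 ^ 2 - A 0 1 ^ 2 * A 2 2 +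
      2 * A 0 1 * A 1 2 * A 0 2 - A 0 2 ^ 2 * A 1 1 := by
    rw [det_fin_three, e10, e20, e21]; ring
  have k11 : (A 0 1 / √(A 0 0)) ^ 2 = A 0 1 ^ 2 / A 0 0 := by rw [div_pow, s0]
  have k22 : (A 0 2 / √(A 0 0)) ^ 2 = A 0 2 ^ 2 / A 0 0 := by rw [div_pow, s0]
  have k12 : A 0 1 / √(A 0 0) * (A 0 2 / √(A 0 0)) = A 0 1 * A 0 2 / A 0 0 := by
    rw [div_mul_div_comm, ← sq, s0]
  have c01 : √(A 0 0) * (A 0 1 / √(A 0 0)) = A 0 1 := by field_simp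
  have c02 : √(A 0 0) * (A 0 2 / √(A 0 0)) = A 0 2 := by field_simp
  generalize hr1 : √((A 0 0 * A 1 1 - A 0 1 ^ 2) / A 0 0) = r1 at *
  generalize hr2 : √(A.det / (A 0 0 * A 1 1 - A 0 1 ^ 2)) = r2 at *
  have c12 : r1 * ((A 0 0 * A 1 2 - A 0 1 * A 0 2) / (A 0 0 * r1)) =
      A 1 2 - A 0 1 * A 0 2 / A 0 0 := by field_simp
  have c22 : ((A 0 0 * A 1 2 - A 0 1 * A 0 2) / (A 0 0 * r1)) ^ 2 + r2 ^ 2 =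
      A 2 2 - A 0 2 ^ 2 / A 0 0 := by
    rw [div_pow, mul_pow, s1, s2, hdet]
    field_simp
    ring
  have key : ∀ i j, i ≤ j → gram ℝ (choleskyVec A) i j = A i j := by
    intro i j hij
    rw [gram_apply]
    fin_cases i <;> fin_cases j <;>
      first
      | (exact absurd hij (by decide))
      | (simp [choleskyVec, EuclideanSpace.inner_eq_star_dotProduct, dotProduct,
          EuclideanSpace.real_norm_sq_eq, Fin.sum_univ_three, hr1, hr2]
         try linear_combination s0
         try linear_combination c01
         try linear_combination c02
         try linear_combination k11 + s1 + (A 1 1) * (div_self h0.ne')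
         try linear_combination k12 + c12
         try linear_combination k22 + c22)
  ext i j
  rcases le_total i j with h | h
  · exact key i j h
  · have := key j i h
    rw [← congrFun (congrFun hs i) j, transpose_apply, ← this, gram_apply, gram_apply,
      real_inner_comm]

theorem leading_minors_pos {A : Matrix (Fin 3) (Fin 3) ℝ} (hA : A.PosDef) :
    0 < A 0 0 ∧ 0 < A 0 0 * A 1 1 - A 0 1 ^ 2 ∧ 0 < A.det := by
  have h00 : 0 < A 0 0 := hA.diag_pos
  have e10 : A 1 0 = A 0 1 := by simpa using (hA.1.apply 0 1)
  refine ⟨h00, ?_, hA.det_pos⟩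
  -- At this vector the form takes the value `A 0 0` times the second leading minor.
  have h := hA.dotProduct_mulVec_pos (x := ![-A 0 1, A 0 0, 0]) (by
    intro h; have := congrFun h 1; simp at this; exact h00.ne' this)
  simp [dotProduct, mulVec, Fin.sum_univ_three, e10] at h
  have h' : 0 < A 0 0 * (A 0 0 * A 1 1 - A 0 1 ^ 2) := by linarith
  exact (pos_iff_pos_of_mul_pos h').1 h00

/-- The continuity is what the Cholesky factor is for: it turns convergence of Gram matrices into
convergence of bases, in terms of which closeness of lattices is defined. -/
theorem continuousAt_choleskyVec {A : Matrix (Fin 3) (Fin 3) ℝ} (h0 : 0 < A 0 0)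
    (h1 : 0 < A 0 0 * A 1 1 - A 0 1 ^ 2) : ContinuousAt choleskyVec A := by
  have p0 := (Real.sqrt_pos.2 h0).ne'
  have p1 := (Real.sqrt_pos.2 (div_pos h1 h0)).ne'
  have c : ∀ i j, ContinuousAt (fun A : Matrix (Fin 3) (Fin 3) ℝ => A i j) A := fun i j =>
    (continuous_apply_apply i j).continuousAt
  have cd : ContinuousAt (fun A : Matrix (Fin 3) (Fin 3) ℝ => A.det) A := by fun_prop
  have cr : ContinuousAt (fun A : Matrix (Fin 3) (Fin 3) ℝ =>
      √((A 0 0 * A 1 1 - A 0 1 ^ 2) / A 0 0)) A :=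
    ((((c 0 0).mul (c 1 1)).sub ((c 0 1).pow 2)).div (c 0 0) h0.ne').sqrt
  refine continuousAt_pi.2 fun i => ?_
  refine (PiLp.continuous_toLp 2 _).continuousAt.comp (g := WithLp.toLp 2)
    (f := fun A j => choleskyVec A i j) ?_
  refine continuousAt_pi.2 fun j => ?_
  fin_cases i <;> fin_cases j <;> simp only [choleskyVec] <;> simp
  · exact (c 0 0).sqrt
  · exact continuousAt_const
  · exact continuousAt_const
  · exact (c 0 1).div (c 0 0).sqrt p0
  · exact cr
  · exact continuousAt_const
  · exact (c 0 2).div (c 0 0).sqrt p0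
  · exact (((c 0 0).mul (c 1 2)).sub ((c 0 1).mul (c 0 2))).div ((c 0 0).mul cr)
      (mul_ne_zero h0.ne' p1)
  · exact (cd.div (((c 0 0).mul (c 1 1)).sub ((c 0 1).pow 2)) h1.ne').sqrt

/-- The basis formed by three vectors with nonsingular Gram matrix. -/
theorem exists_basis_of_det_gram_ne_zero {n : ℕ} {v : Fin n → EuclideanSpace ℝ (Fin n)}
    (h : (gram ℝ v).det ≠ 0) :
    ∃ b : Basis (Fin n) ℝ (EuclideanSpace ℝ (Fin n)), (b : Fin n → _) = v :=
  ⟨basisOfLinearIndependentOfCardEqFinrank' _ (linearIndependent_of_det_gram_ne_zero h) (by simp),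
    by simp⟩

theorem exists_basis_gram_eq {A : Matrix (Fin 3) (Fin 3) ℝ} (hA : A.PosDef) :
    ∃ b : Basis (Fin 3) ℝ (EuclideanSpace ℝ (Fin 3)), gram ℝ b = A := by
  obtain ⟨h0, h1, h2⟩ := leading_minors_pos hA
  have hs : Aᵀ = A := by
    have := hA.1; rwa [IsHermitian, conjTranspose_eq_transpose_of_trivial] at this
  have hg := gram_choleskyVec hs h0 h1 h2
  obtain ⟨b, hb⟩ := exists_basis_of_det_gram_ne_zero (v := choleskyVec A) (by rw [hg]; exact h2.ne')
  exact ⟨b, by rw [hb, hg]⟩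

/-- An isometry takes the Cholesky basis of `gram ℝ b` to `b`. Applied to the Cholesky bases of `A
s`, it gives tuples that converge to `b` and have Gram matrices `A s`, so local minimality can be
tested on any family of isodual Gram matrices tending to that of `b`. -/
theorem eventually_secondMoment_le_of_isLocalMinIsodual {ι : Type*} {l : Filter ι}
    (b : Basis (Fin 3) ℝ (EuclideanSpace ℝ (Fin 3)))
    (hloc : IsLocalMinIsodual (Submodule.span ℤ (Set.range b)))
    {A : ι → Matrix (Fin 3) (Fin 3) ℝ} (hA : Tendsto A l (𝓝 (gram ℝ b)))
    (hs : ∀ᶠ s in l, (A s)ᵀ = A s ∧ IsIsodualGram (A s)) :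
    ∀ᶠ s in l, ∃ c : Basis (Fin 3) ℝ (EuclideanSpace ℝ (Fin 3)), gram ℝ c = A s ∧
      secondMoment (Submodule.span ℤ (Set.range b)) ≤
        secondMoment (Submodule.span ℤ (Set.range c)) := by
  set A₀ := gram ℝ b
  have hpd : A₀.PosDef := posDef_gram_of_linearIndependent b.linearIndependent
  obtain ⟨h0, h1, h2⟩ := leading_minors_pos hpd
  have hg := gram_choleskyVec (transpose_gram b) h0 h1 h2
  obtain ⟨c, hc⟩ := exists_basis_of_det_gram_ne_zero (v := choleskyVec A₀) (by rw [hg]; exact h2.ne')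
  obtain ⟨φ, hφ⟩ := exists_isometry_of_gram_eq c b (by rw [hc, hg])
  have hv : Tendsto (fun s i => φ (choleskyVec (A s) i)) l (𝓝 b) := by
    have h3 := (continuousAt_choleskyVec h0 h1).tendsto.comp hA
    rw [← hc, tendsto_pi_nhds] at h3
    refine tendsto_pi_nhds.2 fun i => ?_
    rw [← hφ]
    exact (φ.continuous.tendsto _).comp (h3 i)
  have hloc' := hloc (b.restrictScalars ℤ)
  have hbb : (fun i => ((b.restrictScalars ℤ i : Submodule.span ℤ (Set.range b)) :
      EuclideanSpace ℝ (Fin 3))) = b := by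
    funext i; exact b.restrictScalars_apply ℤ i
  rw [hbb] at hloc'
  have hloc2 := eventually_nhdsWithin_iff.1 hloc'
  have hcont : ∀ i j, Tendsto (fun s => A s i j) l (𝓝 (A₀ i j)) := fun i j =>
    ((continuous_apply_apply i j).tendsto A₀).comp hA
  have hm : Tendsto (fun s => A s 0 0 * A s 1 1 - A s 0 1 ^ 2) l
      (𝓝 (A₀ 0 0 * A₀ 1 1 - A₀ 0 1 ^ 2)) :=
    ((hcont 0 0).mul (hcont 1 1)).sub ((hcont 0 1).pow 2)
  filter_upwards [hv.eventually hloc2, (hcont 0 0).eventually (lt_mem_nhds h0),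
    hm.eventually (lt_mem_nhds h1), hs] with s hs1 hs2 hs3 hs4
  have hg2 := gram_choleskyVec hs4.1 hs2 hs3 (by rw [hs4.2.1]; exact one_pos)
  have hg3 : gram ℝ (fun i => φ (choleskyVec (A s) i)) = A s := by
    refine Eq.trans ?_ hg2
    ext i j
    simp [gram_apply]
  obtain ⟨d, hd⟩ := exists_basis_of_det_gram_ne_zero (v := fun i => φ (choleskyVec (A s) i))
    (by rw [hg3, hs4.2.1]; exact one_ne_zero)
  refine ⟨d, by rw [hd, hg3], ?_⟩
  have := hs1 (by
    rw [← hd]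
    exact isUnitIsodualLattice_of_gram d (by rw [hd, hg3]; exact hs4.2))
  rw [hd]
  exact this

/-! ### Isodual forms and their normal forms -/

/-- An integral 3 by 3 matrix, regarded as a real one. -/
abbrev castM (B : Matrix (Fin 3) (Fin 3) ℤ) : Matrix (Fin 3) (Fin 3) ℝ :=
  B.map (Int.cast : ℤ → ℝ)

theorem castM_mul (B C : Matrix (Fin 3) (Fin 3) ℤ) : castM (B * C) = castM B * castM C :=
  Matrix.map_mul (f := Int.castRingHom ℝ)

theorem castM_transpose (B : Matrix (Fin 3) (Fin 3) ℤ) : castM Bᵀ = (castM B)ᵀ := rfl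

theorem castM_one : castM 1 = 1 := by simp [castM]

theorem castM_neg (B : Matrix (Fin 3) (Fin 3) ℤ) : castM (-B) = -castM B := by
  ext i j; simp [castM]

theorem det_castM (B : Matrix (Fin 3) (Fin 3) ℤ) : (castM B).det = (B.det : ℝ) :=
  (Int.cast_det B).symm

theorem det_castM_sq {U : Matrix (Fin 3) (Fin 3) ℤ} (hU : IsUnit U.det) :
    (castM U).det * (castM U).det = 1 := by
  rw [det_castM]
  rcases Int.isUnit_iff.1 hU with h | h <;> rw [h] <;> norm_num

theorem isUnit_det_castM {U : Matrix (Fin 3) (Fin 3) ℤ} (hU : IsUnit U.det) :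
    IsUnit (castM U).det := by
  rw [det_castM]; exact hU.map (Int.castRingHom ℝ)

/-- The matrix `A` of a positive definite quadratic form of determinant 1, together with an
integral unimodular matrix `B` that exhibits it as isodual. -/
structure IsoPair (A : Matrix (Fin 3) (Fin 3) ℝ) (B : Matrix (Fin 3) (Fin 3) ℤ) : Prop where
  posDef : A.PosDef
  det_eq : A.det = 1
  unit : IsUnit B.det
  rel : (castM B)ᵀ * A⁻¹ * castM B = A

theorem IsoPair.isUnit {A : Matrix (Fin 3) (Fin 3) ℝ} {B : Matrix (Fin 3) (Fin 3) ℤ}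
    (h : IsoPair A B) : IsUnit A.det := by
  rw [h.det_eq]; exact isUnit_one

theorem transpose_of_posDef {A : Matrix (Fin 3) (Fin 3) ℝ} (h : A.PosDef) : Aᵀ = A := by
  have := h.1; rwa [IsHermitian, conjTranspose_eq_transpose_of_trivial] at this

theorem posDef_congr {A : Matrix (Fin 3) (Fin 3) ℝ} (h : A.PosDef)
    {U : Matrix (Fin 3) (Fin 3) ℤ} (hU : IsUnit U.det) :
    ((castM U)ᵀ * A * castM U).PosDef := by
  have h1 := h.conjTranspose_mul_mul_same (B := castM U)
    (mulVec_injective_iff_isUnit.2 ((isUnit_iff_isUnit_det _).2 (isUnit_det_castM hU)))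
  rwa [conjTranspose_eq_transpose_of_trivial] at h1

theorem det_congr_unimodular {A : Matrix (Fin 3) (Fin 3) ℝ}
    {U : Matrix (Fin 3) (Fin 3) ℤ} (hU : IsUnit U.det) :
    ((castM U)ᵀ * A * castM U).det = A.det := by
  rw [det_mul, det_mul, det_transpose, mul_right_comm, det_castM_sq hU, one_mul]

theorem IsoPair.congr {A : Matrix (Fin 3) (Fin 3) ℝ} {B : Matrix (Fin 3) (Fin 3) ℤ}
    (h : IsoPair A B) {U : Matrix (Fin 3) (Fin 3) ℤ} (hU : IsUnit U.det) :
    IsoPair ((castM U)ᵀ * A * castM U) (Uᵀ * B * U) where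
  posDef := posDef_congr h.posDef hU
  det_eq := by rw [det_congr_unimodular hU, h.det_eq]
  unit := by
    rw [det_mul, det_mul, det_transpose]
    exact (hU.mul h.unit).mul hU
  rel := by
    have hu := isUnit_det_castM hU
    have hut : IsUnit (castM U)ᵀ.det := by rwa [det_transpose]
    simp only [castM_mul, castM_transpose, transpose_mul, transpose_transpose, Matrix.mul_inv_rev]
    calc (castM U)ᵀ * ((castM B)ᵀ * castM U) * ((castM U)⁻¹ * (A⁻¹ * ((castM U)ᵀ)⁻¹)) *
          ((castM U)ᵀ * castM B * castM U)
        = (castM U)ᵀ * ((castM B)ᵀ * (castM U * (castM U)⁻¹) * A⁻¹ *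
            (((castM U)ᵀ)⁻¹ * (castM U)ᵀ) * castM B) * castM U := by
          simp only [mul_assoc]
      _ = _ := by
          rw [mul_nonsing_inv _ hu, nonsing_inv_mul _ hut, mul_one, mul_one, h.rel]

theorem IsoPair.neg {A : Matrix (Fin 3) (Fin 3) ℝ} {B : Matrix (Fin 3) (Fin 3) ℤ}
    (h : IsoPair A B) : IsoPair A (-B) where
  posDef := h.posDef
  det_eq := h.det_eq
  unit := by rw [det_neg]; exact (IsUnit.neg isUnit_one).pow _ |>.mul h.unit
  rel := by rw [castM_neg]; simp [h.rel]

/-- Conorms of the indecomposable isodual lattices. -/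
def hyperbolicConorms (a b c : ℝ) : Fin 6 → ℝ :=
  ![a ^ 2, a * (a + 2 * b), 2 * b * (a + b), 2 * c * (a + c), a * (a + 2 * c), 2 * b * c]

/-- Conorms of the orthogonal sum of `ℤ` and a plane lattice with conorms `α, β, γ`. -/
def decomposableConorms (α β γ : ℝ) : Fin 6 → ℝ := ![α, β, 1, γ, 0, 0]

/-- Gram matrices of suitable bases of the isodual lattices. -/
def IsReducedGram (A : Matrix (Fin 3) (Fin 3) ℝ) : Prop :=
  (∃ a b c : ℝ, 0 < a ∧ 0 < b ∧ 0 < c ∧ a ^ 2 + 2 * a * b + 2 * a * c + 2 * b * c = 1 ∧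
    A = conormGram (hyperbolicConorms a b c)) ∨
  ∃ α β γ : ℝ, 0 ≤ α ∧ 0 ≤ β ∧ 0 ≤ γ ∧ α * β + β * γ + γ * α = 1 ∧
    A = conormGram (decomposableConorms α β γ)

/-- `A` becomes reduced after a unimodular change of basis. -/
def IsReducible (A : Matrix (Fin 3) (Fin 3) ℝ) : Prop :=
  ∃ U : Matrix (Fin 3) (Fin 3) ℤ, IsUnit U.det ∧ IsReducedGram ((castM U)ᵀ * A * castM U)

theorem isReducible_of_congr {A : Matrix (Fin 3) (Fin 3) ℝ} {U : Matrix (Fin 3) (Fin 3) ℤ}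
    (hU : IsUnit U.det) (h : IsReducible ((castM U)ᵀ * A * castM U)) : IsReducible A := by
  obtain ⟨V, hV, hr⟩ := h
  refine ⟨U * V, by rw [det_mul]; exact hU.mul hV, ?_⟩
  rw [castM_mul, transpose_mul]
  simpa only [mul_assoc] using hr

/-! ### Short vectors and unimodular completion -/

/-- The value of a quadratic form at an integral vector. -/
def formValue (A : Matrix (Fin 3) (Fin 3) ℝ) (x : Fin 3 → ℤ) : ℝ :=
  ∑ i, ∑ j, x i * A i j * x j

theorem formValue_gram (b : Fin 3 → EuclideanSpace ℝ (Fin 3)) (x : Fin 3 → ℤ) :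
    formValue (gram ℝ b) x = ‖∑ i, x i • b i‖ ^ 2 := by
  rw [← real_inner_self_eq_norm_sq, sum_inner]
  simp_rw [inner_sum, ← Int.cast_smul_eq_zsmul ℝ, inner_smul_left, inner_smul_right]
  refine Finset.sum_congr rfl fun i _ => Finset.sum_congr rfl fun j _ => ?_
  simp [gram_apply]; ring

theorem diag_congr (A : Matrix (Fin 3) (Fin 3) ℝ) (U : Matrix (Fin 3) (Fin 3) ℤ) (j : Fin 3) :
    ((castM U)ᵀ * A * castM U) j j = formValue A (fun i => U i j) := by
  simp only [mul_apply, transpose_apply, map_apply, formValue, Finset.sum_mul]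
  rw [Finset.sum_comm]

theorem finite_formValue_le {A : Matrix (Fin 3) (Fin 3) ℝ} (hA : A.PosDef) (C : ℝ) :
    {x : Fin 3 → ℤ | formValue A x ≤ C}.Finite := by
  obtain ⟨b, rfl⟩ := exists_basis_gram_eq hA
  have hfin : (Metric.closedBall (0 : EuclideanSpace ℝ (Fin 3)) (√C) ∩
      (Submodule.span ℤ (Set.range b) : Set _)).Finite :=
    ZSpan.setFinite_inter b Metric.isBounded_closedBall
  refine Set.Finite.of_finite_image (f := fun x : Fin 3 → ℤ => ∑ i, x i • b i) (hfin.subset ?_) ?_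
  · rintro _ ⟨x, hx, rfl⟩
    refine ⟨?_, (mem_span_int_range _ _).2 ⟨x, rfl⟩⟩
    rw [Set.mem_ofPred_eq, formValue_gram] at hx
    rw [mem_closedBall_zero_iff]
    exact Real.le_sqrt_of_sq_le hx
  · intro x _ y _ hxy
    simp only at hxy
    funext i
    have := congrArg (fun v => b.repr v i) hxy
    simpa [Finsupp.single_apply] using this

/-- The trace of a positive definite form attains a minimum on every nonempty set of integral
changes of basis. -/
theorem exists_min_trace {A : Matrix (Fin 3) (Fin 3) ℝ} (hA : A.PosDef)
    {S : Set (Matrix (Fin 3) (Fin 3) ℤ)} (hS : S.Nonempty) :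
    ∃ U ∈ S, ∀ V ∈ S, ((castM U)ᵀ * A * castM U).trace ≤ ((castM V)ᵀ * A * castM V).trace := by
  obtain ⟨U₀, hU₀⟩ := hS
  set C := ((castM U₀)ᵀ * A * castM U₀).trace
  have hnn : ∀ x, 0 ≤ formValue A x := by
    obtain ⟨b, rfl⟩ := exists_basis_gram_eq hA
    intro x; rw [formValue_gram]; positivity
  have hfin : {U : Matrix (Fin 3) (Fin 3) ℤ |
      ((castM U)ᵀ * A * castM U).trace ≤ C}.Finite := by
    -- The diagonal entries are nonnegative values of `A` at the columns, so a bounded trace bounds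
    -- every column, and only finitely many matrices qualify.
    have h1 : (Set.univ.pi fun _ : Fin 3 => {x : Fin 3 → ℤ | formValue A x ≤ C}).Finite :=
      Set.Finite.pi fun _ => finite_formValue_le hA C
    refine Set.Finite.of_finite_image (f := fun U : Matrix (Fin 3) (Fin 3) ℤ => Uᵀ)
      (h1.subset ?_) (transpose_injective.injOn)
    rintro _ ⟨U, hU, rfl⟩ j _
    rw [Set.mem_ofPred_eq] at hU ⊢
    refine le_trans ?_ hU
    rw [trace]
    simp only [diag_apply, diag_congr]
    exact Finset.single_le_sum (f := fun j => formValue A fun i => U i j) (fun j _ => hnn _)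
      (Finset.mem_univ j)
  obtain ⟨U, ⟨hUS, hUC⟩, hU⟩ := Set.exists_min_image (S ∩ {U | _})
    (fun U : Matrix (Fin 3) (Fin 3) ℤ => ((castM U)ᵀ * A * castM U).trace)
    (hfin.subset Set.inter_subset_right) ⟨U₀, hU₀, Set.mem_ofPred_eq ▸ le_rfl⟩
  refine ⟨U, hUS, fun V hV => ?_⟩
  by_cases h : ((castM V)ᵀ * A * castM V).trace ≤ C
  · exact hU V ⟨hV, h⟩
  · exact (hUC.trans (not_le.1 h).le)

/-- A positive definite ternary form of determinant 1 has a nonzero value below 2. -/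
theorem exists_formValue_lt_two {A : Matrix (Fin 3) (Fin 3) ℝ} (hA : A.PosDef) (hdet : A.det = 1) :
    ∃ x : Fin 3 → ℤ, x ≠ 0 ∧ formValue A x < 2 := by
  obtain ⟨b, rfl⟩ := exists_basis_gram_eq hA
  by_contra! hcon
  have hV := (volume_voronoiCell_eq_one_iff b).2 hdet
  -- If all nonzero vectors had norm at least `√2 > 7/5`, the cell would contain a ball of radius
  -- `7/10`, whose volume exceeds 1 already for `π > 3`.
  have hsub : Metric.ball (0 : EuclideanSpace ℝ (Fin 3)) (7 / 10) ⊆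
      voronoiCell (Submodule.span ℤ (Set.range b)) := by
    intro x hx y hy
    rw [norm_le_norm_sub_iff, real_inner_self_eq_norm_sq]
    rw [mem_ball_zero_iff] at hx
    obtain ⟨m, rfl⟩ := (mem_span_int_range _ _).1 hy
    rcases eq_or_ne m 0 with rfl | hm
    · simp
    · have h1 := hcon m hm
      rw [formValue_gram] at h1
      have h2 := real_inner_le_norm (∑ i, m i • b i) x
      have h3 : 7 / 5 ≤ ‖∑ i, m i • b i‖ := by
        nlinarith [norm_nonneg (∑ i, m i • b i)]
      nlinarith [norm_nonneg x]
  have h1 := measure_mono (μ := volume) hsub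
  rw [hV, EuclideanSpace.volume_ball_fin_three, ← ENNReal.ofReal_pow (by norm_num),
    ← ENNReal.ofReal_mul (by norm_num), ENNReal.ofReal_le_one] at h1
  nlinarith [Real.pi_gt_three]

theorem exists_bezout_kernel (a b : ℤ) : ∃ p q r s : ℤ, p * s - q * r = 1 ∧ a * q + b * s = 0 := by
  by_cases h : Int.gcd a b = 0
  · obtain ⟨rfl, rfl⟩ := Int.gcd_eq_zero_iff.1 h
    exact ⟨1, 0, 0, 1, by ring, by ring⟩
  · obtain ⟨a', ha⟩ := Int.gcd_dvd_left a b
    obtain ⟨b', hb⟩ := Int.gcd_dvd_right a b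
    have hg := Int.gcd_eq_gcd_ab a b
    set g : ℤ := (Int.gcd a b : ℤ)
    have hg0 : g ≠ 0 := by simpa [g] using h
    refine ⟨Int.gcdA a b, -b', Int.gcdB a b, a', ?_, ?_⟩
    · apply mul_left_cancel₀ hg0
      linear_combination (-1 : ℤ) * hg - Int.gcdA a b * ha - Int.gcdB a b * hb
    · linear_combination a' * hb - b' * ha

theorem exists_unimodular_vecMul (x : Fin 3 → ℤ) :
    ∃ U : Matrix (Fin 3) (Fin 3) ℤ, IsUnit U.det ∧ ∃ d : ℤ, x ᵥ* U = ![d, 0, 0] := by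
  obtain ⟨p, q, r, s, h1, h2⟩ := exists_bezout_kernel (x 1) (x 2)
  obtain ⟨p', q', r', s', h3, h4⟩ := exists_bezout_kernel (x 0) (x 1 * p + x 2 * r)
  refine ⟨!![1, 0, 0; 0, p, q; 0, r, s] * !![p', q', 0; r', s', 0; 0, 0, 1], ?_,
    x 0 * p' + (x 1 * p + x 2 * r) * r', ?_⟩
  · rw [det_mul]
    have e1 : (!![1, 0, 0; 0, p, q; 0, r, s] : Matrix (Fin 3) (Fin 3) ℤ).det = 1 := by
      simp [det_fin_three]; linarith
    have e2 : (!![p', q', 0; r', s', 0; 0, 0, 1] : Matrix (Fin 3) (Fin 3) ℤ).det = 1 := by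
      simp [det_fin_three]; linarith
    rw [e1, e2]; simp
  · rw [← vecMul_vecMul]
    funext i
    fin_cases i <;> simp [vecMul, dotProduct, Fin.sum_univ_three]
    · linear_combination h4
    · exact h2

/-- If `x ᵥ* U = (d, 0, 0)`, then `x` is `d` times the first row of `U⁻¹`. So a primitive vector
extends to a basis of `ℤ³`. -/
theorem exists_unimodular_col (x : Fin 3 → ℤ) :
    ∃ U : Matrix (Fin 3) (Fin 3) ℤ, IsUnit U.det ∧ ∃ d : ℤ, ∀ i, x i = d * U i 0 := by
  obtain ⟨U, hU, d, hd⟩ := exists_unimodular_vecMul x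
  refine ⟨(U⁻¹)ᵀ, by rw [det_transpose]; exact isUnit_nonsing_inv_det _ hU, d, fun i => ?_⟩
  have h := congrArg (· ᵥ* U⁻¹) hd
  simp only [vecMul_vecMul, mul_nonsing_inv _ hU, vecMul_one] at h
  rw [h]
  simp [vecMul, dotProduct, Fin.sum_univ_three]

/-! ### Unimodular integral forms in two and three variables -/

/-- Integral equivalence of ternary forms. -/
def IntEquiv (B C : Matrix (Fin 3) (Fin 3) ℤ) : Prop :=
  ∃ U : Matrix (Fin 3) (Fin 3) ℤ, IsUnit U.det ∧ Uᵀ * B * U = C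

theorem IntEquiv.trans {B C D : Matrix (Fin 3) (Fin 3) ℤ} (h : IntEquiv B C) (h' : IntEquiv C D) :
    IntEquiv B D := by
  obtain ⟨U, hU, rfl⟩ := h
  obtain ⟨V, hV, rfl⟩ := h'
  exact ⟨U * V, by rw [det_mul]; exact hU.mul hV, by simp only [transpose_mul, mul_assoc]⟩

/-- Up to equivalence a unimodular binary form is diagonal or the hyperbolic plane. The proof is
Gauss reduction: make `2|b| ≤ |a|`, swap the two variables, and induct on `|a|`. -/
theorem binary_reduction (n : ℕ) : ∀ a b c : ℤ, a.natAbs ≤ n → IsUnit (a * c - b ^ 2) →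
    ∃ p q r s : ℤ, IsUnit (p * s - q * r) ∧
      ((IsUnit (a * p ^ 2 + 2 * b * p * r + c * r ^ 2) ∧
        a * p * q + b * (p * s + q * r) + c * r * s = 0 ∧
        IsUnit (a * q ^ 2 + 2 * b * q * s + c * s ^ 2)) ∨
      (a * p ^ 2 + 2 * b * p * r + c * r ^ 2 = 0 ∧
        a * p * q + b * (p * s + q * r) + c * r * s = 1 ∧
        a * q ^ 2 + 2 * b * q * s + c * s ^ 2 = 0)) := by
  induction n with
  | zero =>
    intro a b c ha hu
    obtain rfl : a = 0 := by simpa using ha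
    have hb : b ^ 2 = 1 := by
      rcases Int.isUnit_iff.1 hu with h | h <;> nlinarith
    have hbu : IsUnit b := (isUnit_pow_iff two_ne_zero).1 (by rw [hb]; exact isUnit_one)
    -- With `a = 0` and `b = ±1`, the parity of `c` decides: an even `c` can be cleared, which
    -- leaves the hyperbolic plane, and an odd one leads to `diag(1, -1)`.
    rcases Int.even_or_odd' c with ⟨k, rfl | rfl⟩
    · refine ⟨b, -(k * b), 0, 1, by simpa using hbu, Or.inr ⟨by ring, ?_, ?_⟩⟩
      · linear_combination hb
      · linear_combination (-2 * k) * hb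
    · refine ⟨-(k * b), b + k * b, 1, -1, ?_, Or.inl ⟨?_, ?_, ?_⟩⟩
      · rw [show -(k * b) * -1 - (b + k * b) * 1 = -b by ring]; exact hbu.neg
      · rw [show 0 * (-(k * b)) ^ 2 + 2 * b * -(k * b) * 1 + (2 * k + 1) * 1 ^ 2 =
          1 - 2 * k * (b ^ 2 - 1) by ring, hb]; simp
      · linear_combination (2 * k + 1) * hb
      · rw [show 0 * (b + k * b) ^ 2 + 2 * b * (b + k * b) * -1 + (2 * k + 1) * (-1) ^ 2 =
          -1 - (2 + 2 * k) * (b ^ 2 - 1) by ring, hb]; simp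
  | succ n ih =>
    intro a b c ha hu
    rcases Nat.lt_or_ge a.natAbs (n + 1) with h | h
    · exact ih a b c (by omega) hu
    have ha0 : a ≠ 0 := by rintro rfl; simp at h
    obtain ⟨k, hk⟩ : ∃ k : ℤ, 2 * |b + a * k| ≤ |a| := by
      have h1 := Int.emod_nonneg b ha0
      have h2 := Int.emod_lt_abs b ha0
      have h3 := Int.emod_add_mul_ediv b a
      rcases le_or_gt (2 * (b % a)) |a| with h4 | h4
      · refine ⟨-(b / a), ?_⟩
        rw [show b + a * -(b / a) = b % a by linarith, abs_of_nonneg h1]; exact h4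
      · rcases le_total 0 a with h5 | h5
        · refine ⟨-(b / a) - 1, ?_⟩
          rw [abs_of_nonneg h5] at *
          rw [show b + a * (-(b / a) - 1) = b % a - a by linarith, abs_of_neg (by linarith)]
          linarith
        · refine ⟨-(b / a) + 1, ?_⟩
          rw [abs_of_nonpos h5] at *
          rw [show b + a * (-(b / a) + 1) = b % a + a by linarith, abs_of_neg (by linarith)]
          linarith
    set b' := b + a * k with hb'
    set c' := c + 2 * b * k + a * k ^ 2 with hc'
    have hdet : a * c' - b' ^ 2 = a * c - b ^ 2 := by rw [hb', hc']; ring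
    have habs : |a * c'| ≤ b' ^ 2 + 1 := by
      have : |a * c - b ^ 2| = 1 := Int.isUnit_iff_abs_eq.1 hu
      rw [show a * c' = (a * c - b ^ 2) + b' ^ 2 by linarith]
      refine (abs_add_le _ _).trans ?_
      rw [this, abs_of_nonneg (sq_nonneg b')]; linarith
    have hna : (a.natAbs : ℤ) = |a| := Int.natCast_natAbs a
    have hnc : (c'.natAbs : ℤ) = |c'| := Int.natCast_natAbs c'
    rcases Nat.eq_or_lt_of_le (Nat.le_add_left 1 n) with h1 | h1
    · have ha1 : |a| = 1 := by omega
      have hb0 : b' = 0 := by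
        rw [← abs_nonpos_iff]; omega
      have hua : IsUnit a := Int.isUnit_iff_abs_eq.2 ha1
      rw [← hdet, hb0] at hu
      refine ⟨1, k, 0, 1, by simp, Or.inl ⟨by simpa using hua, ?_, ?_⟩⟩
      · linear_combination hb0
      · rw [show a * k ^ 2 + 2 * b * k * 1 + c * 1 ^ 2 = c' by rw [hc']; ring]
        exact isUnit_of_mul_isUnit_right (x := a) (by simpa using hu)
    · have ha2 : 2 ≤ |a| := by omega
      -- Here `|a| |c'| ≤ b'² + 1 ≤ a²/4 + 1 < a²`, since `|a| ≥ 2`.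
      have hlt : |c'| < |a| := by
        rw [abs_mul] at habs
        have h5 : |b'| ^ 2 = b' ^ 2 := sq_abs b'
        nlinarith [abs_nonneg b', abs_nonneg c']
      obtain ⟨p, q, r, s, h6, h7⟩ := ih c' (-b') a (by omega) (by
        rwa [show c' * a - (-b') ^ 2 = a * c' - b' ^ 2 by ring, hdet])
      refine ⟨k * p - r, k * q - s, p, q, ?_, ?_⟩
      · rwa [show (k * p - r) * q - (k * q - s) * p = p * s - q * r by ring]
      · rw [show a * (k * p - r) ^ 2 + 2 * b * (k * p - r) * p + c * p ^ 2 =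
            c' * p ^ 2 + 2 * -b' * p * r + a * r ^ 2 by rw [hb', hc']; ring,
          show a * (k * p - r) * (k * q - s) + b * ((k * p - r) * q + (k * q - s) * p) + c * p * q =
            c' * p * q + -b' * (p * s + q * r) + a * r * s by rw [hb', hc']; ring,
          show a * (k * q - s) ^ 2 + 2 * b * (k * q - s) * q + c * q ^ 2 =
            c' * q ^ 2 + 2 * -b' * q * s + a * s ^ 2 by rw [hb', hc']; ring]
        exact h7

theorem eq_of_symm_fin_three {R : Type*} {B : Matrix (Fin 3) (Fin 3) R} (hB : Bᵀ = B) :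
    B = !![B 0 0, B 0 1, B 0 2; B 0 1, B 1 1, B 1 2; B 0 2, B 1 2, B 2 2] := by
  have h1 : B 1 0 = B 0 1 := congrFun (congrFun hB 0) 1
  have h2 : B 2 0 = B 0 2 := congrFun (congrFun hB 0) 2
  have h3 : B 2 1 = B 1 2 := congrFun (congrFun hB 1) 2
  ext i j
  fin_cases i <;> fin_cases j <;> simp [h1, h2, h3]

theorem transpose_congr {R : Type*} [CommRing R] {B U : Matrix (Fin 3) (Fin 3) R} (hB : Bᵀ = B) :
    (Uᵀ * B * U)ᵀ = Uᵀ * B * U := by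
  simp only [transpose_mul, transpose_transpose, hB, mul_assoc]

theorem IntEquiv.symm_det {B C : Matrix (Fin 3) (Fin 3) ℤ} (h : IntEquiv B C) (hB : Bᵀ = B) :
    Cᵀ = C ∧ C.det = B.det := by
  obtain ⟨U, hU, rfl⟩ := h
  refine ⟨transpose_congr hB, ?_⟩
  rw [det_mul, det_mul, det_transpose, mul_right_comm]
  rcases Int.isUnit_iff.1 hU with h | h <;> rw [h] <;> ring

/-- A vector of value ±1 splits off orthogonally. The projection is integral because `B 0 0` is its
own inverse. -/
theorem intEquiv_split {B : Matrix (Fin 3) (Fin 3) ℤ} (hB : Bᵀ = B) (h0 : IsUnit (B 0 0)) :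
    ∃ a b c : ℤ, IntEquiv B !![B 0 0, 0, 0; 0, a, b; 0, b, c] := by
  have he : B 0 0 * B 0 0 = 1 := by
    rcases Int.isUnit_iff.1 h0 with h | h <;> rw [h] <;> norm_num
  have h1 : B 1 0 = B 0 1 := congrFun (congrFun hB 0) 1
  have h2 : B 2 0 = B 0 2 := congrFun (congrFun hB 0) 2
  have h3 : B 2 1 = B 1 2 := congrFun (congrFun hB 1) 2
  refine ⟨B 1 1 - B 0 0 * B 0 1 ^ 2, B 1 2 - B 0 0 * B 0 1 * B 0 2,
    B 2 2 - B 0 0 * B 0 2 ^ 2,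
    !![1, -(B 0 0 * B 0 1), -(B 0 0 * B 0 2); 0, 1, 0; 0, 0, 1], by simp [det_fin_three], ?_⟩
  ext i j
  fin_cases i <;> fin_cases j <;> simp [mul_apply, Fin.sum_univ_three, h1, h2, h3]
  · linear_combination (-B 0 1) * he
  · linear_combination (-B 0 2) * he
  · linear_combination (-B 0 1) * he
  · linear_combination (B 0 1 ^ 2 * B 0 0) * he
  · linear_combination (B 0 1 * B 0 2 * B 0 0) * he
  · linear_combination (-B 0 2) * he
  · linear_combination (B 0 1 * B 0 2 * B 0 0) * he
  · linear_combination (B 0 2 ^ 2 * B 0 0) * he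

theorem intEquiv_of_unit_value {B : Matrix (Fin 3) (Fin 3) ℤ} (hB : Bᵀ = B) (hdet : B.det = 1)
    (h0 : IsUnit (B 0 0)) :
    IntEquiv B 1 ∨ IntEquiv B !![1, 0, 0; 0, -1, 0; 0, 0, -1] := by
  obtain ⟨a, b, c, h1⟩ := intEquiv_split hB h0
  obtain ⟨-, hd1⟩ := h1.symm_det hB
  set ε := B 0 0
  have hd : ε * (a * c - b ^ 2) = 1 := by
    rw [← hdet, ← hd1]; simp [det_fin_three]; ring
  obtain ⟨p, q, r, s, hu, h2⟩ := binary_reduction a.natAbs a b c le_rfl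
    (isUnit_of_mul_isUnit_right (x := ε) (hd ▸ isUnit_one))
  set a' := a * p ^ 2 + 2 * b * p * r + c * r ^ 2 with ha'
  set b' := a * p * q + b * (p * s + q * r) + c * r * s with hb'
  set c' := a * q ^ 2 + 2 * b * q * s + c * s ^ 2 with hc'
  have h3 : IntEquiv B !![ε, 0, 0; 0, a', b'; 0, b', c'] := by
    refine h1.trans ⟨!![1, 0, 0; 0, p, q; 0, r, s], by simpa [det_fin_three] using hu, ?_⟩
    ext i j
    fin_cases i <;> fin_cases j <;> simp [mul_apply, Fin.sum_univ_three, ha', hb', hc'] <;> ring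
  have hd' : ε * (a' * c' - b' ^ 2) = 1 := by
    rw [← hdet, ← (h3.symm_det hB).2]; simp [det_fin_three]; ring
  clear_value a' b' c' ε
  rcases Int.isUnit_iff.1 h0 with rfl | rfl <;> rcases h2 with ⟨ha, rfl, hc⟩ | ⟨rfl, rfl, rfl⟩
  · rcases Int.isUnit_iff.1 ha with rfl | rfl
    · obtain rfl : c' = 1 := by linarith
      left; convert h3 using 1; ext i j; fin_cases i <;> fin_cases j <;> rfl
    · obtain rfl : c' = -1 := by linarith
      right; exact h3
  · norm_num at hd'
  · right
    rcases Int.isUnit_iff.1 ha with rfl | rfl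
    · obtain rfl : c' = -1 := by linarith
      exact h3.trans ⟨!![0, 1, 0; 1, 0, 0; 0, 0, 1], by decide, by decide +kernel⟩
    · obtain rfl : c' = 1 := by linarith
      exact h3.trans ⟨!![0, 1, 0; 0, 0, 1; 1, 0, 0], by decide, by decide +kernel⟩
  · right
    -- For the form `-x² + 2yz`, the vectors `(1,1,1)`, `(1,1,0)`, `(1,0,1)` are orthogonal and have
    -- the values `1, -1, -1`.
    exact h3.trans ⟨!![1, 1, 1; 1, 1, 0; 1, 0, 1], by decide, by decide +kernel⟩

theorem intEquiv_of_small_value {B : Matrix (Fin 3) (Fin 3) ℤ} (hB : Bᵀ = B) (hdet : B.det = 1)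
    (h0 : |B 0 0| ≤ 1) :
    IntEquiv B 1 ∨ IntEquiv B !![1, 0, 0; 0, -1, 0; 0, 0, -1] := by
  rcases eq_or_ne (B 0 0) 0 with h | h
  · obtain ⟨p, q, r, s, h1, h2⟩ := exists_bezout_kernel (B 0 1) (B 0 2)
    -- If `B 0 0 = 0`, take `e₀` as the last basis vector and a vector orthogonal to it as the
    -- first. The determinant becomes `-C₀₀ C₁₂²`, so `C₀₀` is a unit, and the previous case
    -- applies.
    have h3 : IntEquiv B _ := ⟨!![0, 0, 1; q, p, 0; s, r, 0], by
      simp [det_fin_three, show q * r - p * s = -1 by linarith], rfl⟩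
    obtain ⟨hs, hd⟩ := h3.symm_det hB
    set C := !![0, 0, 1; q, p, 0; s, r, 0]ᵀ * B * !![0, 0, 1; q, p, 0; s, r, 0] with hC
    have e1 : C 2 2 = 0 := by
      simp [hC, mul_apply, Fin.sum_univ_three, h]
    have e2 : C 0 2 = 0 := by
      have h1 : B 1 0 = B 0 1 := congrFun (congrFun hB 0) 1
      have h2 : B 2 0 = B 0 2 := congrFun (congrFun hB 0) 2
      simp [hC, mul_apply, Fin.sum_univ_three, h1, h2]; linarith
    have e3 : C 2 0 = 0 := by rw [← e2]; exact congrFun (congrFun hs 0) 2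
    have e4 : C 2 1 = C 1 2 := congrFun (congrFun hs 1) 2
    rw [hdet, det_fin_three, e1, e2, e3, e4] at hd
    have hu : IsUnit (C 0 0) := by
      refine isUnit_iff_dvd_one.2 ⟨-(C 1 2 ^ 2), ?_⟩
      linarith
    rw [← hdet] at hd
    rcases intEquiv_of_unit_value hs (by rw [(h3.symm_det hB).2, hdet]) hu with h4 | h4
    · exact Or.inl (h3.trans h4)
    · exact Or.inr (h3.trans h4)
  · refine intEquiv_of_unit_value hB hdet (Int.isUnit_iff_abs_eq.2 ?_)
    have := Int.one_le_abs h
    omega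

/-! ### Symmetric isodualities and the hyperbolic plane -/

theorem exists_unimodular_diag_lt_two {A : Matrix (Fin 3) (Fin 3) ℝ} (hA : A.PosDef)
    (hdet : A.det = 1) :
    ∃ U : Matrix (Fin 3) (Fin 3) ℤ, IsUnit U.det ∧ ((castM U)ᵀ * A * castM U) 0 0 < 2 := by
  obtain ⟨x, hx, hlt⟩ := exists_formValue_lt_two hA hdet
  obtain ⟨U, hU, d, hd⟩ := exists_unimodular_col x
  refine ⟨U, hU, ?_⟩
  have h1 : formValue A x = (d : ℝ) ^ 2 * ((castM U)ᵀ * A * castM U) 0 0 := by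
    rw [diag_congr]
    simp only [formValue, hd, Fin.sum_univ_three]
    push_cast; ring
  have hd0 : d ≠ 0 := by
    rintro rfl
    exact hx (funext fun i => by simp [hd])
  have h2 : (1 : ℝ) ≤ (d : ℝ) ^ 2 := by
    exact_mod_cast (Int.one_le_abs hd0).trans (by rw [← sq_abs]; nlinarith [Int.one_le_abs hd0])
  have h3 := (leading_minors_pos (posDef_congr hA hU)).1
  nlinarith

/-- This is Cauchy–Schwarz for a vector and its image under the isometry `A⁻¹ B`, in the form that
`(A ± B)ᵀ A⁻¹ (A ± B) = 2A ± (B + Bᵀ)` is positive semidefinite. -/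
theorem IsoPair.abs_diag_le {A : Matrix (Fin 3) (Fin 3) ℝ} {B : Matrix (Fin 3) (Fin 3) ℤ}
    (h : IsoPair A B) : |(B 0 0 : ℝ)| ≤ A 0 0 := by
  have hAt := transpose_of_posDef h.posDef
  have key : ∀ M : Matrix (Fin 3) (Fin 3) ℝ, Mᵀ * A⁻¹ * M = A →
      0 ≤ A 0 0 + M 0 0 := by
    intro M hM
    have h1 := h.posDef.inv.posSemidef.conjTranspose_mul_mul_same (A + M)
    rw [conjTranspose_eq_transpose_of_trivial, transpose_add, hAt] at h1
    have h2 : (A + Mᵀ) * A⁻¹ * (A + M) = (A + A) + (M + Mᵀ) := by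
      rw [add_mul, mul_nonsing_inv _ h.isUnit, add_mul, one_mul, mul_add, hM,
        mul_assoc Mᵀ, nonsing_inv_mul _ h.isUnit, mul_one]
      abel
    rw [h2] at h1
    have := h1.diag_nonneg (i := 0)
    simp at this
    linarith
  have h1 := key _ h.rel
  have h2 := key (-castM B) (by simpa using h.rel)
  simp at h1 h2
  exact abs_le.2 ⟨by linarith, by linarith⟩

theorem isReducible_one : IsReducible 1 := by
  refine ⟨1, by simp, Or.inr ⟨1, 1, 0, by norm_num, by norm_num, by norm_num, by norm_num, ?_⟩⟩
  rw [castM_one, conormGram_eq]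
  ext i j
  fin_cases i <;> fin_cases j <;> simp [decomposableConorms]

theorem isReducible_of_isoPair_one {A : Matrix (Fin 3) (Fin 3) ℝ} (h : IsoPair A 1) :
    IsReducible A := by
  have h1 : A * A = 1 := by
    have := h.rel
    rw [castM_one, transpose_one, one_mul, mul_one] at this
    nth_rw 1 [← this]
    exact nonsing_inv_mul _ h.isUnit
  have h2 : IsUnit (A + 1).det := (h.posDef.add PosDef.one).det_pos.ne'.isUnit
  have h3 : (A + 1) * (A - 1) = 0 := by
    rw [add_mul, mul_sub, h1]; simp
  have h4 : A - 1 = 0 := by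
    have := congrArg (fun M => (A + 1)⁻¹ * M) h3
    simpa [← mul_assoc, nonsing_inv_mul _ h2] using this
  rw [sub_eq_zero.1 h4]
  exact isReducible_one

theorem isReducedGram_decomposable {α β γ : ℝ} (hα : 0 ≤ α) (hβ : 0 ≤ β) (hγ : 0 ≤ γ)
    (h : α * β + β * γ + γ * α = 1) :
    IsReducedGram (conormGram (decomposableConorms α β γ)) :=
  Or.inr ⟨α, β, γ, hα, hβ, hγ, h, rfl⟩

/-- The degenerate members of the hyperbolic family are decomposable. -/
theorem isReducible_hyperbolic {a b c : ℝ} (ha : 0 ≤ a) (hb : 0 ≤ b) (hc : 0 ≤ c)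
    (h : a ^ 2 + 2 * a * b + 2 * a * c + 2 * b * c = 1) :
    IsReducible (conormGram (hyperbolicConorms a b c)) := by
  rcases ha.eq_or_lt with rfl | ha'
  · refine ⟨!![-1, 1, -1; -1, 0, -1; -1, 0, 0], by decide, ?_⟩
    convert isReducedGram_decomposable (α := 2 * b ^ 2) (β := 2 * c ^ 2) (γ := 0) (by positivity)
      (by positivity) le_rfl (by nlinarith) using 1
    rw [conormGram_eq, conormGram_eq]
    ext i j
    fin_cases i <;> fin_cases j <;>
      simp [decomposableConorms, hyperbolicConorms, mul_apply, Fin.sum_univ_three] <;>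
      nlinarith
  rcases hb.eq_or_lt with rfl | hb'
  · refine ⟨!![-1, 0, 0; -1, 1, 0; -1, 0, 1], by decide, ?_⟩
    convert isReducedGram_decomposable (α := a ^ 2) (β := 2 * c * (a + c)) (γ := a ^ 2)
      (by positivity) (by positivity) (by positivity)
      (by linear_combination (1 + a ^ 2 + 2 * a * c) * h) using 1
    rw [conormGram_eq, conormGram_eq]
    ext i j
    fin_cases i <;> fin_cases j <;>
      simp [decomposableConorms, hyperbolicConorms, mul_apply, Fin.sum_univ_three] <;>
      nlinarith
  rcases hc.eq_or_lt with rfl | hc'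
  · refine ⟨!![-1, 0, 0; 0, 0, -1; 0, -1, 0], by decide, ?_⟩
    convert isReducedGram_decomposable (α := a ^ 2) (β := 2 * b * (a + b)) (γ := a ^ 2)
      (by positivity) (by positivity) (by positivity)
      (by linear_combination (1 + a ^ 2 + 2 * a * b) * h) using 1
    rw [conormGram_eq, conormGram_eq]
    ext i j
    fin_cases i <;> fin_cases j <;>
      simp [decomposableConorms, hyperbolicConorms, mul_apply, Fin.sum_univ_three] <;>
      nlinarith
  exact ⟨1, by simp, by
    rw [castM_one, transpose_one, one_mul, mul_one]
    exact Or.inl ⟨a, b, c, ha', hb', hc', h, rfl⟩⟩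

/-- The Gram matrix of the lattice associated with a point of the hyperbolic plane. -/
def hyperbolicGram (u₁ u₂ u₃ : ℝ) : Matrix (Fin 3) (Fin 3) ℝ :=
  !![2 * u₁ ^ 2 - 1, 2 * u₁ * u₂, 2 * u₁ * u₃; 2 * u₁ * u₂, 2 * u₂ ^ 2 + 1, 2 * u₂ * u₃;
    2 * u₁ * u₃, 2 * u₂ * u₃, 2 * u₃ ^ 2 + 1]

/-- After sign changes `u₂, u₃ ≥ 0`, and with `a = u₁ - u₂ - u₃`, `b = u₂`, `c = u₃` the hyperboloid
equation becomes the constraint of the hyperbolic family. The condition on `u` is just `a ≥ 0`,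
which makes all conorms nonnegative. -/
theorem isReducible_hyperbolicGram {u₁ u₂ u₃ : ℝ} (h : u₁ ^ 2 - u₂ ^ 2 - u₃ ^ 2 = 1)
    (hu : |u₂| + |u₃| ≤ u₁) : IsReducible (hyperbolicGram u₁ u₂ u₃) := by
  wlog h2 : 0 ≤ u₂ generalizing u₂
  · have := this (u₂ := -u₂) (by simpa using h) (by simpa using hu) (by linarith)
    refine isReducible_of_congr (U := !![1, 0, 0; 0, -1, 0; 0, 0, 1]) (by decide) ?_
    convert this using 1
    ext i j
    fin_cases i <;> fin_cases j <;> simp [hyperbolicGram, mul_apply, Fin.sum_univ_three]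
  wlog h3 : 0 ≤ u₃ generalizing u₃
  · have := this (u₃ := -u₃) (by simpa using h) (by simpa using hu) (by linarith)
    refine isReducible_of_congr (U := !![1, 0, 0; 0, 1, 0; 0, 0, -1]) (by decide) ?_
    convert this using 1
    ext i j
    fin_cases i <;> fin_cases j <;> simp [hyperbolicGram, mul_apply, Fin.sum_univ_three]
  rw [abs_of_nonneg h2, abs_of_nonneg h3] at hu
  have := isReducible_hyperbolic (a := u₁ - u₂ - u₃) (by linarith) h2 h3
    (by linear_combination h)
  refine isReducible_of_congr (U := !![-1, 0, 0; 1, 0, -1; 0, 1, 0]) (by decide) ?_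
  convert this using 1
  rw [conormGram_eq]
  ext i j
  fin_cases i <;> fin_cases j <;>
    simp [hyperbolicGram, hyperbolicConorms, mul_apply, Fin.sum_univ_three] <;> nlinarith

/-- Write `D` for the isoduality. Then `D A⁻¹ D = A` makes `A D` an involution of determinant 1, and
positivity of `A` makes `A + D` a matrix `2uuᵀ` of rank one. The entries of the relation, with the
adjugate as inverse, give `u` explicitly. -/
theorem exists_eq_hyperbolicGram {A : Matrix (Fin 3) (Fin 3) ℝ}
    (h : IsoPair A !![1, 0, 0; 0, -1, 0; 0, 0, -1]) :
    ∃ u₁ u₂ u₃ : ℝ, 0 < u₁ ∧ u₁ ^ 2 - u₂ ^ 2 - u₃ ^ 2 = 1 ∧ A = hyperbolicGram u₁ u₂ u₃ := by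
  have hAt := transpose_of_posDef h.posDef
  obtain ⟨hp, hps, -⟩ := leading_minors_pos h.posDef
  have hadj : A.adjugate = A⁻¹ := by rw [inv_def, h.det_eq]; simp
  have hrel := h.rel
  rw [← hadj, adjugate_fin_three] at hrel
  have hs : 0 < A 1 1 := h.posDef.diag_pos
  have hdet := h.det_eq
  rw [det_fin_three] at hdet
  have hA := eq_of_symm_fin_three hAt
  rw [show A 1 0 = A 0 1 from congrFun (congrFun hAt 0) 1,
    show A 2 0 = A 0 2 from congrFun (congrFun hAt 0) 2,
    show A 2 1 = A 1 2 from congrFun (congrFun hAt 1) 2] at hrel hdet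
  have e00 := congrFun (congrFun hrel 0) 0
  have e01 := congrFun (congrFun hrel 0) 1
  have e02 := congrFun (congrFun hrel 0) 2
  have e11 := congrFun (congrFun hrel 1) 1
  have e12 := congrFun (congrFun hrel 1) 2
  have e22 := congrFun (congrFun hrel 2) 2
  generalize A 0 0 = p at *
  generalize A 0 1 = q at *
  generalize A 0 2 = r at *
  generalize A 1 1 = s at *
  generalize A 1 2 = t at *
  generalize A 2 2 = v at *
  simp [mul_apply, Fin.sum_univ_three] at e00 e01 e02 e11 e12 e22
  have hp2 : p ^ 2 = 1 + q ^ 2 + r ^ 2 := by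
    linear_combination hdet - p * e00 + q * e01 + r * e02
  have hpq : p * q - q * s - r * t = 0 := by linear_combination -p * e01 + q * e11 + r * e12
  -- This says that `A D` has trace `-1`. The entries give it only up to the factor `p - 1`; if `p =
  -- 1`, the form is the identity.
  have hsum : s + v = p + 1 := by
    have h1 : (p - 1) * (p + 1 - (s + v)) = 0 := by
      linear_combination hp2 - e11 - e22
    rcases mul_eq_zero.1 h1 with h2 | h2
    · obtain rfl : p = 1 := by linarith
      have hq : q = 0 := by nlinarith
      have hr : r = 0 := by nlinarith
      subst hq; subst hr
      have hv : v = s := by linarith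
      subst hv
      have ht : t = 0 := by linarith
      subst ht
      nlinarith
    · linarith
  have ht : t * (p + 1) = q * r := by linear_combination -e12
  set u := √((p + 1) / 2) with hu
  have hu0 : 0 < u := Real.sqrt_pos.2 (by linarith)
  have hu2 : u ^ 2 = (p + 1) / 2 := Real.sq_sqrt (by linarith)
  have hpu : p = 2 * u ^ 2 - 1 := by linarith
  have hv : v = 2 * u ^ 2 - s := by linarith
  have hqs : q ^ 2 = (s - 1) * (2 * u ^ 2) := by linear_combination s * hpu - hv - e22
  have hrv : r ^ 2 = (v - 1) * (2 * u ^ 2) := by linear_combination v * hpu - hv - e11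
  have ht' : q * r = t * (2 * u ^ 2) := by rw [← ht, hpu]; ring
  refine ⟨u, q / (2 * u), r / (2 * u), hu0, ?_, ?_⟩
  · field_simp
    linear_combination (-1) * hqs - hrv - 2 * u ^ 2 * hv
  · rw [hA, hyperbolicGram]
    have i1 : 2 * u * (q / (2 * u)) = q := by field_simp
    have i2 : 2 * u * (r / (2 * u)) = r := by field_simp
    have i3 : 2 * (q / (2 * u)) ^ 2 + 1 = s := by field_simp; linear_combination hqs
    have i4 : 2 * (r / (2 * u)) ^ 2 + 1 = v := by field_simp; linear_combination hrv
    have i5 : 2 * (q / (2 * u)) * (r / (2 * u)) = t := by field_simp; linear_combination ht'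
    rw [i1, i2, i3, i4, i5, ← hpu]

theorem isReducible_of_isoPair_diag {A : Matrix (Fin 3) (Fin 3) ℝ}
    (h : IsoPair A !![1, 0, 0; 0, -1, 0; 0, 0, -1]) : IsReducible A := by
  set D : Matrix (Fin 3) (Fin 3) ℤ := !![1, 0, 0; 0, -1, 0; 0, 0, -1] with hD
  obtain ⟨U, hU, hmin⟩ := exists_min_trace h.posDef (S := {U | Uᵀ * D * U = D}) ⟨1, by simp⟩
  have hdetU : ∀ V : Matrix (Fin 3) (Fin 3) ℤ, Vᵀ * D * V = D → IsUnit V.det := by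
    intro V hV
    have := congrArg det hV
    rw [det_mul, det_mul, det_transpose, show D.det = 1 by decide, mul_one] at this
    exact IsUnit.of_mul_eq_one _ this
  have hU' : Uᵀ * D * U = D := hU
  have h' := h.congr (hdetU U hU)
  rw [hU'] at h'
  refine isReducible_of_congr (hdetU U hU) ?_
  obtain ⟨u₁, u₂, u₃, h1, hQ, hA⟩ := exists_eq_hyperbolicGram h'
  have hmin' : ∀ V : Matrix (Fin 3) (Fin 3) ℤ, Vᵀ * D * V = D →
      (hyperbolicGram u₁ u₂ u₃).trace ≤ ((castM V)ᵀ * hyperbolicGram u₁ u₂ u₃ * castM V).trace := by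
    intro V hV
    rw [← hA]
    convert hmin (U * V) _ using 2
    · simp only [castM_mul, transpose_mul, mul_assoc]
    · change (U * V)ᵀ * D * (U * V) = D
      rw [transpose_mul, show Vᵀ * Uᵀ * D * (U * V) = Vᵀ * (Uᵀ * D * U) * V by
        simp only [mul_assoc], hU', hV]
  rw [hA]
  refine isReducible_hyperbolicGram hQ ?_
  -- The trace of `2uuᵀ - D` is `4u₁² - 1`, so `u₁` is minimal in the orbit of `u`. The four
  -- automorphs of `D` below replace `u₁` by `3u₁ ± 2u₂ ± 2u₃`. As `|u₂| + |u₃| < 2u₁`, comparing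
  -- squares gives `u₁ ≤ 3u₁ - 2(|u₂| + |u₃|)`.
  have hu : u₁ ^ 2 ≤ (3 * u₁ - 2 * (|u₂| + |u₃|)) ^ 2 := by
    have t1 := hmin' !![3, 2, 2; -2, -1, -2; -2, -2, -1] (by decide +kernel)
    have t2 := hmin' !![3, 2, 2; -2, -1, -2; 2, 2, 1] (by decide +kernel)
    have t3 := hmin' !![3, 2, 2; 2, 1, 2; -2, -2, -1] (by decide +kernel)
    have t4 := hmin' !![3, 2, 2; 2, 1, 2; 2, 2, 1] (by decide +kernel)
    simp [trace_fin_three, hyperbolicGram, mul_apply, Fin.sum_univ_three] at t1 t2 t3 t4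
    rcases abs_cases u₂ with ⟨e2, -⟩ | ⟨e2, -⟩ <;> rcases abs_cases u₃ with ⟨e3, -⟩ | ⟨e3, -⟩ <;>
      rw [e2, e3] <;> linarith
  have hx : |u₂| + |u₃| < 2 * u₁ := by
    have := sq_abs u₂; have := sq_abs u₃
    nlinarith [sq_nonneg (|u₂| - |u₃|), abs_nonneg u₂, abs_nonneg u₃]
  by_contra! hcon
  nlinarith

theorem isReducible_of_symm {A : Matrix (Fin 3) (Fin 3) ℝ} {B : Matrix (Fin 3) (Fin 3) ℤ}
    (h : IsoPair A B) (hB : Bᵀ = B) : IsReducible A := by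
  wlog hdet : B.det = 1 generalizing B
  · refine this h.neg (by rw [transpose_neg, hB]) ?_
    rcases Int.isUnit_iff.1 h.unit with h | h
    · exact absurd h hdet
    · rw [det_neg, h]; rfl
  obtain ⟨U, hU, hlt⟩ := exists_unimodular_diag_lt_two h.posDef h.det_eq
  have h1 := h.congr hU
  have hsymm := transpose_congr (U := U) hB
  -- The integer `B(x, x)` is bounded by `A(x, x) < 2` at a short vector `x`.
  have h2 : |(Uᵀ * B * U) 0 0| ≤ 1 := by
    have h3 := h1.abs_diag_le.trans_lt hlt
    have : |(Uᵀ * B * U) 0 0| < 2 := by exact_mod_cast h3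
    omega
  have hd : (Uᵀ * B * U).det = 1 := by
    rw [← hdet]; exact (IntEquiv.symm_det ⟨U, hU, rfl⟩ hB).2
  refine isReducible_of_congr hU ?_
  rcases intEquiv_of_small_value hsymm hd h2 with ⟨V, hV, hVe⟩ | ⟨V, hV, hVe⟩
  · have h4 := h1.congr hV
    rw [hVe] at h4
    exact isReducible_of_congr hV (isReducible_of_isoPair_one h4)
  · have h4 := h1.congr hV
    rw [hVe] at h4
    exact isReducible_of_congr hV (isReducible_of_isoPair_diag h4)

/-! ### Nonsymmetric isodualities and their axes -/

theorem eq_of_congr_eq {B C U : Matrix (Fin 3) (Fin 3) ℤ} (hU : IsUnit U.det)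
    (h : Uᵀ * B * U = Uᵀ * C * U) : B = C := by
  have hut : IsUnit Uᵀ.det := by rwa [det_transpose]
  have h1 : ∀ D : Matrix (Fin 3) (Fin 3) ℤ, (Uᵀ)⁻¹ * (Uᵀ * D * U) * U⁻¹ = D := by
    intro D
    rw [mul_assoc Uᵀ, ← mul_assoc (Uᵀ)⁻¹, nonsing_inv_mul _ hut, one_mul, mul_assoc,
      mul_nonsing_inv _ hU, mul_one]
  rw [← h1 B, h, h1]

theorem transpose_congr_ne {B U : Matrix (Fin 3) (Fin 3) ℤ} (hU : IsUnit U.det) (h : Bᵀ ≠ B) :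
    (Uᵀ * B * U)ᵀ ≠ Uᵀ * B * U := by
  intro h1
  refine h (eq_of_congr_eq hU ?_)
  rw [← h1]
  simp only [transpose_mul, transpose_transpose, mul_assoc]

/-- A nonsymmetric integral form has an axis: a primitive vector in the kernel of its
antisymmetric part. -/
theorem exists_symm_col {B : Matrix (Fin 3) (Fin 3) ℤ} (hB : Bᵀ ≠ B) :
    ∃ U : Matrix (Fin 3) (Fin 3) ℤ, IsUnit U.det ∧ ∀ i, (Uᵀ * B * U) i 0 = (Uᵀ * B * U) 0 i := by
  -- The vector that represents `B - Bᵀ` as a cross product; it spans the kernel.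
  obtain ⟨U, hU, d, hd⟩ := exists_unimodular_col
    ![B 1 2 - B 2 1, B 2 0 - B 0 2, B 0 1 - B 1 0]
  have hd0 : d ≠ 0 := by
    rintro rfl
    have h0 := hd 0
    have h1 := hd 1
    have h2 := hd 2
    simp at h0 h1 h2
    apply hB
    ext i j
    fin_cases i <;> fin_cases j <;> simp <;> linarith
  have h0 := hd 0
  have h1 := hd 1
  have h2 := hd 2
  simp at h0 h1 h2
  refine ⟨U, hU, fun i => ?_⟩
  apply mul_left_cancel₀ hd0
  simp only [mul_apply, transpose_apply, Fin.sum_univ_three]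
  linear_combination ((B 0 2 - B 2 0) * U 2 i + (B 0 1 - B 1 0) * U 1 i) * h0 +
    ((B 1 0 - B 0 1) * U 0 i + (B 1 2 - B 2 1) * U 2 i) * h1 +
    ((B 2 0 - B 0 2) * U 0 i + (B 2 1 - B 1 2) * U 1 i) * h2

theorem IsoPair.rel_inv {A : Matrix (Fin 3) (Fin 3) ℝ} {B : Matrix (Fin 3) (Fin 3) ℤ}
    (h : IsoPair A B) : castM B * A⁻¹ * (castM B)ᵀ = A := by
  have hu := isUnit_det_castM h.unit
  have hut : IsUnit (castM B)ᵀ.det := by rwa [det_transpose]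
  have h1 : A⁻¹ * castM B = ((castM B)ᵀ)⁻¹ * A := by
    have := congrArg (fun X => ((castM B)ᵀ)⁻¹ * X) h.rel
    simpa [← mul_assoc, nonsing_inv_mul _ hut] using this
  have h2 : A⁻¹ * castM B * A⁻¹ * (castM B)ᵀ = 1 := by
    rw [h1, mul_assoc _ A, mul_nonsing_inv _ h.isUnit, mul_one, nonsing_inv_mul _ hut]
  have h3 := congrArg (fun M => A * M) h2
  simpa [← mul_assoc, mul_nonsing_inv _ h.isUnit] using h3

/-- Let `w` be the image of the axis `e₀` under the isometry `A⁻¹ B`. Both `B w` and `Bᵀ w` equal `A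
e₀`, so `w` is in the kernel of `B - Bᵀ` and hence a multiple of `e₀`. The factor is ±1 because the
map is an isometry. -/
theorem IsoPair.col_eq {A : Matrix (Fin 3) (Fin 3) ℝ} {B : Matrix (Fin 3) (Fin 3) ℤ}
    (h : IsoPair A B) (hB : Bᵀ ≠ B) (hcol : ∀ i, B i 0 = B 0 i) :
    (∀ i, A i 0 = B i 0) ∨ ∀ i, A i 0 = -B i 0 := by
  have hAu := h.isUnit
  set w : Fin 3 → ℝ := fun i => (A⁻¹ * castM B) i 0 with hw
  have hMe : ∀ i, (castM B) i 0 = (castM B)ᵀ i 0 := fun i => by simp [hcol i]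
  have h1 : ∀ i, (castM B)ᵀ i 0 * w 0 + (castM B)ᵀ i 1 * w 1 + (castM B)ᵀ i 2 * w 2 = A i 0 := by
    intro i
    have := congrFun (congrFun h.rel i) 0
    rw [mul_assoc, mul_apply, Fin.sum_univ_three] at this
    exact this
  have h2 : ∀ i, castM B i 0 * w 0 + castM B i 1 * w 1 + castM B i 2 * w 2 = A i 0 := by
    intro i
    have := congrFun (congrFun h.rel_inv i) 0
    rw [mul_assoc, mul_apply, Fin.sum_univ_three] at this
    have e : ∀ j, (A⁻¹ * (castM B)ᵀ) j 0 = w j := by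
      intro j
      simp only [hw, mul_apply, Fin.sum_univ_three, hMe]
    rwa [e, e, e] at this
  have h3 : ∀ i, castM B i 0 = A i 0 * w 0 + A i 1 * w 1 + A i 2 * w 2 := by
    intro i
    have : A * (A⁻¹ * castM B) = castM B := by rw [← mul_assoc, mul_nonsing_inv _ hAu, one_mul]
    rw [← congrFun (congrFun this i) 0, mul_apply, Fin.sum_univ_three]
  have hκ : (B 1 2 : ℝ) - B 2 1 ≠ 0 := by
    intro h0
    apply hB
    have h12 : B 1 2 = B 2 1 := by exact_mod_cast sub_eq_zero.1 h0
    have := hcol 1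
    have := hcol 2
    ext i j
    fin_cases i <;> fin_cases j <;> simp [*]
  have hc1 : (B 1 0 : ℝ) = B 0 1 := by exact_mod_cast hcol 1
  have hc2 : (B 2 0 : ℝ) = B 0 2 := by exact_mod_cast hcol 2
  have hw2 : w 2 = 0 := by
    have e1 := h1 1
    have e2 := h2 1
    simp at e1 e2
    apply (mul_eq_zero.1 (_ : ((B 1 2 : ℝ) - B 2 1) * w 2 = 0)).resolve_left hκ
    linear_combination e2 - e1 - w 0 * hc1
  have hw1 : w 1 = 0 := by
    have e1 := h1 2
    have e2 := h2 2
    simp at e1 e2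
    apply (mul_eq_zero.1 (_ : ((B 1 2 : ℝ) - B 2 1) * w 1 = 0)).resolve_left hκ
    linear_combination e1 - e2 + w 0 * hc2
  have h4 : ∀ i, (B i 0 : ℝ) = A i 0 * w 0 := fun i => by
    have := h3 i
    rw [hw1, hw2] at this
    simpa using this
  have h5 : w 0 * w 0 = 1 := by
    have e2 := h2 0
    rw [hw1, hw2] at e2
    simp at e2
    rw [h4 0, mul_assoc] at e2
    exact mul_left_cancel₀ (leading_minors_pos h.posDef).1.ne' (by rw [e2, mul_one])
  rcases mul_self_eq_one_iff.1 h5 with h6 | h6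
  · exact Or.inl fun i => by rw [h4, h6, mul_one]
  · exact Or.inr fun i => by rw [h4, h6]; ring

/-- An isodual form whose isoduality `B` has the axis `c`, in a basis that is adapted to the
orthogonal complement of `c`. -/
structure AxialPair (A : Matrix (Fin 3) (Fin 3) ℝ) (B : Matrix (Fin 3) (Fin 3) ℤ)
    (c : Fin 3 → ℤ) : Prop extends IsoPair A B where
  form_mulVec : A *ᵥ (fun i => (c i : ℝ)) = ![1, 0, 0]
  mulVec : B *ᵥ c = ![1, 0, 0]
  transpose_mulVec : Bᵀ *ᵥ c = ![1, 0, 0]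
  not_symm : Bᵀ ≠ B

theorem AxialPair.congr {A : Matrix (Fin 3) (Fin 3) ℝ} {B : Matrix (Fin 3) (Fin 3) ℤ}
    {c : Fin 3 → ℤ} (h : AxialPair A B c) {U : Matrix (Fin 3) (Fin 3) ℤ} (hU : IsUnit U.det)
    (hrow : Uᵀ *ᵥ ![1, 0, 0] = ![1, 0, 0]) {c' : Fin 3 → ℤ} (hc : U *ᵥ c' = c) :
    AxialPair ((castM U)ᵀ * A * castM U) (Uᵀ * B * U) c' where
  toIsoPair := h.toIsoPair.congr hU
  form_mulVec := by
    have e1 : castM U *ᵥ (fun i => (c' i : ℝ)) = fun i => (c i : ℝ) := by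
      rw [← hc]; ext i; simp [Matrix.mulVec, dotProduct]
    have e2 : (castM U)ᵀ *ᵥ ![1, 0, 0] = ![1, 0, 0] := by
      ext i
      have := congrArg (Int.cast : ℤ → ℝ) (congrFun hrow i)
      simp [Matrix.mulVec, dotProduct, Fin.sum_univ_three] at this ⊢
      rw [this]
      fin_cases i <;> simp
    rw [← mulVec_mulVec, e1, ← mulVec_mulVec, h.form_mulVec, e2]
  mulVec := by rw [← mulVec_mulVec, hc, ← mulVec_mulVec, h.mulVec, hrow]
  transpose_mulVec := by
    rw [transpose_mul, transpose_mul, transpose_transpose, ← mulVec_mulVec, ← mulVec_mulVec, hc,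
      h.transpose_mulVec, hrow]
  not_symm := transpose_congr_ne hU h.not_symm

theorem exists_axialPair_of_col_eq {A : Matrix (Fin 3) (Fin 3) ℝ} {B : Matrix (Fin 3) (Fin 3) ℤ}
    (h : IsoPair A B) (hB : Bᵀ ≠ B) (hcol : ∀ i, B i 0 = B 0 i) (hA : ∀ i, A i 0 = B i 0) :
    ∃ U : Matrix (Fin 3) (Fin 3) ℤ, IsUnit U.det ∧ ∃ c,
      AxialPair ((castM U)ᵀ * A * castM U) (Uᵀ * B * U) c := by
  obtain ⟨U, hU, g, hg⟩ := exists_unimodular_vecMul fun i => B i 0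
  have h1 := h.congr hU
  -- the axis in the new basis
  have hUc : U *ᵥ (U⁻¹ *ᵥ ![1, 0, 0]) = ![1, 0, 0] := by
    rw [mulVec_mulVec, mul_nonsing_inv _ hU, one_mulVec]
  set c := U⁻¹ *ᵥ ![1, 0, 0] with hc
  have e1 : B *ᵥ ![1, 0, 0] = fun i => B i 0 := by
    ext i; simp [mulVec, dotProduct, Fin.sum_univ_three]
  have e2 : Bᵀ *ᵥ ![1, 0, 0] = fun i => B i 0 := by
    ext i; simp [mulVec, dotProduct, Fin.sum_univ_three, hcol]
  have hBc : (Uᵀ * B * U) *ᵥ c = ![g, 0, 0] := by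
    rw [← mulVec_mulVec, hUc, ← mulVec_mulVec, e1, mulVec_transpose, hg]
  have hBtc : (Uᵀ * B * U)ᵀ *ᵥ c = ![g, 0, 0] := by
    rw [transpose_mul, transpose_mul, transpose_transpose, ← mulVec_mulVec, ← mulVec_mulVec, hUc,
      e2, mulVec_transpose, hg]
  have hAc : ((castM U)ᵀ * A * castM U) *ᵥ (fun i => (c i : ℝ)) = ![(g : ℝ), 0, 0] := by
    have e3 : castM U *ᵥ (fun i => (c i : ℝ)) = ![1, 0, 0] := by
      ext i
      have := congrArg (Int.cast : ℤ → ℝ) (congrFun hUc i)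
      simp [Matrix.mulVec, dotProduct, Fin.sum_univ_three] at this ⊢
      rw [this]
      fin_cases i <;> simp
    have e4 : A *ᵥ ![1, 0, 0] = fun i => (B i 0 : ℝ) := by
      ext i; simp [mulVec, dotProduct, Fin.sum_univ_three, hA]
    rw [← mulVec_mulVec, e3, ← mulVec_mulVec, e4, mulVec_transpose]
    ext i
    have := congrArg (Int.cast : ℤ → ℝ) (congrFun hg i)
    simp [vecMul, dotProduct, Fin.sum_univ_three] at this ⊢
    rw [this]
    fin_cases i <;> simp
  -- The axis `c` is primitive, and `B c = (g, 0, 0)` with invertible `B` makes every entry of `c`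
  -- divisible by `g`.
  have hgu : IsUnit g := by
    have h2 : ∀ i, g ∣ c i := by
      intro i
      have h3 := congrArg (fun v => ((Uᵀ * B * U)⁻¹ *ᵥ v) i) hBc
      simp only [mulVec_mulVec, nonsing_inv_mul _ h1.unit, one_mulVec] at h3
      rw [h3]
      simp [Matrix.mulVec, dotProduct, Fin.sum_univ_three]
    rw [isUnit_iff_dvd_one]
    have h4 := congrFun hUc 0
    simp [Matrix.mulVec, dotProduct, Fin.sum_univ_three] at h4
    rw [← h4]
    exact dvd_add (dvd_add ((h2 0).mul_left _) ((h2 1).mul_left _)) ((h2 2).mul_left _)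
  refine ⟨U, hU, ?_⟩
  rcases Int.isUnit_iff.1 hgu with rfl | rfl
  · exact ⟨c, h1, by simpa using hAc, hBc, hBtc, transpose_congr_ne hU hB⟩
  · refine ⟨-c, h1, ?_, ?_, ?_, transpose_congr_ne hU hB⟩
    · rw [show (fun i => (((-c) i : ℤ) : ℝ)) = -fun i => (c i : ℝ) by ext; simp, mulVec_neg, hAc]
      simp
    · rw [mulVec_neg, hBc]; simp
    · rw [mulVec_neg, hBtc]; simp

theorem exists_axialPair {A : Matrix (Fin 3) (Fin 3) ℝ} {B : Matrix (Fin 3) (Fin 3) ℤ}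
    (h : IsoPair A B) (hB : Bᵀ ≠ B) :
    ∃ U : Matrix (Fin 3) (Fin 3) ℤ, IsUnit U.det ∧ ∃ B' c,
      AxialPair ((castM U)ᵀ * A * castM U) B' c := by
  obtain ⟨U, hU, hcol⟩ := exists_symm_col hB
  have h1 := h.congr hU
  have h2 := transpose_congr_ne hU hB
  obtain ⟨V, hV, B', c, hc⟩ : ∃ V : Matrix (Fin 3) (Fin 3) ℤ, IsUnit V.det ∧ ∃ B' c,
      AxialPair ((castM V)ᵀ * ((castM U)ᵀ * A * castM U) * castM V) B' c := by
    rcases h1.col_eq h2 hcol with h3 | h3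
    · obtain ⟨V, hV, c, hc⟩ := exists_axialPair_of_col_eq h1 h2 hcol h3
      exact ⟨V, hV, _, c, hc⟩
    · obtain ⟨V, hV, c, hc⟩ := exists_axialPair_of_col_eq h1.neg
        (by rw [transpose_neg]; exact fun h4 => h2 (neg_injective h4))
        (fun i => by rw [neg_apply, neg_apply, hcol])
        (fun i => by rw [h3, neg_apply, Int.cast_neg])
      exact ⟨V, hV, _, c, hc⟩
  refine ⟨U * V, by rw [det_mul]; exact hU.mul hV, B', c, ?_⟩
  rw [castM_mul, transpose_mul]
  simpa only [mul_assoc] using hc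

/-- Minimizing the trace over the basis changes that respect the axis reduces the form on the plane
of the last two basis vectors. After a sign change these vectors and the negative of their sum form
an obtuse superbase of the plane lattice. -/
theorem AxialPair.exists_planar_reduced {A : Matrix (Fin 3) (Fin 3) ℝ}
    {B : Matrix (Fin 3) (Fin 3) ℤ} {c : Fin 3 → ℤ} (h : AxialPair A B c) :
    ∃ U : Matrix (Fin 3) (Fin 3) ℤ, IsUnit U.det ∧ ∃ A' B' c', A' = (castM U)ᵀ * A * castM U ∧
      AxialPair A' B' c' ∧ A' 1 2 ≤ 0 ∧ 0 ≤ A' 1 1 + 2 * A' 1 2 ∧ 0 ≤ A' 2 2 + 2 * A' 1 2 := by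
  obtain ⟨U, ⟨hU, hrow⟩, hmin⟩ := exists_min_trace h.posDef
    (S := {U | IsUnit U.det ∧ Uᵀ *ᵥ ![1, 0, 0] = ![1, 0, 0]}) ⟨1, by simp⟩
  have h1 := h.congr hU hrow (c' := U⁻¹ *ᵥ c) (by rw [mulVec_mulVec, mul_nonsing_inv _ hU, one_mulVec])
  set A' := (castM U)ᵀ * A * castM U with hA'
  have hmin' : ∀ V : Matrix (Fin 3) (Fin 3) ℤ, IsUnit V.det → Vᵀ *ᵥ ![1, 0, 0] = ![1, 0, 0] →
      A'.trace ≤ ((castM V)ᵀ * A' * castM V).trace := by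
    intro V hV hVr
    convert hmin (U * V) _ using 2
    · simp only [hA', castM_mul, transpose_mul, mul_assoc]
    · rw [Set.mem_ofPred_eq, det_mul, transpose_mul, ← mulVec_mulVec, hrow, hVr]
      exact ⟨hU.mul hV, rfl⟩
  have h21 : A' 2 1 = A' 1 2 := congrFun (congrFun (transpose_of_posDef h1.posDef) 1) 2
  have t1 := hmin' !![1, 0, 0; 0, 1, 1; 0, 0, 1] (by decide) (by decide +kernel)
  have t2 := hmin' !![1, 0, 0; 0, 1, -1; 0, 0, 1] (by decide) (by decide +kernel)
  have t3 := hmin' !![1, 0, 0; 0, 1, 0; 0, 1, 1] (by decide) (by decide +kernel)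
  have t4 := hmin' !![1, 0, 0; 0, 1, 0; 0, -1, 1] (by decide) (by decide +kernel)
  simp [trace_fin_three, mul_apply, Fin.sum_univ_three, h21] at t1 t2 t3 t4
  rcases le_total (A' 1 2) 0 with h0 | h0
  · exact ⟨U, hU, A', _, _, rfl, h1, h0, by linarith, by linarith⟩
  · have hVd : IsUnit (!![1, 0, 0; 0, 1, 0; 0, 0, -1] : Matrix (Fin 3) (Fin 3) ℤ).det := by decide
    have h2 := h1.congr (U := !![1, 0, 0; 0, 1, 0; 0, 0, -1]) (by decide) (by decide +kernel)
      (c' := (!![1, 0, 0; 0, 1, 0; 0, 0, -1] : Matrix (Fin 3) (Fin 3) ℤ)⁻¹ *ᵥ (U⁻¹ *ᵥ c))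
      (by rw [mulVec_mulVec, mul_nonsing_inv _ hVd, one_mulVec])
    refine ⟨U * !![1, 0, 0; 0, 1, 0; 0, 0, -1], by rw [det_mul]; exact hU.mul (by decide),
      _, _, _, ?_, h2, ?_, ?_, ?_⟩
    · simp only [hA', castM_mul, transpose_mul, mul_assoc]
    all_goals simp [mul_apply, Fin.sum_univ_three]; linarith

/-- The restriction `[p, q; r, s]` of an isoduality to the plane orthogonal to its axis, in terms
of the plane form `[a, h; h, b]`. -/
theorem AxialPair.planar_relations {A : Matrix (Fin 3) (Fin 3) ℝ}
    {B : Matrix (Fin 3) (Fin 3) ℤ} {c : Fin 3 → ℤ} (h : AxialPair A B c) :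
    ∃ (m : ℤ) (t : ℝ), m ≠ 0 ∧ B 1 2 - B 2 1 = m * c 0 ∧
      (c 0 : ℝ) = A 1 1 * A 2 2 - A 1 2 ^ 2 ∧ 2 * (B 1 1 : ℝ) = A 1 1 * t ∧
      (B 1 2 : ℝ) + B 2 1 = A 1 2 * t ∧ 2 * (B 2 2 : ℝ) = A 2 2 * t ∧ m ^ 2 * c 0 = 4 - t ^ 2 := by
  have hAt := transpose_of_posDef h.posDef
  have hs1 : A 1 0 = A 0 1 := congrFun (congrFun hAt 0) 1
  have hs2 : A 2 0 = A 0 2 := congrFun (congrFun hAt 0) 2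
  have hs3 : A 2 1 = A 1 2 := congrFun (congrFun hAt 1) 2
  have hdet := h.det_eq
  rw [det_fin_three, hs1, hs2, hs3] at hdet
  have ac : ∀ i, A i 0 * c 0 + A i 1 * c 1 + A i 2 * c 2 = ![(1 : ℝ), 0, 0] i := by
    intro i
    rw [← h.form_mulVec]; simp [Matrix.mulVec, dotProduct, Fin.sum_univ_three]
  have bc : ∀ i, B i 0 * c 0 + B i 1 * c 1 + B i 2 * c 2 = ![(1 : ℤ), 0, 0] i := by
    intro i
    rw [← h.mulVec]; simp [Matrix.mulVec, dotProduct, Fin.sum_univ_three]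
  have cb : ∀ i, B 0 i * c 0 + B 1 i * c 1 + B 2 i * c 2 = ![(1 : ℤ), 0, 0] i := by
    intro i
    rw [← h.transpose_mulVec]; simp [Matrix.mulVec, dotProduct, Fin.sum_univ_three]
  have a0 := ac 0; have a1 := ac 1; have a2 := ac 2
  have b0 := bc 0; have b1 := bc 1; have b2 := bc 2
  have d0 := cb 0; have d1 := cb 1; have d2 := cb 2
  simp [hs1, hs2, hs3] at a0 a1 a2 b0 b1 b2 d0 d1 d2
  -- By `A c = (1, 0, 0)` the axis is the first column of `A⁻¹`, so `c 0` is the determinant of the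
  -- plane form.
  have hc0 : (c 0 : ℝ) = A 1 1 * A 2 2 - A 1 2 ^ 2 := by
    linear_combination (-c 0) * hdet + (A 1 1 * A 2 2 - A 1 2 ^ 2) * a0 -
      (A 0 1 * A 2 2 - A 0 2 * A 1 2) * a1 + (A 0 1 * A 1 2 - A 0 2 * A 1 1) * a2
  have hc0pos : (0 : ℝ) < c 0 := by
    have := h.posDef.inv.diag_pos (i := 0)
    rw [inv_def, h.det_eq, adjugate_fin_three] at this
    simp [hs3] at this
    rw [hc0]; linarith
  have hc0ne : c 0 ≠ 0 := by rintro h0; simp [h0] at hc0pos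
  -- the isometry `N = A⁻¹ B`
  set N := A⁻¹ * castM B with hN
  have hAN : A * N = castM B := by rw [hN, ← mul_assoc, mul_nonsing_inv _ h.isUnit, one_mul]
  have hNB : Nᵀ * castM B = A := by
    rw [hN, transpose_mul, transpose_nonsing_inv, hAt]; exact h.rel
  have an : ∀ i j, A i 0 * N 0 j + A i 1 * N 1 j + A i 2 * N 2 j = B i j := by
    intro i j
    have := congrFun (congrFun hAN i) j
    rw [mul_apply, Fin.sum_univ_three] at this
    exact this
  have nb : ∀ i j, N 0 i * B 0 j + N 1 i * B 1 j + N 2 i * B 2 j = A i j := by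
    intro i j
    have := congrFun (congrFun hNB i) j
    rw [mul_apply, Fin.sum_univ_three] at this
    exact this
  have hN0 : ∀ j, N 0 j = B 0 j * c 0 + B 1 j * c 1 + B 2 j * c 2 := by
    intro j
    have e0 := an 0 j; have e1 := an 1 j; have e2 := an 2 j
    rw [hs1] at e1
    rw [hs2, hs3] at e2
    linear_combination (-N 0 j) * a0 - N 1 j * a1 - N 2 j * a2 + c 0 * e0 + c 1 * e1 + c 2 * e2
  have hN00 : N 0 0 = 1 := by rw [hN0]; exact_mod_cast d0
  have hN01 : N 0 1 = 0 := by rw [hN0]; exact_mod_cast d1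
  have hN02 : N 0 2 = 0 := by rw [hN0]; exact_mod_cast d2
  have hdN : N.det = B.det := by
    have := congrArg det hAN
    rwa [det_mul, h.det_eq, one_mul, det_castM] at this
  rw [det_fin_three, hN00, hN01, hN02] at hdN
  have an11 := an 1 1; have an12 := an 1 2; have an21 := an 2 1; have an22 := an 2 2
  have nb11 := nb 1 1; have nb12 := nb 1 2; have nb21 := nb 2 1; have nb22 := nb 2 2
  simp only [hN01, hN02, hs3] at an11 an12 an21 an22 nb11 nb12 nb21 nb22
  -- the axis spans the kernel of the antisymmetric part
  have hκ : B 1 2 - B 2 1 = (B 0 0 * (B 1 2 - B 2 1) - B 0 1 * (B 0 2 - B 2 0) +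
      B 0 2 * (B 0 1 - B 1 0)) * c 0 := by
    linear_combination (-(B 1 2 - B 2 1)) * b0 + B 0 2 * (b1 - d1) - B 0 1 * (b2 - d2)
  set m := B 0 0 * (B 1 2 - B 2 1) - B 0 1 * (B 0 2 - B 2 0) + B 0 2 * (B 0 1 - B 1 0)
  have hm : m ≠ 0 := by
    intro h0
    rw [h0, zero_mul] at hκ
    have k1 : B 0 1 - B 1 0 = 0 := (mul_eq_zero.1 (by
      linear_combination d1 - b1 + c 2 * hκ : (B 0 1 - B 1 0) * c 0 = 0)).resolve_right hc0ne
    have k2 : B 0 2 - B 2 0 = 0 := (mul_eq_zero.1 (by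
      linear_combination d2 - b2 - c 1 * hκ : (B 0 2 - B 2 0) * c 0 = 0)).resolve_right hc0ne
    apply h.not_symm
    ext i j
    fin_cases i <;> fin_cases j <;> simp <;> linarith
  have hκ' : (B 1 2 : ℝ) - B 2 1 = m * c 0 := by exact_mod_cast hκ
  clear_value m
  set D := N 1 1 * N 2 2 - N 1 2 * N 2 1 with hD
  have c11 : D * B 1 1 = N 2 2 * A 1 1 - N 2 1 * A 1 2 := by
    linear_combination N 2 2 * nb11 - N 2 1 * nb21
  have c12 : D * B 1 2 = N 2 2 * A 1 2 - N 2 1 * A 2 2 := by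
    linear_combination N 2 2 * nb12 - N 2 1 * nb22
  have c21 : D * B 2 1 = N 1 1 * A 1 2 - N 1 2 * A 1 1 := by
    linear_combination N 1 1 * nb21 - N 1 2 * nb11
  have c22 : D * B 2 2 = N 1 1 * A 2 2 - N 1 2 * A 1 2 := by
    linear_combination N 1 1 * nb22 - N 1 2 * nb12
  -- The isometry acts on the plane as a rotation. A reflection has trace 0, which would make the
  -- plane block of `B` symmetric, contrary to `m ≠ 0`.
  have hdet1 : D = 1 := by
    rcases Int.isUnit_iff.1 h.unit with h1 | h1
    · rw [h1] at hdN; push_cast at hdN; linarith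
    · exfalso
      rw [h1] at hdN
      have hd : D = -1 := by push_cast at hdN; linarith
      have ha : A 1 1 ≠ 0 := h.posDef.diag_pos.ne'
      have htr : N 1 1 + N 2 2 = 0 := (mul_eq_zero.1 (by
        linear_combination an11 - c11 + B 1 1 * hd :
          A 1 1 * (N 1 1 + N 2 2) = 0)).resolve_left ha
      have : (m : ℝ) * c 0 = 0 := by
        rw [← hκ']
        linear_combination (-1) * an12 - B 2 1 * hd + c21 + A 1 2 * htr
      exact (mul_ne_zero (Int.cast_ne_zero.2 hm) hc0pos.ne') this
  rw [hdet1, one_mul] at c11 c12 c21 c22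
  have e1 : 2 * (B 1 1 : ℝ) = A 1 1 * (N 1 1 + N 2 2) := by linear_combination c11 - an11
  have e2 : (B 1 2 : ℝ) + B 2 1 = A 1 2 * (N 1 1 + N 2 2) := by linear_combination c21 - an12
  have e3 : 2 * (B 2 2 : ℝ) = A 2 2 * (N 1 1 + N 2 2) := by linear_combination c22 - an22
  refine ⟨m, N 1 1 + N 2 2, hm, hκ, hc0, e1, e2, e3, ?_⟩
  -- The plane block of `B` is the plane form times a rotation and has the same determinant.
  -- Splitting the block into its symmetric part, `t/2` times the plane form, and its antisymmetric
  -- part yields the last relation.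
  have hJ : (B 1 1 : ℝ) * B 2 2 - B 1 2 * B 2 1 = c 0 := by
    rw [hc0, ← one_mul (A 1 1 * A 2 2 - _), ← hdet1, hD, ← an11, ← an12, ← an21, ← an22]
    ring
  apply mul_left_cancel₀ hc0pos.ne'
  set t := N 1 1 + N 2 2
  linear_combination 4 * hJ - (m * c 0 + (B 1 2 - B 2 1 : ℝ)) * hκ' - 2 * B 2 2 * e1 +
    (B 1 2 + B 2 1 + A 1 2 * t) * e2 - A 1 1 * t * e3 + t ^ 2 * hc0

/-- Adding plane vectors to the first basis vector leaves the plane form alone, so only `c 1` and `c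
2` modulo `c 0` matter. -/
theorem AxialPair.shift {A : Matrix (Fin 3) (Fin 3) ℝ} {B : Matrix (Fin 3) (Fin 3) ℤ}
    {c : Fin 3 → ℤ} (h : AxialPair A B c) (k l : ℤ) :
    ∃ U : Matrix (Fin 3) (Fin 3) ℤ, IsUnit U.det ∧ ∃ A' B', A' = (castM U)ᵀ * A * castM U ∧
      AxialPair A' B' ![c 0, c 1 - k * c 0, c 2 - l * c 0] ∧
      A' 1 1 = A 1 1 ∧ A' 1 2 = A 1 2 ∧ A' 2 2 = A 2 2 := by
  refine ⟨!![1, 0, 0; k, 1, 0; l, 0, 1], by simp [det_fin_three], _, _, rfl,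
    h.congr (by simp [det_fin_three]) ?_ ?_, ?_, ?_, ?_⟩
  · ext i; fin_cases i <;> simp [Matrix.mulVec, dotProduct, Fin.sum_univ_three]
  · ext i; fin_cases i <;> simp [Matrix.mulVec, dotProduct, Fin.sum_univ_three]
  all_goals simp [mul_apply, Fin.sum_univ_three]

theorem AxialPair.form_eq {A : Matrix (Fin 3) (Fin 3) ℝ} {B : Matrix (Fin 3) (Fin 3) ℤ}
    {c : Fin 3 → ℤ} (h : AxialPair A B c) :
    A = !![A 0 0, A 0 1, A 0 2; A 0 1, A 1 1, A 1 2; A 0 2, A 1 2, A 2 2] ∧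
    A 0 0 * c 0 + A 0 1 * c 1 + A 0 2 * c 2 = 1 ∧
    A 0 1 * c 0 + A 1 1 * c 1 + A 1 2 * c 2 = 0 ∧
    A 0 2 * c 0 + A 1 2 * c 1 + A 2 2 * c 2 = 0 := by
  have hAt := transpose_of_posDef h.posDef
  have ac : ∀ i, A i 0 * c 0 + A i 1 * c 1 + A i 2 * c 2 = ![(1 : ℝ), 0, 0] i := by
    intro i
    rw [← h.form_mulVec]; simp [Matrix.mulVec, dotProduct, Fin.sum_univ_three]
  have a1 := ac 1; have a2 := ac 2
  rw [show A 1 0 = A 0 1 from congrFun (congrFun hAt 0) 1] at a1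
  rw [show A 2 0 = A 0 2 from congrFun (congrFun hAt 0) 2,
    show A 2 1 = A 1 2 from congrFun (congrFun hAt 1) 2] at a2
  exact ⟨eq_of_symm_fin_three hAt, ac 0, a1, a2⟩

/-- The parameters of the mean-centered cuboidal lattice in the hyperbolic family are
`mccSide, mccSide / √2, mccSide / √2`. -/
noncomputable def mccSide : ℝ := √((√2 - 1) / 2)

theorem mccSide_sq : mccSide ^ 2 = (√2 - 1) / 2 :=
  Real.sq_sqrt (by have := Real.one_lt_sqrt_two; linarith)

theorem mccSide_pos : 0 < mccSide :=
  Real.sqrt_pos.2 (by have := Real.one_lt_sqrt_two; linarith)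

theorem hyperbolicConorms_mcc : hyperbolicConorms mccSide (mccSide / √2) (mccSide / √2) =
    ![(√2 - 1) / 2, 1 / 2, 1 / 2, 1 / 2, 1 / 2, (√2 - 1) / 2] := by
  have h1 := mccSide_sq
  have h2 : √2 ^ 2 = 2 := Real.sq_sqrt (by norm_num)
  have e0 : mccSide * (mccSide + 2 * (mccSide / √2)) = 1 / 2 := by
    field_simp; linear_combination (√2 * 2 + 4) * h1 + h2
  have e1 : 2 * (mccSide / √2) * (mccSide + mccSide / √2) = 1 / 2 := by
    field_simp; linear_combination 4 * (√2 + 1) * h1 + h2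
  have e2 : 2 * (mccSide / √2) * (mccSide / √2) = (√2 - 1) / 2 := by
    field_simp; linear_combination 4 * h1 + (1 - √2) * h2
  simp only [hyperbolicConorms, e0, e1, e2, h1]

theorem mccGram_eq :
    mccGram = conormGram (hyperbolicConorms mccSide (mccSide / √2) (mccSide / √2)) := by
  rw [hyperbolicConorms_mcc, conormGram_eq, mccGram]
  ext i j
  fin_cases i <;> fin_cases j <;> simp <;> ring

theorem mcc_constraint : mccSide ^ 2 + 2 * mccSide * (mccSide / √2) +
    2 * mccSide * (mccSide / √2) + 2 * (mccSide / √2) * (mccSide / √2) = 1 := by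
  have h1 := mccSide_sq
  have h2 : √2 ^ 2 = 2 := Real.sq_sqrt (by norm_num)
  have h3 : mccSide / √2 = mccSide * √2 / 2 := by field_simp; linear_combination (-mccSide) * h2
  rw [h3]
  linear_combination (1 + 2 * √2 + √2 ^ 2 / 2) * h1 + (√2 / 4 + 3 / 4) * h2

theorem isReducible_mccGram : IsReducible mccGram := by
  rw [mccGram_eq]
  have := mccSide_pos
  exact isReducible_hyperbolic this.le (by positivity) (by positivity) mcc_constraint

/-- If `c 0 = 1`, the axis completes the basis of its orthogonal plane to a basis of the lattice,
and it has norm 1. -/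
theorem AxialPair.isReducible_of_axis_one {A : Matrix (Fin 3) (Fin 3) ℝ}
    {B : Matrix (Fin 3) (Fin 3) ℤ} {c : Fin 3 → ℤ} (h : AxialPair A B c) (h0 : A 1 2 ≤ 0)
    (h1 : 0 ≤ A 1 1 + 2 * A 1 2) (h2 : 0 ≤ A 2 2 + 2 * A 1 2) (h3 : c 0 = 1)
    (hc0 : A 1 1 * A 2 2 - A 1 2 ^ 2 = 1) : IsReducible A := by
  obtain ⟨hA, a0, a1, a2⟩ := h.form_eq
  rw [h3] at a0 a1 a2
  push_cast at a0 a1 a2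
  refine ⟨!![0, 0, 1; 1, 0, c 1; 0, 1, c 2], by simp [det_fin_three], ?_⟩
  convert isReducedGram_decomposable (α := A 1 1 + A 1 2) (β := A 2 2 + A 1 2) (γ := -A 1 2)
    (by linarith) (by linarith) (by linarith) (by linarith) using 1
  rw [conormGram_eq]
  generalize A 0 0 = x at *
  generalize A 0 1 = y at *
  generalize A 0 2 = z at *
  generalize A 1 1 = a at *
  generalize A 1 2 = g at *
  generalize A 2 2 = b at *
  subst hA
  ext i j
  fin_cases i <;> fin_cases j <;>
    simp [decomposableConorms, mul_apply, Fin.sum_univ_three]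
  · linear_combination a1
  · linear_combination a2
  · linear_combination a1
  · linear_combination a2
  · linear_combination a0 + c 1 * a1 + c 2 * a2

/-- The plane lattice is square, and the odd entries of the axis determine how it is glued to the
axis. The result is `M₃`. -/
theorem AxialPair.isReducible_of_axis_two {A : Matrix (Fin 3) (Fin 3) ℝ}
    {B : Matrix (Fin 3) (Fin 3) ℤ} {c : Fin 3 → ℤ} (h : AxialPair A B c) (hA12 : A 1 2 = 0)
    (hA11 : A 1 1 = √2) (hA22 : A 2 2 = √2) (h3 : c 0 = 2) {k l : ℤ} (hk : c 1 = 2 * k + 1)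
    (hl : c 2 = 2 * l + 1) : IsReducible A := by
  obtain ⟨U, hU, A', B', hA', h', e11, e12, e22⟩ := h.shift k l
  obtain ⟨hA, a0, a1, a2⟩ := h'.form_eq
  refine isReducible_of_congr hU ?_
  rw [← hA']
  rw [e11, hA11, e12, hA12, e22, hA22] at hA
  simp only [e11, hA11, e12, hA12, e22, hA22, h3, hk, hl] at a0 a1 a2
  simp at a0 a1 a2
  have f1 : A' 0 1 = -√2 / 2 := by linarith
  have f2 : A' 0 2 = -√2 / 2 := by linarith
  have f0 : A' 0 0 = (1 + √2) / 2 := by rw [f1, f2] at a0; linarith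
  rw [f0, f1, f2] at hA
  refine isReducible_of_congr (U := !![-1, 1, 1; -1, 0, 1; 0, 0, 1]) (by decide) ?_
  convert isReducible_mccGram using 1
  rw [hA]
  ext i j
  fin_cases i <;> fin_cases j <;> simp [mccGram, mul_apply, Fin.sum_univ_three] <;> ring

/-- The plane lattice is hexagonal and the axis is a body diagonal of the cubic lattice. -/
theorem AxialPair.isReducible_of_axis_three {A : Matrix (Fin 3) (Fin 3) ℝ}
    {B : Matrix (Fin 3) (Fin 3) ℤ} {c : Fin 3 → ℤ} (h : AxialPair A B c) (hA12 : A 1 2 = -1)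
    (hA11 : A 1 1 = 2) (hA22 : A 2 2 = 2) (h3 : c 0 = 3) {ε k l : ℤ} (hε : ε = 1 ∨ ε = -1)
    (hk : c 1 = 3 * k + ε) (hl : c 2 = 3 * l - ε) : IsReducible A := by
  obtain ⟨U, hU, A', B', hA', h', e11, e12, e22⟩ := h.shift k l
  obtain ⟨hA, a0, a1, a2⟩ := h'.form_eq
  refine isReducible_of_congr hU ?_
  rw [← hA']
  rw [e11, hA11, e12, hA12, e22, hA22] at hA
  simp only [e11, hA11, e12, hA12, e22, hA22, h3, hk, hl] at a0 a1 a2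
  simp at a0 a1 a2
  have f1 : A' 0 1 = -ε := by linarith
  have f2 : A' 0 2 = ε := by linarith
  have f0 : A' 0 0 = 1 := by
    rw [f1, f2] at a0
    rcases hε with rfl | rfl <;> norm_num at a0 <;> linarith
  rw [f0, f1, f2] at hA
  refine isReducible_of_congr (U := !![1, ε, -ε; 0, 1, 0; 0, 0, 1]) (by simp [det_fin_three]) ?_
  convert isReducible_one using 1
  rw [hA]
  ext i j
  rcases hε with rfl | rfl <;>
  fin_cases i <;> fin_cases j <;> simp [mul_apply, Fin.sum_univ_three] <;> norm_num

-- From `m² c₀ = 4 - t²` with `m ≠ 0` one gets `c₀ ≤ 4`. For `c₀ > 1` also `m² = 1`, which fixes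
-- `t²`; then `X, Y, Z` are integers with `XY + YZ + ZX = t² c₀`, and each of the three products is
-- at least `Z²`. This leaves few plane forms. The equation `B c = (1, 0, 0)` then determines the
-- residues of the axis modulo `c₀`.
set_option maxHeartbeats 800000 in
theorem AxialPair.isReducible_of_planar_reduced {A : Matrix (Fin 3) (Fin 3) ℝ}
    {B : Matrix (Fin 3) (Fin 3) ℤ} {c : Fin 3 → ℤ} (h : AxialPair A B c) (h0 : A 1 2 ≤ 0)
    (h1 : 0 ≤ A 1 1 + 2 * A 1 2) (h2 : 0 ≤ A 2 2 + 2 * A 1 2) : IsReducible A := by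
  obtain ⟨m, t, hm, hκ, hc0, ep, eq, es, ht⟩ := h.planar_relations
  have ha : 0 < A 1 1 := h.posDef.diag_pos
  have hb : 0 < A 2 2 := h.posDef.diag_pos
  have bc : ∀ i, B i 0 * c 0 + B i 1 * c 1 + B i 2 * c 2 = ![(1 : ℤ), 0, 0] i := by
    intro i
    rw [← h.mulVec]; simp [Matrix.mulVec, dotProduct, Fin.sum_univ_three]
  have b0 := bc 0; have b1 := bc 1; have b2 := bc 2
  simp at b0 b1 b2
  -- Selling parameters of the plane form, scaled by `t`
  set X := 2 * B 1 1 + (B 1 2 + B 2 1) with hX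
  set Y := 2 * B 2 2 + (B 1 2 + B 2 1) with hY
  set Z := -(B 1 2 + B 2 1) with hZ
  have hXr : (X : ℝ) = (A 1 1 + A 1 2) * t := by rw [hX]; push_cast; linarith
  have hYr : (Y : ℝ) = (A 2 2 + A 1 2) * t := by rw [hY]; push_cast; linarith
  have hZr : (Z : ℝ) = -A 1 2 * t := by rw [hZ]; push_cast; linarith
  have hS : ((X * Y + Y * Z + Z * X : ℤ) : ℝ) = t ^ 2 * c 0 := by
    push_cast; rw [hXr, hYr, hZr, hc0]; ring
  have hZX : Z ^ 2 ≤ Z * X := by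
    have : (Z : ℝ) ^ 2 ≤ Z * X := by
      rw [hXr, hZr]; nlinarith [mul_nonneg (mul_nonneg (neg_nonneg.2 h0) h1) (sq_nonneg t)]
    exact_mod_cast this
  have hZY : Z ^ 2 ≤ Y * Z := by
    have : (Z : ℝ) ^ 2 ≤ Y * Z := by
      rw [hYr, hZr]; nlinarith [mul_nonneg (mul_nonneg (neg_nonneg.2 h0) h2) (sq_nonneg t)]
    exact_mod_cast this
  have hXY : Z ^ 2 ≤ X * Y := by
    have : (Z : ℝ) ^ 2 ≤ X * Y := by
      rw [hYr, hZr, hXr]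
      have : A 1 2 ^ 2 ≤ (A 1 1 + A 1 2) * (A 2 2 + A 1 2) := by nlinarith
      nlinarith [mul_nonneg (sub_nonneg.2 this) (sq_nonneg t)]
    exact_mod_cast this
  have hc0pos : 0 < c 0 := by
    have : (0 : ℝ) < c 0 := by rw [hc0]; nlinarith
    exact_mod_cast this
  have hm1 : 1 ≤ m ^ 2 := by rw [← sq_abs]; nlinarith [Int.one_le_abs hm]
  have hle : m ^ 2 * c 0 ≤ 4 := by
    have : (m : ℝ) ^ 2 * c 0 ≤ 4 := by rw [ht]; nlinarith
    exact_mod_cast this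
  have hc4 : c 0 ≤ 4 := by nlinarith
  have hm2 : 1 < c 0 → m = 1 ∨ m = -1 := by
    intro h3
    have : m ^ 2 ≤ 2 := by nlinarith
    have h4 : m ≤ 1 := by nlinarith
    have h5 : -1 ≤ m := by nlinarith
    omega
  obtain h3 | h3 | h3 | h3 : c 0 = 1 ∨ c 0 = 2 ∨ c 0 = 3 ∨ c 0 = 4 := by omega
  · exact h.isReducible_of_axis_one h0 h1 h2 h3 (by rw [← hc0, h3, Int.cast_one])
  · have hmm := hm2 (by omega)
    have hm1 : (m : ℝ) ^ 2 = 1 := by rcases hmm with rfl | rfl <;> norm_num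
    have ht2 : t ^ 2 = 2 := by
      rw [hm1, h3] at ht; push_cast at ht; linarith
    rw [h3] at hκ hS b0 b1 b2
    have hS' : X * Y + Y * Z + Z * X = 4 := by
      rw [ht2] at hS; refine Int.cast_injective (α := ℝ) (hS.trans ?_); norm_num
    -- `B 1 2 - B 2 1 = 2m` is even, hence so are `X, Y, Z`. The halves satisfy `xy + yz + zx = 1`
    -- and `3z² ≤ 1`, so `z = 0`.
    obtain ⟨x, hx⟩ : ∃ x, X = 2 * x := ⟨X / 2, by omega⟩
    obtain ⟨y, hy⟩ : ∃ y, Y = 2 * y := ⟨Y / 2, by omega⟩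
    obtain ⟨z, hz⟩ : ∃ z, Z = 2 * z := ⟨Z / 2, by omega⟩
    have hz0 : z = 0 := by
      have : z ^ 2 ≤ 0 := by
        by_contra! hcon
        rw [hx, hy, hz] at hS'
        rw [hx, hz] at hZX
        rw [hy, hz] at hZY
        rw [hx, hy, hz] at hXY
        nlinarith
      exact pow_eq_zero_iff two_ne_zero |>.1 (le_antisymm this (sq_nonneg z))
    rw [hz0, mul_zero] at hz
    rw [hz] at hZr hS'
    have hxy : x * y = 1 := by rw [hx, hy] at hS'; linarith
    have ht0 : t ≠ 0 := by rintro rfl; norm_num at ht2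
    have hA12 : A 1 2 = 0 := by
      have : A 1 2 * t = 0 := by push_cast at hZr; linarith
      exact (mul_eq_zero.1 this).resolve_right ht0
    have hx2 : x ^ 2 = 1 ∧ y ^ 2 = 1 := by
      rcases Int.eq_one_or_neg_one_of_mul_eq_one' hxy with ⟨rfl, rfl⟩ | ⟨rfl, rfl⟩ <;> norm_num
    have sq_eq : ∀ {r : ℝ} {w : ℤ}, 0 < r → 2 * (w : ℝ) = r * t → w ^ 2 = 1 → r = √2 := by
      intro r w hr hw hw2
      have : (w : ℝ) ^ 2 = 1 := by exact_mod_cast hw2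
      refine ((Real.sqrt_eq_iff_mul_self_eq_of_pos hr).2 ?_).symm
      have : r ^ 2 * t ^ 2 = 4 := by rw [← mul_pow, ← hw, mul_pow, this]; norm_num
      rw [ht2] at this; linarith
    have hA11 : A 1 1 = √2 := by
      refine sq_eq ha (w := x) ?_ hx2.1
      rw [hx, hA12, add_zero] at hXr; push_cast at hXr; exact hXr
    have hA22 : A 2 2 = √2 := by
      refine sq_eq hb (w := y) ?_ hx2.2
      rw [hy, hA12, add_zero] at hYr; push_cast at hYr; exact hYr
    have hq : B 1 2 = m ∧ B 2 1 = -m := by omega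
    have hp : B 1 1 = x := by omega
    rw [hq.1, hp] at b1
    have hx1 : x = 1 ∨ x = -1 := by
      rw [← mul_self_eq_one_iff, ← sq]; exact hx2.1
    have hpar : (c 1 + c 2) % 2 = 0 := by
      rcases hmm with rfl | rfl <;> rcases hx1 with rfl | rfl <;> omega
    obtain ⟨k, l, hk, hl⟩ : ∃ k l, c 1 = 2 * k + 1 ∧ c 2 = 2 * l + 1 := by
      refine ⟨c 1 / 2, c 2 / 2, ?_⟩
      by_contra hcon
      obtain ⟨k, hk⟩ : ∃ k, c 1 = 2 * k := ⟨c 1 / 2, by omega⟩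
      obtain ⟨l, hl⟩ : ∃ l, c 2 = 2 * l := ⟨c 2 / 2, by omega⟩
      rw [hk, hl] at b0
      have : 2 * (B 0 0 + B 0 1 * k + B 0 2 * l) = 1 := by linarith
      omega
    exact h.isReducible_of_axis_two hA12 hA11 hA22 h3 hk hl
  · have hmm := hm2 (by omega)
    have hm1 : (m : ℝ) ^ 2 = 1 := by rcases hmm with rfl | rfl <;> norm_num
    have ht2 : t ^ 2 = 1 := by
      rw [hm1, h3] at ht; push_cast at ht; linarith
    rw [h3] at hκ hS b0 b1 b2
    have hS' : X * Y + Y * Z + Z * X = 3 := by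
      rw [ht2] at hS; refine Int.cast_injective (α := ℝ) (hS.trans ?_); norm_num
    -- `3Z² ≤ 3`, and `Z` is odd because `B 1 2 - B 2 1 = 3m` is odd.
    have hZ1 : Z = 1 ∨ Z = -1 := by
      have h4 : Z ≤ 1 := by nlinarith
      have h5 : -1 ≤ Z := by nlinarith
      rcases hmm with rfl | rfl <;> omega
    have hZs : Z ^ 2 = 1 := by rcases hZ1 with h4 | h4 <;> rw [h4] <;> norm_num
    have hX1 : X = Z ∧ Y = Z := by
      rcases hZ1 with h4 | h4 <;> rw [h4] at hZX hZY hS' hXY ⊢ <;> constructor <;> nlinarith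
    have hZt : (Z : ℝ) * t = 1 := by
      have h5 : (Z : ℝ) ^ 2 = 1 := by exact_mod_cast hZs
      have h6 : 0 ≤ (Z : ℝ) * t := by rw [hZr]; nlinarith
      have h7 : ((Z : ℝ) * t) ^ 2 = 1 := by rw [mul_pow, h5, ht2, one_mul]
      nlinarith
    have hA12 : A 1 2 = -1 := by
      rw [hZr, mul_assoc, ← sq, ht2] at hZt; linarith
    have hA11 : A 1 1 = 2 := by
      have : (A 1 1 + A 1 2) * t * t = 1 := by rw [← hXr, hX1.1, hZt]
      rw [mul_assoc, ← sq, ht2] at this; linarith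
    have hA22 : A 2 2 = 2 := by
      have : (A 2 2 + A 1 2) * t * t = 1 := by rw [← hYr, hX1.2, hZt]
      rw [mul_assoc, ← sq, ht2] at this; linarith
    have hp : B 1 1 = Z := by omega
    have hq : 2 * B 1 2 = 3 * m - Z := by omega
    have hb1 : 2 * (B 1 0 * 3) + 2 * Z * c 1 + (3 * m - Z) * c 2 = 0 := by
      rw [← hq, ← hp]; linarith
    have hpar : (c 1 + c 2) % 3 = 0 := by
      rcases hmm with rfl | rfl <;> rcases hZ1 with h4 | h4 <;> rw [h4] at hb1 <;> omega
    obtain ⟨ε, k, l, hε, hk, hl⟩ : ∃ ε k l : ℤ, (ε = 1 ∨ ε = -1) ∧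
        c 1 = 3 * k + ε ∧ c 2 = 3 * l - ε := by
      obtain h5 | h5 | h5 : c 1 % 3 = 0 ∨ c 1 % 3 = 1 ∨ c 1 % 3 = 2 := by omega
      · exfalso
        obtain ⟨k, hk⟩ : ∃ k, c 1 = 3 * k := ⟨c 1 / 3, by omega⟩
        obtain ⟨l, hl⟩ : ∃ l, c 2 = 3 * l := ⟨c 2 / 3, by omega⟩
        rw [hk, hl] at b0
        have : 3 * (B 0 0 + B 0 1 * k + B 0 2 * l) = 1 := by linarith
        omega
      · exact ⟨1, c 1 / 3, c 2 / 3 + 1, by omega, by omega, by omega⟩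
      · exact ⟨-1, c 1 / 3 + 1, c 2 / 3, by omega, by omega, by omega⟩
    exact h.isReducible_of_axis_three hA12 hA11 hA22 h3 hε hk hl
  · exfalso
    have hmm := hm2 (by omega)
    have hm1 : (m : ℝ) ^ 2 = 1 := by rcases hmm with rfl | rfl <;> norm_num
    have ht0 : t = 0 := by
      rw [hm1, h3] at ht; push_cast at ht; nlinarith
    rw [ht0, mul_zero] at ep eq es
    rw [h3] at hκ
    have p0 : B 1 1 = 0 := by exact_mod_cast (by linarith : (B 1 1 : ℝ) = 0)
    have s0 : B 2 2 = 0 := by exact_mod_cast (by linarith : (B 2 2 : ℝ) = 0)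
    have q0 : B 1 2 + B 2 1 = 0 := by exact_mod_cast eq
    have q1 : B 1 2 = 2 * m := by linarith
    have q2 : B 2 1 = -(2 * m) := by linarith
    rw [h3] at b0 b1 b2
    rw [p0, q1] at b1
    rw [s0, q2] at b2
    -- The last two rows of `B c` force `c 1` and `c 2` to be even. Then the first row is even too,
    -- but it equals 1.
    have c1 : ∃ k, c 1 = 2 * k := ⟨c 1 / 2, by rcases hmm with rfl | rfl <;> omega⟩
    have c2 : ∃ k, c 2 = 2 * k := ⟨c 2 / 2, by rcases hmm with rfl | rfl <;> omega⟩
    obtain ⟨k, hk⟩ := c1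
    obtain ⟨l, hl⟩ := c2
    rw [hk, hl] at b0
    have : 2 * (B 0 0 * 2 + B 0 1 * k + B 0 2 * l) = 1 := by linarith
    omega

/-- Every isodual ternary form is equivalent to one of the forms of the hyperbolic family or to
a decomposable form. -/
theorem IsoPair.isReducible {A : Matrix (Fin 3) (Fin 3) ℝ} {B : Matrix (Fin 3) (Fin 3) ℤ}
    (h : IsoPair A B) : IsReducible A := by
  by_cases hB : Bᵀ = B
  · exact isReducible_of_symm h hB
  · obtain ⟨U, hU, B', c, h1⟩ := exists_axialPair h hB
    obtain ⟨V, hV, A'', B'', c'', hA'', h2, i0, i1, i2⟩ := h1.exists_planar_reduced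
    refine isReducible_of_congr hU (isReducible_of_congr hV ?_)
    rw [← hA'']
    exact h2.isReducible_of_planar_reduced i0 i1 i2

/-! ### The normal forms are isodual, and every isodual lattice has one -/

theorem posDef_conormGram {p : Fin 6 → ℝ} (hp : ∀ e, 0 ≤ p e) (hdet : (conormGram p).det ≠ 0) :
    (conormGram p).PosDef := by
  refine PosSemidef.posDef_iff_isUnit (𝕜 := ℝ) ?_ |>.2
    ((isUnit_iff_isUnit_det _).2 hdet.isUnit)
  have h : conormGram p = ∑ e, p e • vecMulVec (fun a => (edgeVec e a : ℝ))
      (star fun a => (edgeVec e a : ℝ)) := by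
    ext a b
    simp [conormGram, Matrix.sum_apply, vecMulVec_apply, mul_assoc]
  rw [h]
  exact posSemidef_sum _ fun e _ => (posSemidef_vecMulVec_self_star _).smul (hp e)

theorem isoPair_of_mul_eq_one {A C : Matrix (Fin 3) (Fin 3) ℝ} {B : Matrix (Fin 3) (Fin 3) ℤ}
    (hA : A.PosDef) (hdet : A.det = 1) (hB : IsUnit B.det) (hC : A * C = 1)
    (h : (castM B)ᵀ * C * castM B = A) : IsoPair A B :=
  ⟨hA, hdet, hB, by rw [inv_eq_right_inv hC, h]⟩

theorem IsoPair.isIsodualGram {A : Matrix (Fin 3) (Fin 3) ℝ} {B : Matrix (Fin 3) (Fin 3) ℤ}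
    (h : IsoPair A B) : IsIsodualGram A :=
  ⟨h.det_eq, B, h.unit, h.rel⟩

theorem det_hyperbolic (a b c : ℝ) : (conormGram (hyperbolicConorms a b c)).det =
    (a ^ 2 + 2 * a * b + 2 * a * c + 2 * b * c) ^ 3 := by
  rw [conormGram_eq]
  simp [hyperbolicConorms, det_fin_three]
  ring

theorem hyperbolicConorms_nonneg {a b c : ℝ} (ha : 0 ≤ a) (hb : 0 ≤ b) (hc : 0 ≤ c) (e : Fin 6) :
    0 ≤ hyperbolicConorms a b c e := by
  fin_cases e <;> simp [hyperbolicConorms] <;> positivity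

theorem decomposableConorms_nonneg {α β γ : ℝ} (hα : 0 ≤ α) (hβ : 0 ≤ β) (hγ : 0 ≤ γ)
    (e : Fin 6) : 0 ≤ decomposableConorms α β γ e := by
  fin_cases e <;> simp [decomposableConorms, hα, hβ, hγ]

theorem isoPair_hyperbolic {a b c : ℝ} (ha : 0 ≤ a) (hb : 0 ≤ b) (hc : 0 ≤ c)
    (h : a ^ 2 + 2 * a * b + 2 * a * c + 2 * b * c = 1) :
    ∃ B, IsoPair (conormGram (hyperbolicConorms a b c)) B := by
  have hdet : (conormGram (hyperbolicConorms a b c)).det = 1 := by rw [det_hyperbolic, h, one_pow]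
  have hpd := posDef_conormGram (hyperbolicConorms_nonneg ha hb hc) (by rw [hdet]; norm_num)
  -- in the basis of `hyperbolicGram` the isoduality is `diag(1, -1, -1)`
  set V : Matrix (Fin 3) (Fin 3) ℤ := !![-1, 0, 0; 0, 0, 1; -1, -1, 0] with hV
  have hVd : IsUnit V.det := by decide
  have hH : (castM V)ᵀ * conormGram (hyperbolicConorms a b c) * castM V =
      hyperbolicGram (a + b + c) b c := by
    rw [conormGram_eq]
    ext i j
    fin_cases i <;> fin_cases j <;>
      simp [hV, hyperbolicGram, hyperbolicConorms, mul_apply, Fin.sum_univ_three]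
    all_goals linarith
  have h1 : IsoPair (hyperbolicGram (a + b + c) b c) !![1, 0, 0; 0, -1, 0; 0, 0, -1] := by
    refine isoPair_of_mul_eq_one (C := !![1, 0, 0; 0, -1, 0; 0, 0, -1] *
      hyperbolicGram (a + b + c) b c * !![1, 0, 0; 0, -1, 0; 0, 0, -1])
      (hH ▸ posDef_congr hpd hVd) (by rw [← hH, det_congr_unimodular hVd, hdet]) (by decide) ?_ ?_
    · ext i j
      fin_cases i <;> fin_cases j <;> simp [hyperbolicGram, mul_apply, Fin.sum_univ_three] 
      · linear_combination (4 * (a + b + c) ^ 2) * h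
      · linear_combination (-4 * (a + b + c) * b) * h
      · linear_combination (-4 * (a + b + c) * c) * h
      · linear_combination (4 * (a + b + c) * b) * h
      · linear_combination (-4 * b ^ 2) * h
      · linear_combination (-4 * b * c) * h
      · linear_combination (4 * (a + b + c) * c) * h
      · linear_combination (-4 * b * c) * h
      · linear_combination (-4 * c ^ 2) * h
    · ext i j
      fin_cases i <;> fin_cases j <;> simp [hyperbolicGram, mul_apply, Fin.sum_univ_three]
  have hVi := mul_nonsing_inv _ hVd
  have h2 := h1.congr (U := V⁻¹) (isUnit_nonsing_inv_det _ hVd)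
  rw [← hH] at h2
  have h3 : castM V * castM V⁻¹ = 1 := by rw [← castM_mul, hVi, castM_one]
  have h4 : (castM V⁻¹)ᵀ * (castM V)ᵀ = 1 := by rw [← transpose_mul, h3, transpose_one]
  refine ⟨(V⁻¹)ᵀ * !![1, 0, 0; 0, -1, 0; 0, 0, -1] * V⁻¹, ?_⟩
  convert h2 using 1
  simp only [← mul_assoc]
  rw [h4, one_mul, mul_assoc, h3, mul_one]

theorem det_decomposable (α β γ : ℝ) : (conormGram (decomposableConorms α β γ)).det =
    α * β + β * γ + γ * α := by
  rw [conormGram_eq]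
  simp [decomposableConorms, det_fin_three]
  ring

/-- A plane lattice of determinant 1 is mapped to its dual by a quarter turn, and `ℤ` is its own
dual. -/
theorem isoPair_decomposable {α β γ : ℝ} (hα : 0 ≤ α) (hβ : 0 ≤ β) (hγ : 0 ≤ γ)
    (h : α * β + β * γ + γ * α = 1) :
    ∃ B, IsoPair (conormGram (decomposableConorms α β γ)) B := by
  have hdet : (conormGram (decomposableConorms α β γ)).det = 1 := by rw [det_decomposable, h]
  refine ⟨!![0, 1, 0; -1, 0, 0; 0, 0, 1], isoPair_of_mul_eq_one
    (C := !![β + γ, γ, 0; γ, α + γ, 0; 0, 0, 1])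
    (posDef_conormGram (decomposableConorms_nonneg hα hβ hγ) (by rw [hdet]; norm_num)) hdet
    (by decide) ?_ ?_⟩
  · rw [conormGram_eq]
    ext i j
    fin_cases i <;> fin_cases j <;> simp [decomposableConorms, mul_apply, Fin.sum_univ_three]
    all_goals linarith
  · rw [conormGram_eq]
    ext i j
    fin_cases i <;> fin_cases j <;> simp [decomposableConorms, mul_apply, Fin.sum_univ_three]

theorem exists_basis_congr (b : Basis (Fin 3) ℝ (EuclideanSpace ℝ (Fin 3)))
    {U : Matrix (Fin 3) (Fin 3) ℤ} (hU : IsUnit U.det) :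
    ∃ b' : Basis (Fin 3) ℝ (EuclideanSpace ℝ (Fin 3)),
      Submodule.span ℤ (Set.range b') = Submodule.span ℤ (Set.range b) ∧
      gram ℝ b' = (castM U)ᵀ * gram ℝ b * castM U := by
  have hg := gram_basis_expand b (castM U)
  have hb := posDef_gram_of_linearIndependent (𝕜 := ℝ) b.linearIndependent
  obtain ⟨b', hb'⟩ := exists_basis_of_det_gram_ne_zero
    (v := fun i => ∑ k, castM U k i • b k) (by rw [hg]; exact (posDef_congr hb hU).det_pos.ne')
  refine ⟨b', ?_, by rw [hb', hg]⟩
  have hsub : ∀ (W : Matrix (Fin 3) (Fin 3) ℤ) (v : Fin 3 → EuclideanSpace ℝ (Fin 3)),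
      Submodule.span ℤ (Set.range fun i => ∑ k, castM W k i • v k) ≤
        Submodule.span ℤ (Set.range v) := by
    intro W v
    rw [Submodule.span_le]
    rintro _ ⟨i, rfl⟩
    refine (mem_span_int_range _ _).2 ⟨fun k => W k i, ?_⟩
    simp [← Int.cast_smul_eq_zsmul ℝ]
  refine le_antisymm (hb' ▸ hsub U b) ?_
  convert hsub U⁻¹ b' using 3
  ext1 i
  rw [hb']
  have h3 : castM U * castM U⁻¹ = 1 := by rw [← castM_mul, mul_nonsing_inv _ hU, castM_one]
  calc b i = ∑ l, (castM U * castM U⁻¹) l i • b l := by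
        rw [h3]; simp [Matrix.one_apply]
    _ = _ := by
        simp_rw [mul_apply, Finset.sum_smul, Finset.smul_sum, smul_smul]
        rw [Finset.sum_comm]
        simp_rw [mul_comm]

/-- Every three-dimensional isodual lattice has a reduced basis. -/
theorem exists_reduced_basis {L : Submodule ℤ (EuclideanSpace ℝ (Fin 3))}
    (h : IsUnitIsodualLattice L) :
    ∃ b : Basis (Fin 3) ℝ (EuclideanSpace ℝ (Fin 3)), Submodule.span ℤ (Set.range b) = L ∧
      IsReducedGram (gram ℝ b) := by
  obtain ⟨b, rfl⟩ := exists_basis_span_eq h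
  obtain ⟨hdet, B, hB, hrel⟩ := isIsodualGram_of_isUnitIsodualLattice (by norm_num) b h
  obtain ⟨U, hU, hr⟩ := IsoPair.isReducible
    ⟨posDef_gram_of_linearIndependent b.linearIndependent, hdet, hB, hrel⟩
  obtain ⟨b', hspan, hg⟩ := exists_basis_congr b hU
  exact ⟨b', hspan, hg ▸ hr⟩

/-! ### The moment on the hyperbolic family -/

/-- Thirty-six times the second moment of the lattice with parameters `a, b, c`. -/
def hyperbolicMoment (a b c : ℝ) : ℝ := conormMoment (hyperbolicConorms a b c)

theorem secondMoment_hyperbolic {a b c : ℝ} (ha : 0 ≤ a) (hb : 0 ≤ b) (hc : 0 ≤ c)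
    (h : a ^ 2 + 2 * a * b + 2 * a * c + 2 * b * c = 1)
    (v : Basis (Fin 3) ℝ (EuclideanSpace ℝ (Fin 3)))
    (hv : gram ℝ v = conormGram (hyperbolicConorms a b c)) :
    secondMoment (Submodule.span ℤ (Set.range v)) = hyperbolicMoment a b c / 36 :=
  secondMoment_eq_of_gram (hyperbolicConorms_nonneg ha hb hc) v hv
    (by rw [det_hyperbolic, h, one_pow])

theorem secondMoment_decomposable {α β γ : ℝ} (hα : 0 ≤ α) (hβ : 0 ≤ β) (hγ : 0 ≤ γ)
    (h : α * β + β * γ + γ * α = 1)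
    (v : Basis (Fin 3) ℝ (EuclideanSpace ℝ (Fin 3)))
    (hv : gram ℝ v = conormGram (decomposableConorms α β γ)) :
    secondMoment (Submodule.span ℤ (Set.range v)) = (1 + (α + β + γ) + α * β * γ) / 36 := by
  rw [secondMoment_eq_of_gram (decomposableConorms_nonneg hα hβ hγ) v hv
    (by rw [det_decomposable, h])]
  simp [conormMoment, decomposableConorms]
  ring

section HyperbolicPolynomials

variable {K : Type*} [CommRing K]

/-- The constraint, the quadratic part and the degree eight part of the moment of the lattice with
parameters `a, b, c` are polynomials in `a`, `s = b + c` and `m = b c`. -/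
def hypQ (a s m : K) : K := a ^ 2 + 2 * a * s + 2 * m

/-- Sum of the conorms. -/
def hypS (a s m : K) : K := 3 * a ^ 2 + 4 * a * s + 2 * s ^ 2 - 2 * m

/-- Part of degree eight of the moment. -/
def hypR (a s m : K) : K :=
  2 * a ^ 7 * s + 6 * a ^ 6 * s ^ 2 + 16 * a ^ 6 * m + 4 * a ^ 5 * s ^ 3 + 60 * a ^ 5 * s * m +
    60 * a ^ 4 * s ^ 2 * m + 56 * a ^ 4 * m ^ 2 + 16 * a ^ 3 * s ^ 3 * m + 88 * a ^ 3 * s * m ^ 2 +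
    32 * a ^ 2 * s ^ 2 * m ^ 2 + 32 * a ^ 2 * m ^ 3 + 16 * a * s * m ^ 3

end HyperbolicPolynomials

theorem hyperbolicMoment_eq (a b c : ℝ) :
    hyperbolicMoment a b c = hypS a (b + c) (b * c) + hypR a (b + c) (b * c) := by
  simp [hyperbolicMoment, conormMoment, hyperbolicConorms, hypS, hypR]
  ring

theorem hypQ_eq (a b c : ℝ) :
    hypQ a (b + c) (b * c) = a ^ 2 + 2 * a * b + 2 * a * c + 2 * b * c := by
  rw [hypQ]; ring

/-- The parts `hypS` and `hypR` have degrees 2 and 8 in the parameters. Dividing the parameters by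
`√Q` therefore gives the moment `(S Q³ + R) / Q⁴`, which can be varied without a constraint. -/
theorem hyperbolicMoment_normalize {a b c : ℝ} (h : 0 < hypQ a (b + c) (b * c)) :
    hyperbolicMoment (a / √(hypQ a (b + c) (b * c))) (b / √(hypQ a (b + c) (b * c)))
      (c / √(hypQ a (b + c) (b * c))) * hypQ a (b + c) (b * c) ^ 4 =
    hypS a (b + c) (b * c) * hypQ a (b + c) (b * c) ^ 3 + hypR a (b + c) (b * c) := by
  set q := hypQ a (b + c) (b * c)
  have h1 : (√q)⁻¹ ^ 2 * q = 1 := by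
    rw [inv_pow, Real.sq_sqrt h.le, inv_mul_cancel₀ h.ne']
  set r := (√q)⁻¹
  have h2 : hyperbolicMoment (a / √q) (b / √q) (c / √q) =
      r ^ 2 * hypS a (b + c) (b * c) + (r ^ 2) ^ 4 * hypR a (b + c) (b * c) := by
    simp only [hyperbolicMoment_eq, div_eq_mul_inv, hypS, hypR, r]
    ring
  rw [h2, add_mul, mul_assoc, mul_comm _ (q ^ 4), mul_right_comm ((r ^ 2) ^ 4), ← mul_pow, h1]
  linear_combination (hypS a (b + c) (b * c) * q ^ 3) * h1

theorem continuous_conormGram : Continuous conormGram := by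
  refine continuous_matrix fun i j => ?_
  simp only [conormGram, of_apply]
  fun_prop

theorem tendsto_conormGram_hyperbolic {ι : Type*} {l : Filter ι} {a b c : ℝ} {x y z : ι → ℝ}
    (hx : Tendsto x l (𝓝 a)) (hy : Tendsto y l (𝓝 b)) (hz : Tendsto z l (𝓝 c)) :
    Tendsto (fun i => conormGram (hyperbolicConorms (x i) (y i) (z i))) l
      (𝓝 (conormGram (hyperbolicConorms a b c))) := by
  refine (continuous_conormGram.tendsto _).comp (tendsto_pi_nhds.2 fun e => ?_)
  fin_cases e
  · exact hx.pow 2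
  · exact hx.mul (hx.add (hy.const_mul 2))
  · exact (hy.const_mul 2).mul (hx.add hy)
  · exact (hz.const_mul 2).mul (hx.add hz)
  · exact hx.mul (hx.add (hz.const_mul 2))
  · exact (hy.const_mul 2).mul hz

/-- The filter is arbitrary so that the inequality serves both full neighbourhoods of interior
points and one-sided curves that start on a side of the triangle. -/
theorem le_of_isLocalMinIsodual_hyperbolic {ι : Type*} {l : Filter ι} {a b c : ℝ}
    (v : Basis (Fin 3) ℝ (EuclideanSpace ℝ (Fin 3)))
    (hv : gram ℝ v = conormGram (hyperbolicConorms a b c))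
    (hloc : IsLocalMinIsodual (Submodule.span ℤ (Set.range v)))
    (ha : 0 ≤ a) (hb : 0 ≤ b) (hc : 0 ≤ c) (h : hypQ a (b + c) (b * c) = 1)
    {x y z : ι → ℝ} (hx : Tendsto x l (𝓝 a)) (hy : Tendsto y l (𝓝 b)) (hz : Tendsto z l (𝓝 c))
    (hnn : ∀ᶠ i in l, 0 ≤ x i ∧ 0 ≤ y i ∧ 0 ≤ z i) :
    ∀ᶠ i in l, hyperbolicMoment a b c * hypQ (x i) (y i + z i) (y i * z i) ^ 4 ≤
      hypS (x i) (y i + z i) (y i * z i) * hypQ (x i) (y i + z i) (y i * z i) ^ 3 +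
        hypR (x i) (y i + z i) (y i * z i) := by
  set q : ι → ℝ := fun i => hypQ (x i) (y i + z i) (y i * z i) with hqdef
  have hq : Tendsto q l (𝓝 1) := by
    rw [← h]
    simp only [hqdef, hypQ]
    exact (((hx.pow 2).add ((hx.const_mul 2).mul (hy.add hz))).add ((hy.mul hz).const_mul 2))
  have hqpos : ∀ᶠ i in l, 0 < q i := hq.eventually (lt_mem_nhds one_pos)
  have hsq : Tendsto (fun i => √(q i)) l (𝓝 1) := by
    have := (Real.continuous_sqrt.tendsto 1).comp hq
    rw [Real.sqrt_one] at this
    exact this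
  have hdiv : ∀ {w : ι → ℝ} {d : ℝ}, Tendsto w l (𝓝 d) →
      Tendsto (fun i => w i / √(q i)) l (𝓝 d) := by
    intro w d hw
    have := hw.div hsq one_ne_zero
    rw [div_one] at this
    exact this
  have hA : Tendsto (fun i => conormGram (hyperbolicConorms (x i / √(q i)) (y i / √(q i))
      (z i / √(q i)))) l (𝓝 (gram ℝ v)) := by
    rw [hv]
    exact tendsto_conormGram_hyperbolic (hdiv hx) (hdiv hy) (hdiv hz)
  have hgood : ∀ᶠ i in l, (0 ≤ x i / √(q i) ∧ 0 ≤ y i / √(q i) ∧ 0 ≤ z i / √(q i)) ∧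
      (x i / √(q i)) ^ 2 + 2 * (x i / √(q i)) * (y i / √(q i)) +
        2 * (x i / √(q i)) * (z i / √(q i)) + 2 * (y i / √(q i)) * (z i / √(q i)) = 1 := by
    filter_upwards [hnn, hqpos] with i hi hqi
    refine ⟨⟨?_, ?_, ?_⟩, ?_⟩
    · exact div_nonneg hi.1 (Real.sqrt_nonneg _)
    · exact div_nonneg hi.2.1 (Real.sqrt_nonneg _)
    · exact div_nonneg hi.2.2 (Real.sqrt_nonneg _)
    · have h1 : √(q i) ^ 2 = q i := Real.sq_sqrt hqi.le
      have h2 : q i = x i ^ 2 + 2 * x i * y i + 2 * x i * z i + 2 * y i * z i := hypQ_eq _ _ _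
      have h3 : √(q i) ≠ 0 := (Real.sqrt_pos.2 hqi).ne'
      field_simp
      linarith
  have hev := eventually_secondMoment_le_of_isLocalMinIsodual v hloc hA (by
    filter_upwards [hgood] with i hi
    obtain ⟨B, hB⟩ := isoPair_hyperbolic hi.1.1 hi.1.2.1 hi.1.2.2 hi.2
    exact ⟨transpose_of_posDef hB.posDef, hB.isIsodualGram⟩)
  filter_upwards [hev, hgood, hqpos] with i ⟨w, hw, hle⟩ hi hqi
  rw [secondMoment_hyperbolic ha hb hc (by rw [← hypQ_eq, h]) v hv,
    secondMoment_hyperbolic hi.1.1 hi.1.2.1 hi.1.2.2 hi.2 w hw] at hle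
  have := mul_le_mul_of_nonneg_right hle (pow_nonneg hqi.le 4)
  have h5 : hyperbolicMoment (x i / √(q i)) (y i / √(q i)) (z i / √(q i)) * q i ^ 4 =
    hypS (x i) (y i + z i) (y i * z i) * q i ^ 3 + hypR (x i) (y i + z i) (y i * z i) :=
      hyperbolicMoment_normalize hqi
  rw [← h5]
  linarith

/-- The moment of the lattices of the hyperbolic family has a local minimum at the parameters
`a, b, c`. The nearby parameters are not normalized. -/
def IsHyperbolicMin (a b c : ℝ) : Prop :=
  ∀ᶠ p : ℝ × ℝ × ℝ in 𝓝 (a, b, c),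
    hyperbolicMoment a b c * hypQ p.1 (p.2.1 + p.2.2) (p.2.1 * p.2.2) ^ 4 ≤
      hypS p.1 (p.2.1 + p.2.2) (p.2.1 * p.2.2) * hypQ p.1 (p.2.1 + p.2.2) (p.2.1 * p.2.2) ^ 3 +
        hypR p.1 (p.2.1 + p.2.2) (p.2.1 * p.2.2)

theorem eventually_nonneg {a b c : ℝ} (ha : 0 < a) (hb : 0 < b) (hc : 0 < c) :
    ∀ᶠ p : ℝ × ℝ × ℝ in 𝓝 (a, b, c), 0 ≤ p.1 ∧ 0 ≤ p.2.1 ∧ 0 ≤ p.2.2 := by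
  have h1 : Continuous fun p : ℝ × ℝ × ℝ => p.2.1 := by fun_prop
  have h2 : Continuous fun p : ℝ × ℝ × ℝ => p.2.2 := by fun_prop
  filter_upwards [(continuous_fst.tendsto (a, b, c)).eventually (lt_mem_nhds ha),
    (h1.tendsto (a, b, c)).eventually (lt_mem_nhds hb),
    (h2.tendsto (a, b, c)).eventually (lt_mem_nhds hc)] with p h3 h4 h5
  exact ⟨h3.le, h4.le, h5.le⟩

theorem isHyperbolicMin_of_isLocalMinIsodual {a b c : ℝ}
    (v : Basis (Fin 3) ℝ (EuclideanSpace ℝ (Fin 3)))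
    (hv : gram ℝ v = conormGram (hyperbolicConorms a b c))
    (hloc : IsLocalMinIsodual (Submodule.span ℤ (Set.range v)))
    (ha : 0 < a) (hb : 0 < b) (hc : 0 < c) (h : hypQ a (b + c) (b * c) = 1) :
    IsHyperbolicMin a b c := by
  have h1 : Continuous fun p : ℝ × ℝ × ℝ => p.2.1 := by fun_prop
  have h2 : Continuous fun p : ℝ × ℝ × ℝ => p.2.2 := by fun_prop
  exact le_of_isLocalMinIsodual_hyperbolic v hv hloc ha.le hb.le hc.le h
    (continuous_fst.tendsto (a, b, c)) (h1.tendsto (a, b, c)) (h2.tendsto (a, b, c))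
    (eventually_nonneg ha hb hc)

open Polynomial in
/-- Lagrange condition in the direction `(d₁, d₂, d₃)` at a local minimum. -/
theorem derivative_eq_zero_of_isHyperbolicMin {a b c : ℝ}
    (hmin : IsHyperbolicMin a b c) (h : hypQ a (b + c) (b * c) = 1) (d₁ d₂ d₃ : ℝ) :
    (derivative (hypS (C a + C d₁ * X) (C b + C d₂ * X + (C c + C d₃ * X))
        ((C b + C d₂ * X) * (C c + C d₃ * X)) *
      hypQ (C a + C d₁ * X) (C b + C d₂ * X + (C c + C d₃ * X))
        ((C b + C d₂ * X) * (C c + C d₃ * X)) ^ 3 +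
      hypR (C a + C d₁ * X) (C b + C d₂ * X + (C c + C d₃ * X))
        ((C b + C d₂ * X) * (C c + C d₃ * X)) -
      C (hyperbolicMoment a b c) * hypQ (C a + C d₁ * X) (C b + C d₂ * X + (C c + C d₃ * X))
        ((C b + C d₂ * X) * (C c + C d₃ * X)) ^ 4)).eval 0 = 0 := by
  set ψ : ℝ[X] := _
  change (derivative ψ).eval 0 = 0
  have hlin : Tendsto (fun t : ℝ => (a + d₁ * t, b + d₂ * t, c + d₃ * t)) (𝓝 0)
      (𝓝 (a, b, c)) := by
    have : Continuous fun t : ℝ => (a + d₁ * t, b + d₂ * t, c + d₃ * t) := by fun_prop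
    simpa using this.tendsto 0
  have hev := hlin.eventually hmin
  have heval : ∀ t, ψ.eval t = hypS (a + d₁ * t) (b + d₂ * t + (c + d₃ * t))
        ((b + d₂ * t) * (c + d₃ * t)) *
      hypQ (a + d₁ * t) (b + d₂ * t + (c + d₃ * t)) ((b + d₂ * t) * (c + d₃ * t)) ^ 3 +
      hypR (a + d₁ * t) (b + d₂ * t + (c + d₃ * t)) ((b + d₂ * t) * (c + d₃ * t)) -
      hyperbolicMoment a b c *
        hypQ (a + d₁ * t) (b + d₂ * t + (c + d₃ * t)) ((b + d₂ * t) * (c + d₃ * t)) ^ 4 := by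
    intro t
    simp [ψ, hypS, hypQ, hypR]
  refine IsLocalMin.hasDerivAt_eq_zero (f := fun t => ψ.eval t) ?_ (ψ.hasDerivAt 0)
  filter_upwards [hev] with t ht
  rw [heval, heval]
  have h0 : hyperbolicMoment a b c = hypS a (b + c) (b * c) + hypR a (b + c) (b * c) :=
    hyperbolicMoment_eq a b c
  simp only [mul_zero, add_zero, h]
  rw [h0] at ht ⊢
  linarith

/-! ### Critical points of the hyperbolic family -/

/-- Partial derivative of the moment polynomial in `a`. -/
def hypFa (a s m : ℝ) : ℝ :=
  6 * a + 4 * s + (14 * a ^ 6 * s + 36 * a ^ 5 * s ^ 2 + 96 * a ^ 5 * m + 20 * a ^ 4 * s ^ 3 +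
    300 * a ^ 4 * s * m + 240 * a ^ 3 * s ^ 2 * m + 224 * a ^ 3 * m ^ 2 + 48 * a ^ 2 * s ^ 3 * m +
    264 * a ^ 2 * s * m ^ 2 + 64 * a * s ^ 2 * m ^ 2 + 64 * a * m ^ 3 + 16 * s * m ^ 3)

/-- Partial derivative of the moment polynomial in `s`. -/
def hypFs (a s m : ℝ) : ℝ :=
  4 * a + 4 * s + (2 * a ^ 7 + 12 * a ^ 6 * s + 12 * a ^ 5 * s ^ 2 + 60 * a ^ 5 * m +
    120 * a ^ 4 * s * m + 48 * a ^ 3 * s ^ 2 * m + 88 * a ^ 3 * m ^ 2 +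
    64 * a ^ 2 * s * m ^ 2 + 16 * a * m ^ 3)

/-- Partial derivative of the moment polynomial in `m`. -/
def hypFm (a s m : ℝ) : ℝ :=
  -2 + (16 * a ^ 6 + 60 * a ^ 5 * s +
    60 * a ^ 4 * s ^ 2 + 112 * a ^ 4 * m + 16 * a ^ 3 * s ^ 3 + 176 * a ^ 3 * s * m +
    64 * a ^ 2 * s ^ 2 * m + 96 * a ^ 2 * m ^ 2 + 48 * a * s * m ^ 2)

-- At `Q = 1` the derivative of `S Q³ + R - (S + R) Q⁴`, with the factor `S + R` held constant, is
-- `S' + R' - (S + 4R) Q'`. This gives the multiplier explicitly.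
open Polynomial in
theorem lagrange_of_isHyperbolicMin {a b c : ℝ}
    (hmin : IsHyperbolicMin a b c) (h : hypQ a (b + c) (b * c) = 1) (d₁ d₂ d₃ : ℝ) :
    hypFa a (b + c) (b * c) * d₁ + hypFs a (b + c) (b * c) * (d₂ + d₃) +
      hypFm a (b + c) (b * c) * (c * d₂ + b * d₃) =
    2 * (hypS a (b + c) (b * c) + 4 * hypR a (b + c) (b * c)) *
      ((a + (b + c)) * d₁ + a * (d₂ + d₃) + (c * d₂ + b * d₃)) := by
  have key := derivative_eq_zero_of_isHyperbolicMin hmin h d₁ d₂ d₃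
  rw [hyperbolicMoment_eq] at key
  set A : ℝ[X] := C a + C d₁ * X with hA
  set s : ℝ[X] := C b + C d₂ * X + (C c + C d₃ * X) with hs
  set m : ℝ[X] := (C b + C d₂ * X) * (C c + C d₃ * X) with hm
  have e1 : (hypS A s m).eval 0 = hypS a (b + c) (b * c) := by simp [hypS, A, s, m]
  have e2 : (hypQ A s m).eval 0 = 1 := by rw [← h]; simp [hypQ, A, s, m]
  have A0 : A.eval 0 = a := by simp [A]
  have s0 : s.eval 0 = b + c := by simp [s]
  have m0 : m.eval 0 = b * c := by simp [m]
  have A1 : (derivative A).eval 0 = d₁ := by simp [A]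
  have s1 : (derivative s).eval 0 = d₂ + d₃ := by simp [s]
  have m1 : (derivative m).eval 0 = c * d₂ + b * d₃ := by simp [m]; ring
  clear_value A s m
  have e3 : (derivative (hypQ A s m)).eval 0 = 2 * ((a + (b + c)) * d₁ + a * (d₂ + d₃) +
      (c * d₂ + b * d₃)) := by
    simp [hypQ, derivative_pow, A0, s0, A1, s1, m1]; ring
  have e4 : (derivative (hypS A s m)).eval 0 + (derivative (hypR A s m)).eval 0 =
      hypFa a (b + c) (b * c) * d₁ + hypFs a (b + c) (b * c) * (d₂ + d₃) +
      hypFm a (b + c) (b * c) * (c * d₂ + b * d₃) := by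
    simp [hypS, hypR, derivative_pow, A0, s0, m0, A1, s1, m1, hypFa, hypFs, hypFm]; ring
  simp only [derivative_sub, derivative_add, derivative_mul, derivative_pow, derivative_C,
    eval_sub, eval_add, eval_mul, eval_pow, eval_C, e1, e2, e3] at key
  rw [← e4]
  simp at key
  linear_combination key

/-- The moment has no critical point with `b ≠ c`. -/
theorem false_of_critical_of_ne {a s m : ℝ} (ha : 0 < a) (hs : 0 < s) (hm : 0 < m)
    (h : hypQ a s m = 1)
    (h1 : hypFs a s m = a * hypFm a s m) (h2 : hypFa a s m = (a + s) * hypFm a s m) : False := by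
  obtain rfl : m = (1 - a ^ 2 - 2 * a * s) / 2 := by rw [hypQ] at h; linarith
  -- After elimination of `m` by the constraint, one equation is linear and the other quadratic in
  -- `s`. Eliminating `s` leaves a polynomial in `a` whose only possible root in range is `3a⁴ = 1`.
  have e1 : (4 * a ^ 6 - a ^ 4 - 2 * a ^ 2 + 1) * s + 2 * a * (a ^ 6 - 2 * a ^ 4 - a ^ 2 + 1) = 0 := by
    rw [hypFs, hypFm] at h1
    linear_combination h1 / 4
  have e2 : 2 * a ^ 7 + 7 * a ^ 6 * s + 6 * a ^ 5 * s ^ 2 - 6 * a ^ 5 - 10 * a ^ 4 * s -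
      a ^ 3 * s ^ 2 + a ^ 3 - 3 * a ^ 2 * s - a * s ^ 2 + 2 * a + s = 0 := by
    rw [hypFa, hypFm] at h2
    linear_combination h2 / 8
  have e3 : a ^ 3 * (1 - 3 * a ^ 4) *
      (1 + 2 * a ^ 2 - a ^ 4 - 2 * a ^ 6 + 2 * a ^ 8 + 2 * a ^ 10) = 0 := by
    linear_combination (4 * a ^ 6 - a ^ 4 - 2 * a ^ 2 + 1) ^ 2 * e2 -
      (((4 * a ^ 6 - a ^ 4 - 2 * a ^ 2 + 1) * s - 2 * a * (a ^ 6 - 2 * a ^ 4 - a ^ 2 + 1)) *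
        (6 * a ^ 5 - a ^ 3 - a) + (4 * a ^ 6 - a ^ 4 - 2 * a ^ 2 + 1) *
        (7 * a ^ 6 - 10 * a ^ 4 - 3 * a ^ 2 + 1)) * e1
  have has := mul_pos ha hs
  have ha1 : a ^ 2 < 1 := by nlinarith
  have hpos : 0 < 1 + 2 * a ^ 2 - a ^ 4 - 2 * a ^ 6 + 2 * a ^ 8 + 2 * a ^ 10 := by
    have hx : 0 < a ^ 2 := by positivity
    have : 1 + 2 * a ^ 2 - a ^ 4 - 2 * a ^ 6 + 2 * a ^ 8 + 2 * a ^ 10 =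
        1 - a ^ 2 * a ^ 2 + 2 * a ^ 2 * (1 - a ^ 2 * a ^ 2) + 2 * (a ^ 2) ^ 4 +
          2 * (a ^ 2) ^ 5 := by ring
    rw [this]
    have h3 : 0 < 1 - a ^ 2 * a ^ 2 := by nlinarith
    positivity
  have h3 : 3 * a ^ 4 = 1 := by
    rcases mul_eq_zero.1 e3 with h3 | h3
    · rcases mul_eq_zero.1 h3 with h3 | h3
      · exact absurd h3 (by positivity)
      · linarith
    · exact absurd h3 hpos.ne'
  have h4 : (1 - a ^ 2) * s = a * (2 * a ^ 2 - 1) := by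
    linear_combination (3 / 2 : ℝ) * e1 + ((-2 * a ^ 2 + 1 / 2) * s - a * (a ^ 2 - 2)) * h3
  -- The second factor is `2m`, and `a² < 1`, so neither factor can vanish.
  have h5 : (1 - a ^ 2) * (1 - a ^ 2 - 2 * a * s) = 0 := by
    linear_combination (-2 * a) * h4 - h3
  rcases mul_eq_zero.1 h5 with h6 | h6 <;> linarith

theorem eq_mcc_of_sq_eq {a t : ℝ} (ha : 0 < a) (ht : 0 < t) (h : hypQ a (t + t) (t * t) = 1)
    (h1 : a ^ 2 = 2 * t ^ 2) : a = mccSide ∧ t = mccSide / √2 := by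
  have h2 : √2 ^ 2 = 2 := Real.sq_sqrt (by norm_num)
  have h3 : a = √2 * t := by
    refine (sq_eq_sq₀ ha.le (by positivity)).1 ?_
    rw [mul_pow, h2, h1]
  have h4 : a = mccSide := by
    refine (sq_eq_sq₀ ha.le mccSide_pos.le).1 ?_
    rw [mccSide_sq]
    have h5 : a * t = √2 / 2 * a ^ 2 := by rw [h3]; linear_combination (-√2 / 2 * t ^ 2) * h2
    have h6 : 2 * (1 + √2) * a ^ 2 = 1 := by
      rw [hypQ] at h
      linear_combination h - 4 * h5 + h1
    linear_combination (√2 - 1) / 2 * h6 - a ^ 2 * h2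
  refine ⟨h4, ?_⟩
  rw [← h4, h3]
  field_simp

theorem eq_mcc_of_critical_of_eq {a t : ℝ} (ha : 0 < a) (ht : 0 < t)
    (h : hypQ a (t + t) (t * t) = 1)
    (h1 : (hypFs a (t + t) (t * t) + t * hypFm a (t + t) (t * t)) * (a + 2 * t) =
      hypFa a (t + t) (t * t) * (a + t)) : a = mccSide ∧ t = mccSide / √2 := by
  refine eq_mcc_of_sq_eq ha ht h ?_
  -- Multiplying the terms of degree 2 by `Q³ = 1` makes the equation homogeneous of degree 8. It
  -- then factors, with a cofactor that is positive.
  have h2 : (a ^ 2 - 2 * t ^ 2) * (16 * a ^ 5 * t + 128 * a ^ 4 * t ^ 2 + 288 * a ^ 3 * t ^ 3 +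
      256 * a ^ 2 * t ^ 4 + 64 * a * t ^ 5) = 0 := by
    rw [hypQ] at h
    rw [hypFs, hypFm, hypFa] at h1
    have h3 : (a ^ 2 + 4 * a * t + 2 * t ^ 2) ^ 3 = 1 := by
      rw [show a ^ 2 + 4 * a * t + 2 * t ^ 2 = 1 by linarith]; norm_num
    linear_combination (-2 : ℝ) * h1 + 4 * (a ^ 2 - 2 * t ^ 2) * h3
  have h3 := (mul_eq_zero.1 h2).resolve_right (by positivity)
  linarith

/-- The equations for `b` and `c` differ by `b - c` times `F_m - μ`, where `F_m` is the derivative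
in `m = bc`. So either `b = c`, which gives `M₃`, or the derivatives in `a, s, m` are multiples of
those of the constraint, which is impossible. -/
theorem eq_mcc_of_lagrange {a b c μ : ℝ} (ha : 0 < a) (hb : 0 < b) (hc : 0 < c)
    (h : hypQ a (b + c) (b * c) = 1)
    (key : ∀ d₁ d₂ d₃ : ℝ, hypFa a (b + c) (b * c) * d₁ + hypFs a (b + c) (b * c) * (d₂ + d₃) +
      hypFm a (b + c) (b * c) * (c * d₂ + b * d₃) =
        μ * ((a + (b + c)) * d₁ + a * (d₂ + d₃) + (c * d₂ + b * d₃))) :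
    a = mccSide ∧ b = mccSide / √2 ∧ c = mccSide / √2 := by
  have k1 := key 1 0 0
  have k2 := key 0 1 0
  have k3 := key 0 0 1
  rcases eq_or_ne b c with rfl | hbc
  · have := eq_mcc_of_critical_of_eq ha hb h
      (by linear_combination (a + 2 * b) * k2 - (a + b) * k1)
    exact ⟨this.1, this.2, this.2⟩
  · exfalso
    have hμ : hypFm a (b + c) (b * c) = μ := by
      apply mul_left_cancel₀ (sub_ne_zero.2 hbc)
      linear_combination k3 - k2
    refine false_of_critical_of_ne ha (add_pos hb hc) (mul_pos hb hc) h ?_ ?_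
    · linear_combination k2 - (a + c) * hμ
    · linear_combination k1 - (a + (b + c)) * hμ

/-- The mean-centered cuboidal lattice is the only local minimum in the interior of the
hyperbolic family. -/
theorem IsHyperbolicMin.eq_mcc {a b c : ℝ} (hmin : IsHyperbolicMin a b c)
    (ha : 0 < a) (hb : 0 < b) (hc : 0 < c) (h : hypQ a (b + c) (b * c) = 1) :
    a = mccSide ∧ b = mccSide / √2 ∧ c = mccSide / √2 :=
  eq_mcc_of_lagrange ha hb hc h (lagrange_of_isHyperbolicMin hmin h)

/-! ### Decomposable lattices are not local minima -/

/-- The moment of the decomposable lattices has a local minimum at `α, β, γ`. -/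
def IsDecomposableMin (α β γ : ℝ) : Prop :=
  ∀ᶠ p : ℝ × ℝ × ℝ in 𝓝 (α, β, γ), 0 ≤ p.1 → 0 ≤ p.2.1 → 0 ≤ p.2.2 →
    p.1 * p.2.1 + p.2.1 * p.2.2 + p.2.2 * p.1 = 1 →
    α + β + γ + α * β * γ ≤ p.1 + p.2.1 + p.2.2 + p.1 * p.2.1 * p.2.2

theorem isDecomposableMin_of_isLocalMinIsodual {α β γ : ℝ}
    (v : Basis (Fin 3) ℝ (EuclideanSpace ℝ (Fin 3)))
    (hv : gram ℝ v = conormGram (decomposableConorms α β γ))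
    (hloc : IsLocalMinIsodual (Submodule.span ℤ (Set.range v)))
    (hα : 0 ≤ α) (hβ : 0 ≤ β) (hγ : 0 ≤ γ) (h : α * β + β * γ + γ * α = 1) :
    IsDecomposableMin α β γ := by
  set S : Set (ℝ × ℝ × ℝ) := {p | 0 ≤ p.1 ∧ 0 ≤ p.2.1 ∧ 0 ≤ p.2.2 ∧
    p.1 * p.2.1 + p.2.1 * p.2.2 + p.2.2 * p.1 = 1} with hS
  have hcont : Continuous fun p : ℝ × ℝ × ℝ => decomposableConorms p.1 p.2.1 p.2.2 := by
    refine continuous_pi fun e => ?_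
    fin_cases e <;> simp [decomposableConorms] <;> fun_prop
  have hA : Tendsto (fun p : ℝ × ℝ × ℝ => conormGram (decomposableConorms p.1 p.2.1 p.2.2))
      (𝓝[S] (α, β, γ)) (𝓝 (gram ℝ v)) := by
    rw [hv]
    exact ((continuous_conormGram.comp hcont).tendsto (α, β, γ)).mono_left nhdsWithin_le_nhds
  have hev := eventually_secondMoment_le_of_isLocalMinIsodual v hloc hA (by
    filter_upwards [self_mem_nhdsWithin] with p hp
    obtain ⟨B, hB⟩ := isoPair_decomposable hp.1 hp.2.1 hp.2.2.1 hp.2.2.2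
    exact ⟨transpose_of_posDef hB.posDef, hB.isIsodualGram⟩)
  rw [eventually_nhdsWithin_iff] at hev
  filter_upwards [hev] with p hp h1 h2 h3 h4
  obtain ⟨w, hw, hle⟩ := hp ⟨h1, h2, h3, h4⟩
  rw [secondMoment_decomposable hα hβ hγ h v hv, secondMoment_decomposable h1 h2 h3 h4 w hw] at hle
  linarith

theorem IsDecomposableMin.rotate {α β γ : ℝ} (h : IsDecomposableMin α β γ) :
    IsDecomposableMin β γ α := by
  have hc : Continuous fun p : ℝ × ℝ × ℝ => (p.2.2, p.1, p.2.1) := by fun_prop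
  filter_upwards [(hc.tendsto (β, γ, α)).eventually h] with p hp h1 h2 h3 h4
  have := hp h3 h1 h2 (by linarith)
  linarith

/-- For fixed `γ` the constraint reads `(α + γ)(β + γ) = 1 + γ²`, so one factor can be scaled by `x`
and the other by `x⁻¹`. Up to a constant the moment is then `(1 - γ²)((α + γ)x + (β + γ)x⁻¹)`, with
derivative `(1 - γ²)(α - β)` at `x = 1`. -/
theorem IsDecomposableMin.eq_one_or_eq {α β γ : ℝ} (h : IsDecomposableMin α β γ) (hα : 0 < α)
    (hβ : 0 < β) (hγ : 0 ≤ γ) (h1 : α * β + β * γ + γ * α = 1) : γ = 1 ∨ α = β := by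
  have ht : Tendsto (fun x : ℝ => ((α + γ) * x - γ, (β + γ) * x⁻¹ - γ, γ)) (𝓝 1)
      (𝓝 (α, β, γ)) := by
    have : ContinuousAt (fun x : ℝ => ((α + γ) * x - γ, (β + γ) * x⁻¹ - γ, γ)) 1 := by
      have : ContinuousAt (fun x : ℝ => x⁻¹) 1 := continuousAt_inv₀ one_ne_zero
      fun_prop
    simpa [ContinuousAt] using this
  have hd : HasDerivAt (fun x : ℝ => (1 - γ ^ 2) * ((α + γ) * x + (β + γ) * x⁻¹))
      ((1 - γ ^ 2) * ((α + γ) * 1 + (β + γ) * -((1 : ℝ) ^ 2)⁻¹)) 1 :=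
    ((((hasDerivAt_id (1 : ℝ)).const_mul (α + γ)).add
      ((hasDerivAt_inv one_ne_zero).const_mul (β + γ))).const_mul (1 - γ ^ 2))
  have hmin : IsLocalMin (fun x : ℝ => (1 - γ ^ 2) * ((α + γ) * x + (β + γ) * x⁻¹)) 1 := by
    have hx1 := (continuous_fst.tendsto (α, β, γ)).comp ht
    have hx2 := ((continuous_fst.comp continuous_snd).tendsto (α, β, γ)).comp ht
    filter_upwards [ht.eventually h, hx1.eventually (lt_mem_nhds hα),
      hx2.eventually (lt_mem_nhds hβ), lt_mem_nhds (zero_lt_one' ℝ)] with x h2 h3 h4 h5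
    have h6 : x * x⁻¹ = 1 := mul_inv_cancel₀ h5.ne'
    have := h2 h3.le h4.le hγ (by
      linear_combination (α + γ) * (β + γ) * h6 + h1)
    have e1 : ((α + γ) * x - γ) * ((β + γ) * x⁻¹ - γ) =
        1 + 2 * γ ^ 2 - γ * ((α + γ) * x + (β + γ) * x⁻¹) := by
      linear_combination (α + γ) * (β + γ) * h6 + h1
    rw [e1] at this
    have e2 : α * β = 1 - γ * (α + β) := by linarith
    rw [e2] at this
    rw [inv_one]
    nlinarith
  have h2 := hmin.hasDerivAt_eq_zero hd
  have h3 : (1 - γ) * ((1 + γ) * (α - β)) = 0 := by linear_combination h2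
  rcases mul_eq_zero.1 h3 with h4 | h4
  · left; linarith
  · right
    have := (mul_eq_zero.1 h4).resolve_left (by positivity)
    linarith

theorem not_isDecomposableMin_cubic : ¬ IsDecomposableMin 1 1 0 := by
  intro h
  -- A rhombic deformation of the square lattice. It lowers the moment by `(1 - x)²(x² + 2x - 1) /
  -- (2x)`.
  have ht : Tendsto (fun x : ℝ => (x, x, (1 - x ^ 2) * (2 * x)⁻¹)) (𝓝[<] 1) (𝓝 (1, 1, 0)) := by
    have : ContinuousAt (fun x : ℝ => (x, x, (1 - x ^ 2) * (2 * x)⁻¹)) 1 := by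
      have : ContinuousAt (fun x : ℝ => (2 * x)⁻¹) 1 :=
        (continuousAt_const.mul continuousAt_id).inv₀ (by norm_num)
      fun_prop
    have := this.tendsto
    simp only [one_pow, sub_self, zero_mul] at this
    exact this.mono_left nhdsWithin_le_nhds
  have hlt : ∀ᶠ x in 𝓝[<] (1 : ℝ), x < 1 := self_mem_nhdsWithin
  have hgt : ∀ᶠ x in 𝓝[<] (1 : ℝ), 9 / 10 < x :=
    nhdsWithin_le_nhds (lt_mem_nhds (by norm_num))
  obtain ⟨x, h1, hx, h3⟩ := ((ht.eventually h).and (hlt.and hgt)).exists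
  have h6 : (2 * x) * (2 * x)⁻¹ = 1 := mul_inv_cancel₀ (by linarith)
  have hi : 0 < (2 * x)⁻¹ := inv_pos.2 (by linarith)
  have := h1 (by linarith) (by linarith)
    (mul_nonneg (by nlinarith) hi.le)
    (by linear_combination (1 - x ^ 2) * h6)
  set y := (2 * x)⁻¹
  have h7 : 2 * x ≤ 2 * x ^ 2 + (1 - x ^ 2) / 2 + x ^ 2 * (1 - x ^ 2) / 2 := by
    have h8 := mul_le_mul_of_nonneg_left this (by linarith : 0 ≤ x)
    have h9 : x * ((1 - x ^ 2) * y) = (1 - x ^ 2) / 2 := by linear_combination (1 - x ^ 2) / 2 * h6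
    have h10 : x * (x * x * ((1 - x ^ 2) * y)) = x ^ 2 * ((1 - x ^ 2) / 2) := by
      linear_combination x ^ 2 * h9
    nlinarith
  have h8 : 0 < (1 - x) ^ 2 * (x ^ 2 + 2 * x - 1) := mul_pos (by nlinarith) (by nlinarith)
  nlinarith

theorem IsDecomposableMin.ne_zero {α β γ : ℝ} (h : IsDecomposableMin α β γ) (hα : 0 ≤ α)
    (hβ : 0 ≤ β) (h1 : α * β + β * γ + γ * α = 1) : γ ≠ 0 := by
  rintro rfl
  have hαβ : α * β = 1 := by linarith
  have hα' : 0 < α := hα.lt_of_ne (by rintro rfl; simp at hαβ)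
  have hβ' : 0 < β := hβ.lt_of_ne (by rintro rfl; simp at hαβ)
  rcases h.eq_one_or_eq hα' hβ' le_rfl h1 with h2 | rfl
  · norm_num at h2
  · obtain rfl : α = 1 := by nlinarith
    exact not_isDecomposableMin_cubic h

theorem IsDecomposableMin.eq_hexagonal {α β γ : ℝ} (h : IsDecomposableMin α β γ) (hα : 0 ≤ α)
    (hβ : 0 ≤ β) (hγ : 0 ≤ γ) (h1 : α * β + β * γ + γ * α = 1) : α = γ ∧ β = γ ∧ 3 * γ ^ 2 = 1 := by
  have hα' : 0 < α := hα.lt_of_ne' (h.rotate.ne_zero hβ hγ (by linarith))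
  have hβ' : 0 < β := hβ.lt_of_ne' (h.rotate.rotate.ne_zero hγ hα (by linarith))
  have hγ' : 0 < γ := hγ.lt_of_ne' (h.ne_zero hα hβ h1)
  have k1 := h.eq_one_or_eq hα' hβ' hγ h1
  have k2 := h.rotate.eq_one_or_eq hβ' hγ' hα (by linarith)
  have k3 := h.rotate.rotate.eq_one_or_eq hγ' hα' hβ (by linarith)
  have key : α = γ ∧ β = γ := by
    rcases k1 with rfl | rfl
    · exfalso
      rcases k2 with rfl | rfl <;> nlinarith
    · rcases k2 with rfl | rfl
      · nlinarith
      · exact ⟨rfl, rfl⟩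
  obtain ⟨rfl, rfl⟩ := key
  exact ⟨rfl, rfl, by linarith⟩

/-- The decomposable lattices with `α = γ` form the side `b = 0` of the triangle, from which they
can be deformed into its interior. -/
theorem congr_decomposable {a c : ℝ} (h : a ^ 2 + 2 * a * c = 1) :
    (castM !![-1, 0, 0; -1, 1, 0; -1, 0, 1])ᵀ *
      conormGram (decomposableConorms (a ^ 2) (2 * c * (a + c)) (a ^ 2)) *
      castM !![-1, 0, 0; -1, 1, 0; -1, 0, 1] = conormGram (hyperbolicConorms a 0 c) := by
  rw [conormGram_eq, conormGram_eq]
  ext i j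
  fin_cases i <;> fin_cases j <;>
    simp [decomposableConorms, hyperbolicConorms, mul_apply, Fin.sum_univ_three] <;> linarith

/-- The product of a hexagonal lattice and `ℤ` is not a local minimum, since it can be deformed to
indecomposable lattices of smaller moment. -/
theorem not_isLocalMinIsodual_hexagonal {γ : ℝ} (hγ : 0 < γ) (h3 : 3 * γ ^ 2 = 1)
    (v : Basis (Fin 3) ℝ (EuclideanSpace ℝ (Fin 3)))
    (hv : gram ℝ v = conormGram (decomposableConorms γ γ γ)) :
    ¬ IsLocalMinIsodual (Submodule.span ℤ (Set.range v)) := by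
  intro hloc
  set r := √3 with hr
  have hr2 : r ^ 2 = 3 := Real.sq_sqrt (by norm_num)
  have hr0 : 0 < r := Real.sqrt_pos.2 (by norm_num)
  have hr1 : 1 < r := by nlinarith
  have hγr : γ * r = 1 := by
    have : (γ * r) ^ 2 = 1 := by rw [mul_pow, hr2]; linarith
    nlinarith [mul_pos hγ hr0]
  set a := √γ with ha
  have ha0 : 0 < a := Real.sqrt_pos.2 hγ
  have ha2 : a ^ 2 = γ := Real.sq_sqrt hγ.le
  -- The hexagonal lattice is the point `(a, 0, ak)` of the side, with `a² = γ = 1/√3`. It is moved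
  -- along `(a(1 - e), ae, ak)`.
  set k := (r - 1) / 2 with hk
  have hk0 : 0 < k := by rw [hk]; linarith
  have hQ : a ^ 2 + 2 * a * (a * k) = 1 := by
    rw [hk]; linear_combination hγr + r * ha2
  have hβ : 2 * (a * k) * (a + a * k) = γ := by
    rw [hk]; linear_combination (r ^ 2 - 1) / 2 * ha2 + γ / 2 * hr2
  obtain ⟨w, hspan, hw⟩ := exists_basis_congr v
    (U := !![-1, 0, 0; -1, 1, 0; -1, 0, 1]) (by decide)
  have hc := congr_decomposable hQ
  rw [hβ, ha2, ← hv, ← hw] at hc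
  rw [← hspan] at hloc
  have hlin : ∀ p d : ℝ, Tendsto (fun t : ℝ => a * (p + d * t)) (𝓝[>] 0) (𝓝 (a * p)) := by
    intro p d
    have : Continuous fun t : ℝ => a * (p + d * t) := by fun_prop
    have := this.tendsto 0
    simp only [mul_zero, add_zero] at this
    exact this.mono_left nhdsWithin_le_nhds
  have hx : Tendsto (fun t : ℝ => a * (1 - t)) (𝓝[>] 0) (𝓝 a) := by
    simpa [← sub_eq_add_neg] using hlin 1 (-1)
  have hy : Tendsto (fun t : ℝ => a * t) (𝓝[>] 0) (𝓝 0) := by simpa using hlin 0 1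
  have hev := le_of_isLocalMinIsodual_hyperbolic w hc hloc ha0.le le_rfl
    (by positivity) (by rw [hypQ_eq]; linear_combination hQ) hx hy
    (tendsto_const_nhds (x := a * k)) (by
      filter_upwards [self_mem_nhdsWithin, nhdsWithin_le_nhds (gt_mem_nhds (zero_lt_one' ℝ))]
        with t h1 h2
      have h1' : 0 < t := h1
      refine ⟨mul_nonneg ha0.le (by linarith), mul_nonneg ha0.le (by linarith), by positivity⟩)
  have hg : Continuous fun e : ℝ => -10 - 6 * r + (16 + 24 * r) * e + (14 - 24 * r) * e ^ 2 -
      40 * e ^ 3 + (52 / 3 + 10 * r) * e ^ 4 - (2 + 10 / 9 * r) * e ^ 6 := by fun_prop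
  have hg0 : -10 - 6 * r + (16 + 24 * r) * 0 + (14 - 24 * r) * 0 ^ 2 -
      40 * 0 ^ 3 + (52 / 3 + 10 * r) * 0 ^ 4 - (2 + 10 / 9 * r) * 0 ^ 6 < 0 := by
    norm_num; linarith
  have hgneg := (hg.tendsto 0).eventually (gt_mem_nhds hg0)
  have hpos : ∀ᶠ e in 𝓝[>] (0 : ℝ), 0 < e := self_mem_nhdsWithin
  obtain ⟨e, h1, he, h4⟩ := (hev.and (hpos.and (nhdsWithin_le_nhds hgneg))).exists
  have hγ3 : γ = r / 3 := by linear_combination (r / 3) * hγr - γ / 3 * hr2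
  have hγ4 : γ ^ 4 = 1 / 9 := by
    rw [show γ ^ 4 = (3 * γ ^ 2) ^ 2 / 9 by ring, h3]; norm_num
  have hp3 : r ^ 3 = 3 * r := by rw [pow_succ, hr2]
  have hp4 : r ^ 4 = 9 := by rw [show r ^ 4 = (r ^ 2) ^ 2 by ring, hr2]; norm_num
  have hp5 : r ^ 5 = 9 * r := by rw [pow_succ, hp4]
  have hS : ∀ s t m : ℝ, hypS (a * s) (a * t) (a ^ 2 * m) = γ * hypS s t m := by
    intro s t m; simp only [hypS]; rw [← ha2]; ring
  have hQ' : ∀ s t m : ℝ, hypQ (a * s) (a * t) (a ^ 2 * m) = γ * hypQ s t m := by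
    intro s t m; simp only [hypQ]; rw [← ha2]; ring
  have hR : ∀ s t m : ℝ, hypR (a * s) (a * t) (a ^ 2 * m) = γ ^ 4 * hypR s t m := by
    intro s t m; simp only [hypR]; rw [← ha2]; ring
  have hf0 : hyperbolicMoment a 0 (a * k) = 1 + 10 / 9 * r := by
    have hS0 := hS 1 k 0
    have hR0 := hR 1 k 0
    rw [mul_one, mul_zero] at hS0 hR0
    rw [hyperbolicMoment_eq, zero_add, zero_mul]
    rw [hS0, hR0, hγ4, hγ3, hk, hypS, hypR]
    ring_nf
    simp only [hr2, hp3]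
    ring
  rw [hf0, show a * e + a * k = a * (e + k) by ring,
    show a * e * (a * k) = a ^ 2 * (e * k) by ring, hS, hQ', hR] at h1
  have hq : hypQ (1 - e) (e + k) (e * k) = r - e ^ 2 := by rw [hypQ, hk]; ring
  rw [hq] at h1
  -- There is no first-order term, and the coefficient `-10 - 6√3` of `e²` is negative.
  have h5 : hypS (1 - e) (e + k) (e * k) * (r - e ^ 2) ^ 3 + hypR (1 - e) (e + k) (e * k) -
      (1 + 10 / 9 * r) * (r - e ^ 2) ^ 4 = e ^ 2 * (-10 - 6 * r + (16 + 24 * r) * e +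
        (14 - 24 * r) * e ^ 2 - 40 * e ^ 3 + (52 / 3 + 10 * r) * e ^ 4 -
          (2 + 10 / 9 * r) * e ^ 6) := by
    rw [hypS, hypR, hk]
    ring_nf
    simp only [hr2, hp3, hp4, hp5]
    ring
  have h6 : 0 ≤ γ ^ 4 * (hypS (1 - e) (e + k) (e * k) * (r - e ^ 2) ^ 3 +
      hypR (1 - e) (e + k) (e * k) - (1 + 10 / 9 * r) * (r - e ^ 2) ^ 4) := by
    linarith
  rw [h5] at h6
  have h7 := mul_neg_of_pos_of_neg (pow_pos hγ 4) (mul_neg_of_pos_of_neg (pow_pos he 2) h4)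
  linarith

/-- No decomposable isodual lattice is a local minimum. -/
theorem not_isLocalMinIsodual_decomposable {α β γ : ℝ} (hα : 0 ≤ α) (hβ : 0 ≤ β) (hγ : 0 ≤ γ)
    (h : α * β + β * γ + γ * α = 1) (v : Basis (Fin 3) ℝ (EuclideanSpace ℝ (Fin 3)))
    (hv : gram ℝ v = conormGram (decomposableConorms α β γ)) :
    ¬ IsLocalMinIsodual (Submodule.span ℤ (Set.range v)) := by
  intro hloc
  obtain ⟨rfl, rfl, h3⟩ := (isDecomposableMin_of_isLocalMinIsodual v hv hloc hα hβ hγ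
    h).eq_hexagonal hα hβ hγ h
  exact not_isLocalMinIsodual_hexagonal (hα.lt_of_ne (by rintro rfl; norm_num at h3)) h3 v hv hloc

/-! ### The global minimum -/

theorem hyperbolicMoment_mcc :
    hyperbolicMoment mccSide (mccSide / √2) (mccSide / √2) = (17 + 4 * √2) / 8 := by
  have h2 : √2 ^ 2 = 2 := Real.sq_sqrt (by norm_num)
  rw [hyperbolicMoment, hyperbolicConorms_mcc, conormMoment]
  simp
  linear_combination (1 / 2 : ℝ) * h2

theorem schur_three {x y z : ℝ} (hx : 0 ≤ x) (hy : 0 ≤ y) (hz : 0 ≤ z) :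
    0 ≤ x * (x - y) * (x - z) + y * (y - x) * (y - z) + z * (z - x) * (z - y) := by
  rcases le_total x y with h1 | h1 <;> rcases le_total y z with h2 | h2 <;>
    rcases le_total x z with h3 | h3 <;>
    nlinarith [mul_nonneg hx (sq_nonneg (y - z)), mul_nonneg hy (sq_nonneg (x - z)),
      mul_nonneg hz (sq_nonneg (x - y)), mul_nonneg (sub_nonneg.2 h1) (sub_nonneg.2 h2),
      mul_nonneg (sub_nonneg.2 h1) (sub_nonneg.2 h3),
      mul_nonneg (sub_nonneg.2 h2) (sub_nonneg.2 h3),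
      mul_nonneg hx (mul_nonneg (sub_nonneg.2 h1) (sub_nonneg.2 h3)),
      mul_nonneg hy (mul_nonneg (sub_nonneg.2 h1) (sub_nonneg.2 h2)),
      mul_nonneg hz (mul_nonneg (sub_nonneg.2 h2) (sub_nonneg.2 h3)),
      mul_nonneg (sub_nonneg.2 h1) (mul_nonneg (sub_nonneg.2 h2) (sub_nonneg.2 h3)),
      mul_nonneg (sub_nonneg.2 h1) (sq_nonneg (y - z)), mul_nonneg (sub_nonneg.2 h2) (sq_nonneg (x - y)),
      mul_nonneg (sub_nonneg.2 h1) (sq_nonneg (x - y))]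

/-- Decomposable lattices have larger moment than the mean-centered cuboidal lattice. -/
theorem mcc_lt_decomposable {α β γ : ℝ} (hα : 0 ≤ α) (hβ : 0 ≤ β) (hγ : 0 ≤ γ)
    (h : α * β + β * γ + γ * α = 1) :
    (17 + 4 * √2) / 8 < 1 + (α + β + γ) + α * β * γ := by
  have h2 : √2 < 1.4143 := by
    rw [Real.sqrt_lt' (by norm_num)]; norm_num
  have hs := schur_three hα hβ hγ
  have h3 : 0 ≤ α * β * γ := by positivity
  set σ := α + β + γ with hσ
  have h4 : 3 ≤ σ ^ 2 := by
    nlinarith [sq_nonneg (α - β), sq_nonneg (β - γ), sq_nonneg (γ - α)]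
  -- Schur's inequality in elementary symmetric functions, with the second one equal to 1.
  have h5 : σ * (4 - σ ^ 2) ≤ 9 * (α * β * γ) := by
    have : 0 ≤ σ ^ 3 - 4 * σ * (α * β + β * γ + γ * α) + 9 * (α * β * γ) := by
      rw [hσ]; linarith
    rw [h] at this; linarith
  have h0 : 0 ≤ σ := by positivity
  have h6 : 1.73 ≤ σ := by nlinarith
  -- The value to beat is below 2.833. For `σ ≥ 1.84` the sum `1 + σ` suffices; otherwise `σ ≥
  -- 1.73`, and the Schur bound for the product adds at least `σ/15`.
  rcases le_total 1.84 σ with h7 | h7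
  · linarith
  · have : 0.6 ≤ 4 - σ ^ 2 := by nlinarith
    nlinarith

theorem hyperbolicMoment_zero_left {b c : ℝ} (h : hypQ 0 (b + c) (b * c) = 1) :
    hyperbolicMoment 0 b c = 1 + (2 * b ^ 2 + 2 * c ^ 2 + 0) + 2 * b ^ 2 * (2 * c ^ 2) * 0 := by
  rw [hyperbolicMoment_eq]
  simp only [hypS, hypR, hypQ] at *
  linear_combination h

theorem hyperbolicMoment_zero_mid {a c : ℝ} (h : hypQ a (0 + c) (0 * c) = 1) :
    hyperbolicMoment a 0 c =
      1 + (a ^ 2 + 2 * c * (a + c) + a ^ 2) + a ^ 2 * (2 * c * (a + c)) * a ^ 2 := by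
  rw [hyperbolicMoment_eq]
  simp only [hypS, hypR, hypQ] at *
  linear_combination (1 + 2 * a ^ 4 * c * (a + c)) * h

theorem hyperbolicMoment_swap (a b c : ℝ) : hyperbolicMoment a c b = hyperbolicMoment a b c := by
  rw [hyperbolicMoment_eq, hyperbolicMoment_eq, add_comm c, mul_comm c]

/-- On the sides of the triangle the lattices are decomposable, with conorms `2b², 2c², 0` or `a²,
2c(a + c), a²`, or the latter with `b` and `c` exchanged. -/
theorem mcc_lt_boundary {a b c : ℝ} (ha : 0 ≤ a) (hb : 0 ≤ b) (hc : 0 ≤ c)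
    (h : hypQ a (b + c) (b * c) = 1) (h0 : a = 0 ∨ b = 0 ∨ c = 0) :
    (17 + 4 * √2) / 8 < hyperbolicMoment a b c := by
  have edge : ∀ c, 0 ≤ c → hypQ a (0 + c) (0 * c) = 1 →
      (17 + 4 * √2) / 8 < hyperbolicMoment a 0 c := by
    intro c hc h
    rw [hyperbolicMoment_zero_mid h]
    rw [hypQ] at h
    exact mcc_lt_decomposable (by positivity) (by positivity) (by positivity)
      (by linear_combination (1 + a ^ 2 + 2 * a * c) * h)
  rcases h0 with rfl | rfl | rfl
  · rw [hyperbolicMoment_zero_left h]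
    rw [hypQ] at h
    exact mcc_lt_decomposable (by positivity) (by positivity) le_rfl
      (by linear_combination (2 * b * c + 1) * h)
  · exact edge c hc h
  · rw [← hyperbolicMoment_swap]
    exact edge b hb (by rwa [add_comm, mul_comm])

/-- A global minimum among normalized parameters is a local minimum. -/
theorem isHyperbolicMin_of_forall_le {a b c : ℝ} (ha : 0 < a) (hb : 0 < b) (hc : 0 < c)
    (hmin : ∀ x y z : ℝ, 0 ≤ x → 0 ≤ y → 0 ≤ z → hypQ x (y + z) (y * z) = 1 →
      hyperbolicMoment a b c ≤ hyperbolicMoment x y z)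
    (h : hypQ a (b + c) (b * c) = 1) : IsHyperbolicMin a b c := by
  have hcont : Continuous fun p : ℝ × ℝ × ℝ => hypQ p.1 (p.2.1 + p.2.2) (p.2.1 * p.2.2) := by
    simp only [hypQ]; fun_prop
  filter_upwards [eventually_nonneg ha hb hc, (hcont.tendsto (a, b, c)).eventually
    (lt_mem_nhds (by rw [h]; exact one_pos))] with p h1 h2
  rw [← hyperbolicMoment_normalize h2]
  refine mul_le_mul_of_nonneg_right (hmin _ _ _ (div_nonneg h1.1 (Real.sqrt_nonneg _))
    (div_nonneg h1.2.1 (Real.sqrt_nonneg _)) (div_nonneg h1.2.2 (Real.sqrt_nonneg _)) ?_)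
    (pow_nonneg h2.le 4)
  set q := hypQ p.1 (p.2.1 + p.2.2) (p.2.1 * p.2.2) with hq
  have h3 : √q ^ 2 = q := Real.sq_sqrt h2.le
  have h4 : √q ≠ 0 := (Real.sqrt_pos.2 h2).ne'
  rw [hypQ] at hq ⊢
  field_simp
  linarith

theorem sq_le_hyperbolicMoment {x y z : ℝ} (hx : 0 ≤ x) (hy : 0 ≤ y) (hz : 0 ≤ z) :
    3 * x ^ 2 + 2 * y ^ 2 + 2 * z ^ 2 ≤ hyperbolicMoment x y z := by
  rw [hyperbolicMoment_eq]
  have : 0 ≤ hypR x (y + z) (y * z) := by rw [hypR]; positivity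
  rw [hypS]
  have h3 : 0 ≤ x * (y + z) := by positivity
  have h4 : 0 ≤ y * z := by positivity
  linear_combination this + 4 * h3 + 2 * h4

/-- A coercive function attains its minimum on a closed part of the octant. -/
theorem exists_min_octant {q f : ℝ × ℝ × ℝ → ℝ} (hq : Continuous q) (hf : Continuous f)
    (hle : ∀ x y z, 0 ≤ x → 0 ≤ y → 0 ≤ z → x ^ 2 + y ^ 2 + z ^ 2 ≤ f (x, y, z))
    {a b c : ℝ} (ha : 0 ≤ a) (hb : 0 ≤ b) (hc : 0 ≤ c) (h : q (a, b, c) = 1) :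
    ∃ x y z, 0 ≤ x ∧ 0 ≤ y ∧ 0 ≤ z ∧ q (x, y, z) = 1 ∧
      ∀ x' y' z', 0 ≤ x' → 0 ≤ y' → 0 ≤ z' → q (x', y', z') = 1 →
        f (x, y, z) ≤ f (x', y', z') := by
  set S : Set (ℝ × ℝ × ℝ) := {p | 0 ≤ p.1 ∧ 0 ≤ p.2.1 ∧ 0 ≤ p.2.2 ∧ q p = 1 ∧
    f p ≤ f (a, b, c)} with hS
  have hclosed : IsClosed S := by
    have e1 : Continuous fun p : ℝ × ℝ × ℝ => p.2.1 := by fun_prop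
    have e2 : Continuous fun p : ℝ × ℝ × ℝ => p.2.2 := by fun_prop
    simp only [hS, Set.ofPred_and]
    exact (isClosed_le continuous_const continuous_fst).inter
      ((isClosed_le continuous_const e1).inter ((isClosed_le continuous_const e2).inter
        ((isClosed_eq hq continuous_const).inter (isClosed_le hf continuous_const))))
  have hbdd : S ⊆ Metric.closedBall 0 (1 + f (a, b, c)) := by
    rintro ⟨x, y, z⟩ ⟨hx, hy, hz, -, hle'⟩
    have h1 := (hle x y z hx hy hz).trans hle'
    rw [mem_closedBall_zero_iff, Prod.norm_def, Prod.norm_def]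
    simp only [Real.norm_eq_abs]
    have hsq : ∀ t : ℝ, t ^ 2 ≤ f (a, b, c) → |t| ≤ 1 + f (a, b, c) := fun t ht => by
      nlinarith [sq_abs t, sq_nonneg (|t| - 1), abs_nonneg t]
    refine max_le (hsq x ?_) (max_le (hsq y ?_) (hsq z ?_)) <;>
      linarith [sq_nonneg x, sq_nonneg y, sq_nonneg z]
  obtain ⟨⟨x, y, z⟩, ⟨hx, hy, hz, hQ, hxyz⟩, hmin⟩ :=
    ((isCompact_closedBall _ _).of_isClosed_subset hclosed hbdd).exists_isMinOn
      ⟨(a, b, c), ha, hb, hc, h, le_rfl⟩ hf.continuousOn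
  refine ⟨x, y, z, hx, hy, hz, hQ, fun x' y' z' h1 h2 h3 h4 => ?_⟩
  rcases le_or_gt (f (x', y', z')) (f (a, b, c)) with h5 | h5
  · exact isMinOn_iff.1 hmin _ ⟨h1, h2, h3, h4, h5⟩
  · exact hxyz.trans h5.le

/-- A minimum exists by coercivity. On a side of the triangle its value exceeds that of `M₃`; in the
interior it is a critical point, hence `M₃` itself. -/
theorem mcc_le_hyperbolicMoment {a b c : ℝ} (ha : 0 ≤ a) (hb : 0 ≤ b) (hc : 0 ≤ c)
    (h : hypQ a (b + c) (b * c) = 1) : (17 + 4 * √2) / 8 ≤ hyperbolicMoment a b c := by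
  have hcQ : Continuous fun p : ℝ × ℝ × ℝ => hypQ p.1 (p.2.1 + p.2.2) (p.2.1 * p.2.2) := by
    simp only [hypQ]; fun_prop
  have hcf : Continuous fun p : ℝ × ℝ × ℝ => hyperbolicMoment p.1 p.2.1 p.2.2 := by
    simp only [hyperbolicMoment_eq, hypS, hypR]; fun_prop
  obtain ⟨x, y, z, hx, hy, hz, hQ, hmin⟩ := exists_min_octant hcQ hcf (fun x y z hx hy hz => by
    linarith [sq_le_hyperbolicMoment hx hy hz, sq_nonneg x, sq_nonneg y, sq_nonneg z]) ha hb hc h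
  refine le_trans ?_ (hmin a b c ha hb hc h)
  by_cases h0 : x = 0 ∨ y = 0 ∨ z = 0
  · exact (mcc_lt_boundary hx hy hz hQ h0).le
  · push Not at h0
    have hx' := hx.lt_of_ne' h0.1
    have hy' := hy.lt_of_ne' h0.2.1
    have hz' := hz.lt_of_ne' h0.2.2
    have key := (isHyperbolicMin_of_forall_le hx' hy' hz' hmin hQ).eq_mcc hx' hy' hz' hQ
    rw [key.1, key.2.1, key.2.2, hyperbolicMoment_mcc]

theorem eq_mcc_of_hyperbolicMoment_eq {a b c : ℝ} (ha : 0 < a) (hb : 0 < b) (hc : 0 < c)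
    (h : hypQ a (b + c) (b * c) = 1) (heq : hyperbolicMoment a b c = (17 + 4 * √2) / 8) :
    a = mccSide ∧ b = mccSide / √2 ∧ c = mccSide / √2 :=
  (isHyperbolicMin_of_forall_le ha hb hc (fun x y z hx hy hz hQ => by
    rw [heq]; exact mcc_le_hyperbolicMoment hx hy hz hQ) h).eq_mcc ha hb hc h

/-! ### The mean-centered cuboidal lattice and the theorem -/

theorem mccGram_posDef : mccGram.PosDef := by
  have h := mccSide_pos
  obtain ⟨B, hB⟩ := isoPair_hyperbolic h.le (by positivity : 0 ≤ mccSide / √2)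
    (by positivity) mcc_constraint
  rw [mccGram_eq]
  exact hB.posDef

theorem span_range_coe_basis {n : ℕ} {L : Submodule ℤ (EuclideanSpace ℝ (Fin n))}
    (b : Basis (Fin n) ℤ L) :
    Submodule.span ℤ (Set.range fun i => (b i : EuclideanSpace ℝ (Fin n))) = L := by
  have := congrArg (Submodule.map L.subtype) b.span_eq
  rw [Submodule.map_span, ← Set.range_comp, Submodule.map_top, Submodule.range_subtype] at this
  exact this

theorem isMCC_iff {L : Submodule ℤ (EuclideanSpace ℝ (Fin 3))} :
    IsMCC L ↔ ∃ b : Basis (Fin 3) ℝ (EuclideanSpace ℝ (Fin 3)),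
      Submodule.span ℤ (Set.range b) = L ∧ gram ℝ b = mccGram := by
  constructor
  · rintro ⟨b, hb⟩
    have hg : gram ℝ (fun i => (b i : EuclideanSpace ℝ (Fin 3))) = mccGram := by
      ext i j; exact hb i j
    obtain ⟨c, hc⟩ := exists_basis_of_det_gram_ne_zero
      (v := fun i => (b i : EuclideanSpace ℝ (Fin 3)))
      (by rw [hg]; exact mccGram_posDef.det_pos.ne')
    refine ⟨c, ?_, hc ▸ hg⟩
    rw [hc]
    exact span_range_coe_basis b
  · rintro ⟨b, rfl, hb⟩
    refine ⟨b.restrictScalars ℤ, fun i j => ?_⟩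
    rw [Basis.restrictScalars_apply, Basis.restrictScalars_apply, ← hb]
    rfl

theorem exists_isMCC : ∃ M : Submodule ℤ (EuclideanSpace ℝ (Fin 3)), IsMCC M := by
  obtain ⟨b, hb⟩ := exists_basis_gram_eq mccGram_posDef
  exact ⟨_, isMCC_iff.2 ⟨b, rfl, hb⟩⟩

theorem IsMCC.isUnitIsodualLattice {M : Submodule ℤ (EuclideanSpace ℝ (Fin 3))} (h : IsMCC M) :
    IsUnitIsodualLattice M := by
  obtain ⟨b, rfl, hb⟩ := isMCC_iff.1 h
  have h0 := mccSide_pos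
  obtain ⟨B, hB⟩ := isoPair_hyperbolic h0.le (by positivity : 0 ≤ mccSide / √2)
    (by positivity) mcc_constraint
  rw [← mccGram_eq, ← hb] at hB
  exact isUnitIsodualLattice_of_gram b hB.isIsodualGram

theorem IsMCC.secondMoment_eq {M : Submodule ℤ (EuclideanSpace ℝ (Fin 3))} (h : IsMCC M) :
    secondMoment M = (17 + 4 * √2) / 288 := by
  obtain ⟨b, rfl, hb⟩ := isMCC_iff.1 h
  have h0 := mccSide_pos
  rw [secondMoment_hyperbolic h0.le (by positivity) (by positivity) mcc_constraint b
    (hb.trans mccGram_eq), hyperbolicMoment_mcc]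
  ring

theorem secondMoment_ge {L : Submodule ℤ (EuclideanSpace ℝ (Fin 3))}
    (h : IsUnitIsodualLattice L) : (17 + 4 * √2) / 288 ≤ secondMoment L ∧
      (secondMoment L = (17 + 4 * √2) / 288 → IsMCC L) := by
  obtain ⟨v, rfl, ⟨a, b, c, ha, hb, hc, hQ, hv⟩ | ⟨α, β, γ, hα, hβ, hγ, hQ, hv⟩⟩ :=
    exists_reduced_basis h
  · rw [secondMoment_hyperbolic ha.le hb.le hc.le hQ v hv]
    rw [← hypQ_eq] at hQ
    refine ⟨by linarith [mcc_le_hyperbolicMoment ha.le hb.le hc.le hQ], fun heq => ?_⟩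
    obtain ⟨rfl, rfl, rfl⟩ := eq_mcc_of_hyperbolicMoment_eq ha hb hc hQ (by linarith)
    exact isMCC_iff.2 ⟨v, rfl, by rw [hv, mccGram_eq]⟩
  · rw [secondMoment_decomposable hα hβ hγ hQ v hv]
    have := mcc_lt_decomposable hα hβ hγ hQ
    exact ⟨by linarith, fun heq => by linarith⟩

theorem isMCC_of_isLocalMinIsodual {L : Submodule ℤ (EuclideanSpace ℝ (Fin 3))}
    (h : IsUnitIsodualLattice L) (hloc : IsLocalMinIsodual L) : IsMCC L := by
  obtain ⟨v, rfl, ⟨a, b, c, ha, hb, hc, hQ, hv⟩ | ⟨α, β, γ, hα, hβ, hγ, hQ, hv⟩⟩ :=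
    exists_reduced_basis h
  · rw [← hypQ_eq] at hQ
    obtain ⟨rfl, rfl, rfl⟩ :=
      (isHyperbolicMin_of_isLocalMinIsodual v hv hloc ha hb hc hQ).eq_mcc ha hb hc hQ
    exact isMCC_iff.2 ⟨v, rfl, by rw [hv, mccGram_eq]⟩
  · exact absurd hloc (not_isLocalMinIsodual_decomposable hα hβ hγ hQ v hv)

theorem theorem1 :
    (∃ M : Submodule ℤ (EuclideanSpace ℝ (Fin 3)), IsMCC M) ∧
    (∀ M : Submodule ℤ (EuclideanSpace ℝ (Fin 3)), IsMCC M →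
      IsUnitIsodualLattice M ∧
      secondMoment M = (17 + 4 * √2) / 288 ∧
      IsLocalMinIsodual M ∧
      ∀ L : Submodule ℤ (EuclideanSpace ℝ (Fin 3)), IsUnitIsodualLattice L →
        secondMoment M ≤ secondMoment L ∧
        (secondMoment L = secondMoment M → IsMCC L)) ∧
    (∀ L : Submodule ℤ (EuclideanSpace ℝ (Fin 3)), IsUnitIsodualLattice L →
      IsLocalMinIsodual L → IsMCC L) := by
  refine ⟨exists_isMCC, fun M hM => ⟨hM.isUnitIsodualLattice, hM.secondMoment_eq, ?_, ?_⟩,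
    fun L hL hloc => isMCC_of_isLocalMinIsodual hL hloc⟩
  -- Local minimality is immediate from global minimality.
  · intro b
    filter_upwards [self_mem_nhdsWithin] with v hv
    rw [span_range_coe_basis b, hM.secondMoment_eq]
    exact (secondMoment_ge hv).1
  · intro L hL
    rw [hM.secondMoment_eq]
    exact secondMoment_ge hL
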